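/- **Lemma.** Let $D, E \subset \mathbb{P}^1(\overline{\mathbb{Q}})$ be disjoint finite sets with $\infty \in D$; write $D = \{\infty, d_1, \dots, d_m\}$ and $E = \{e_1, \dots, e_n\}$ with $d_i, e_j \in \overline{\mathbb{Q}} \subset \mathbb{C}$, and for all $i, j$ fix a branch $\lambda_{ij}$ of $\log(e_j - d_i)$, that is, a complex number with $\exp(\lambda_{ij}) = e_j - d_i$. Classes in $H^1_{\mathrm{AdR}}(\mathbb{P}^1\setminus D, E)$ are represented by pairs $(a,\omega)$, where $a\colon E \to \overline{\mathbb{Q}}$ is a function and $\omega$ is a regular algebraic differential on $\mathbb{P}^1 \setminus D$ over $\overline{\mathbb{Q}}$, modulo the pairs $(-f|_E, \mathrm{d}f)$ with $f$ regular on $\mathbb{P}^1\setminus D$. Classes in $H_1(\mathbb{P}^1\setminus D, E;\mathbb{Z})$ are represented by integral combinations $\gamma$ of oriented line segments in $\mathbb{C}\setminus\{d_1,\dots,d_m\}$ with $\partial\gamma$ supported on $E$, modulo boundaries of affine triangles contained in $\mathbb{C}\setminus\{d_1,\dots,d_m\}$. The period of the two classes is $$\int_\gamma (a,\omega) = a(\partial\gamma)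 + \int_\gamma \omega .$$ There is an algorithm which takes as input $D$, $E$, the branches $\lambda_{ij}$, a finite list of representatives $(a_r,\omega_r)$ and a finite list of representatives $\gamma_s$ whose segments have algebraic end points (in particular, representatives of bases of the two spaces), terminates on every such input, and returns for each pair $(s,r)$ explicit algebraic numbers $c, c', c_{ij}$ such that $$\int_{\gamma_s} (a_r,\omega_r) = c + c'\cdot 2\pi \mathrm{i} + \sum_{i=1}^m\sum_{j=1}^n c_{ij}\,\lambda_{ij} .$$ In the input and in the output, all algebraic numbers are given exactly, as polynomials with rational coefficients in a generator $\theta$ of a number field $\mathbb{Q}(\theta)\subset\mathbb{C}$ containing all the algebraic numbers of the input. The generator $\theta$ is given by an irreducible integer polynomial together with a disc with rational centre and radius in which $\theta$ is its only root. Each branch $\lambda_{ij}$ is specified by a point of $\mathbb{Q}(\mathrm{i})$ at distance less than $1$ from it. -/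

import Mathlib

open scoped Polynomial

noncomputable section

namespace BakerPeriod

/-! ### The punctured line, its regular functions, and relative de Rham cohomology

The finite points of `D` form a family `d : Fin m ↪ Qbar`, and the point at infinity always belongs
to `D`; the points of `E` form a family `e : Fin n ↪ Qbar`. So `ℙ¹ ∖ D` is the affine line without
the points `d i`. -/

/-- The field of algebraic numbers, as a subfield of `ℂ`. -/
abbrev Qbar : Type := ↥(algebraicClosure ℚ ℂ)

variable {m n : ℕ}

/-- The complex points of `ℙ¹ ∖ D`. -/
def puncturedLine (d : Fin m ↪ Qbar) : Set ℂ := (Set.range fun i => (d i : ℂ))ᶜ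

/-- The value at a complex point of a rational function with algebraic coefficients. -/
def evalC (f : RatFunc Qbar) (z : ℂ) : ℂ := RatFunc.eval (algebraMap Qbar ℂ) z f

/-- The derivative `df/dx` of a rational function, by the quotient rule. -/
def ratDeriv (f : RatFunc Qbar) : RatFunc Qbar :=
  algebraMap Qbar[X] (RatFunc Qbar)
      (Polynomial.derivative f.num * f.denom - f.num * Polynomial.derivative f.denom) /
    algebraMap Qbar[X] (RatFunc Qbar) (f.denom ^ 2)

/-- The regular functions on `ℙ¹ ∖ D` over `Qbar`: rational functions without poles there. -/
def regularFunctions (d : Fin m ↪ Qbar) : Submodule Qbar (RatFunc Qbar) where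
  carrier := {f | ∀ z ∈ puncturedLine d, f.denom.eval₂ (algebraMap Qbar ℂ) z ≠ 0}
  zero_mem' := by
    intro z _
    simp
  add_mem' := by
    intro f g hf hg z hz h0
    obtain ⟨q, hq⟩ := RatFunc.denom_add_dvd f g
    have := congrArg (Polynomial.eval₂ (algebraMap Qbar ℂ) z) hq
    rw [Polynomial.eval₂_mul, Polynomial.eval₂_mul, h0, zero_mul] at this
    exact mul_ne_zero (hf z hz) (hg z hz) this
  smul_mem' := by
    intro c f hf z hz h0
    have hc : c • f = RatFunc.C c * f := RatFunc.smul_eq_C_mul c f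
    rw [hc] at h0
    obtain ⟨q, hq⟩ := RatFunc.denom_mul_dvd (RatFunc.C c) f
    have := congrArg (Polynomial.eval₂ (algebraMap Qbar ℂ) z) hq
    rw [Polynomial.eval₂_mul, Polynomial.eval₂_mul, h0, zero_mul] at this
    refine hf z hz ?_
    simpa using this

/-- Cocycles for the algebraic de Rham cohomology of `(ℙ¹ ∖ D, E)`: pairs `(a, f)`, standing for
`(a, ω)` with `a` a function on `E` and `ω = f dx` a regular differential on `ℙ¹ ∖ D`. -/
abbrev DeRhamCocycle (d : Fin m ↪ Qbar) (_e : Fin n ↪ Qbar) : Type :=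
  (Fin n → Qbar) × regularFunctions d

/-- The exact cocycles: those of the form `(-f|_E, df)` for `f` regular on `ℙ¹ ∖ D`. -/
def exactCocycles (d : Fin m ↪ Qbar) (e : Fin n ↪ Qbar) :
    Submodule Qbar (DeRhamCocycle d e) :=
  Submodule.span Qbar {x | ∃ f ∈ regularFunctions d,
    (∀ j, x.1 j = -RatFunc.eval (RingHom.id Qbar) (e j) f) ∧
      (x.2 : RatFunc Qbar) = ratDeriv f}

/-- The first algebraic de Rham cohomology `H¹_AdR(ℙ¹ ∖ D, E)`, a vector space over `Qbar`. -/
abbrev DeRhamH1 (d : Fin m ↪ Qbar) (e : Fin n ↪ Qbar) : Type :=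
  DeRhamCocycle d e ⧸ exactCocycles d e

/-! ### Relative Betti homology, through affine simplices -/

/-- Formal `ℤ`-linear combinations of oriented line segments `(z, w)` in the plane. -/
abbrev SegmentChain : Type := (ℂ × ℂ) →₀ ℤ

/-- The boundary of `(z, w)` is `w - z`. -/
def boundary : SegmentChain →ₗ[ℤ] (ℂ →₀ ℤ) :=
  Finsupp.lmapDomain ℤ ℤ Prod.snd - Finsupp.lmapDomain ℤ ℤ Prod.fst

/-- Relative `1`-cycles of `(ℙ¹ ∖ D, E)`: combinations of segments contained in `ℙ¹ ∖ D` whose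
boundary is supported on `E`. -/
def relCycles (d : Fin m ↪ Qbar) (e : Fin n ↪ Qbar) : Submodule ℤ SegmentChain :=
  Finsupp.supported ℤ ℤ {s : ℂ × ℂ | segment ℝ s.1 s.2 ⊆ puncturedLine d} ⊓
    (Finsupp.supported ℤ ℤ (Set.range fun j => (e j : ℂ))).comap boundary

/-- The boundary of the affine triangle with vertices `u`, `v`, `w`. -/
def triangleBoundary (u v w : ℂ) : SegmentChain :=
  Finsupp.single (v, w) 1 - Finsupp.single (u, w) 1 + Finsupp.single (u, v) 1

/-- The boundaries of the affine (possibly degenerate) triangles contained in `ℙ¹ ∖ D`. The constant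
segments at points of `E` are among them. -/
def boundaries (d : Fin m ↪ Qbar) : Submodule ℤ SegmentChain :=
  Submodule.span ℤ {c | ∃ u v w : ℂ, convexHull ℝ {u, v, w} ⊆ puncturedLine d ∧
    c = triangleBoundary u v w}

/-- The Betti homology `H₁(ℙ¹ ∖ D, E; ℤ)`, computed by affine simplices. -/
abbrev BettiH1 (d : Fin m ↪ Qbar) (e : Fin n ↪ Qbar) : Type :=
  relCycles d e ⧸ (boundaries d).comap (relCycles d e).subtype

/-! ### The period pairing -/

/-- The integral of `f dx` along the segment from `z` to `w`. -/
def segmentIntegral (f : RatFunc Qbar) (s : ℂ × ℂ) : ℂ :=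
  ∫ t in (0 : ℝ)..1, evalC f (s.1 + t * (s.2 - s.1)) * (s.2 - s.1)

/-- The integral of `f dx` along a chain of segments. -/
def chainIntegral (f : RatFunc Qbar) : SegmentChain →ₗ[ℤ] ℂ :=
  Finsupp.linearCombination ℤ (segmentIntegral f)

/-- The evaluation `a(c)` of a function `a` on `E` at a `0`-chain `c`. -/
def evalZeroChain (e : Fin n ↪ Qbar) (a : Fin n → Qbar) (c : ℂ →₀ ℤ) : ℂ :=
  ∑ j, (c (e j : ℂ) : ℂ) * (a j : ℂ)

/-- The period `∫_γ (a, ω) = a(∂γ) + ∫_γ ω` of a cocycle along a relative cycle. -/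
def period {d : Fin m ↪ Qbar} {e : Fin n ↪ Qbar} (γ : relCycles d e) (x : DeRhamCocycle d e) : ℂ :=
  evalZeroChain e x.1 (boundary γ) + chainIntegral x.2 γ

/-! The period depends only on the two classes. -/

lemma evalC_add {d : Fin m ↪ Qbar} {f g : RatFunc Qbar} (hf : f ∈ regularFunctions d)
    (hg : g ∈ regularFunctions d) {z : ℂ} (hz : z ∈ puncturedLine d) :
    evalC (f + g) z = evalC f z + evalC g z :=
  RatFunc.eval_add _ _ (hf z hz) (hg z hz)

lemma evalC_smul {d : Fin m ↪ Qbar} {f : RatFunc Qbar} (hf : f ∈ regularFunctions d) (c : Qbar)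
    {z : ℂ} (hz : z ∈ puncturedLine d) : evalC (c • f) z = (c : ℂ) * evalC f z := by
  rw [RatFunc.smul_eq_C_mul, evalC, RatFunc.eval_mul _ _ (by simp) (hf z hz), RatFunc.eval_C]
  rfl

lemma eval_of_div {f : RatFunc Qbar} {p q : Qbar[X]} {z : ℂ}
    (hf : f = algebraMap Qbar[X] (RatFunc Qbar) p / algebraMap Qbar[X] (RatFunc Qbar) q)
    (hq : q.eval₂ (algebraMap Qbar ℂ) z ≠ 0) :
    evalC f z = p.eval₂ (algebraMap Qbar ℂ) z / q.eval₂ (algebraMap Qbar ℂ) z := by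
  have hq0 : q ≠ 0 := by
    rintro rfl
    simp at hq
  obtain ⟨r, hr⟩ : f.denom ∣ q := hf ▸ RatFunc.denom_div_dvd p q
  have hd : f.denom.eval₂ (algebraMap Qbar ℂ) z ≠ 0 := by
    intro h
    rw [hr, Polynomial.eval₂_mul, h, zero_mul] at hq
    exact hq rfl
  have hx : f.num * q = p * f.denom := by
    have := RatFunc.num_div_dvd p hq0
    have h1 := RatFunc.num_div_denom f
    have inj := RatFunc.algebraMap_injective Qbar
    apply inj
    rw [map_mul, map_mul]
    have a1 : algebraMap Qbar[X] (RatFunc Qbar) q ≠ 0 := by simpa using hq0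
    have a2 : algebraMap Qbar[X] (RatFunc Qbar) f.denom ≠ 0 := by simpa using f.denom_ne_zero
    rw [← div_eq_div_iff a2 a1, h1, hf]
  have hx' := congrArg (Polynomial.eval₂ (algebraMap Qbar ℂ) z) hx
  rw [Polynomial.eval₂_mul, Polynomial.eval₂_mul] at hx'
  rw [evalC, RatFunc.eval, div_eq_div_iff hd hq, hx']

lemma hasDerivAt_evalC {d : Fin m ↪ Qbar} {f : RatFunc Qbar} (hf : f ∈ regularFunctions d)
    {z : ℂ} (hz : z ∈ puncturedLine d) : HasDerivAt (evalC f) (evalC (ratDeriv f) z) z := by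
  have hd := hf z hz
  have key : ∀ p : Qbar[X], HasDerivAt (fun w => p.eval₂ (algebraMap Qbar ℂ) w)
      ((Polynomial.derivative p).eval₂ (algebraMap Qbar ℂ) z) z := by
    intro p
    have h := (p.map (algebraMap Qbar ℂ)).hasDerivAt z
    simpa [Polynomial.derivative_map, Polynomial.eval_map] using h
  rw [eval_of_div (f := ratDeriv f) rfl (by rw [Polynomial.eval₂_pow]; exact pow_ne_zero 2 hd)]
  rw [Polynomial.eval₂_sub, Polynomial.eval₂_mul, Polynomial.eval₂_mul, Polynomial.eval₂_pow]
  exact (key f.num).div (key f.denom) hd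

lemma continuousOn_evalC {d : Fin m ↪ Qbar} {f : RatFunc Qbar} (hf : f ∈ regularFunctions d) :
    ContinuousOn (evalC f) (puncturedLine d) :=
  fun _ hz => (hasDerivAt_evalC hf hz).continuousAt.continuousWithinAt

lemma mem_segment_param {z w : ℂ} {t : ℝ} (ht : t ∈ Set.Icc (0 : ℝ) 1) :
    z + t * (w - z) ∈ segment ℝ z w := by
  rw [segment_eq_image']
  exact ⟨t, ht, by simp⟩

lemma continuousOn_integrand {d : Fin m ↪ Qbar} {f : RatFunc Qbar} (hf : f ∈ regularFunctions d)
    {s : ℂ × ℂ} (hs : segment ℝ s.1 s.2 ⊆ puncturedLine d) :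
    ContinuousOn (fun t : ℝ => evalC f (s.1 + t * (s.2 - s.1)) * (s.2 - s.1))
      (Set.Icc (0 : ℝ) 1) := by
  refine ContinuousOn.mul ?_ continuousOn_const
  refine (continuousOn_evalC hf).comp (by fun_prop) ?_
  intro t ht
  exact hs (mem_segment_param ht)

lemma intervalIntegrable_integrand {d : Fin m ↪ Qbar} {f : RatFunc Qbar}
    (hf : f ∈ regularFunctions d) {s : ℂ × ℂ} (hs : segment ℝ s.1 s.2 ⊆ puncturedLine d) :
    IntervalIntegrable (fun t : ℝ => evalC f (s.1 + t * (s.2 - s.1)) * (s.2 - s.1))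
      MeasureTheory.volume 0 1 :=
  ContinuousOn.intervalIntegrable_of_Icc zero_le_one (continuousOn_integrand hf hs)

lemma segmentIntegral_add {d : Fin m ↪ Qbar} {f g : RatFunc Qbar} (hf : f ∈ regularFunctions d)
    (hg : g ∈ regularFunctions d) {s : ℂ × ℂ} (hs : segment ℝ s.1 s.2 ⊆ puncturedLine d) :
    segmentIntegral (f + g) s = segmentIntegral f s + segmentIntegral g s := by
  rw [segmentIntegral, segmentIntegral, segmentIntegral, ← intervalIntegral.integral_add
    (intervalIntegrable_integrand hf hs) (intervalIntegrable_integrand hg hs)]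
  refine intervalIntegral.integral_congr fun t ht => ?_
  rw [Set.uIcc_of_le zero_le_one] at ht
  rw [evalC_add hf hg (hs (mem_segment_param ht)), add_mul]

lemma segmentIntegral_smul {d : Fin m ↪ Qbar} {f : RatFunc Qbar} (hf : f ∈ regularFunctions d)
    (c : Qbar) {s : ℂ × ℂ} (hs : segment ℝ s.1 s.2 ⊆ puncturedLine d) :
    segmentIntegral (c • f) s = (c : ℂ) * segmentIntegral f s := by
  rw [segmentIntegral, segmentIntegral, ← intervalIntegral.integral_const_mul]
  refine intervalIntegral.integral_congr fun t ht => ?_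
  rw [Set.uIcc_of_le zero_le_one] at ht
  rw [evalC_smul hf c (hs (mem_segment_param ht)), mul_assoc]

/-- The fundamental theorem of calculus along a segment in a convex set. -/
lemma segmentIntegral_eq_sub {d : Fin m ↪ Qbar} {f : RatFunc Qbar} (hf : f ∈ regularFunctions d)
    {K : Set ℂ} (hK : Convex ℝ K) (hKd : K ⊆ puncturedLine d) {g : ℂ → ℂ}
    (hg : ∀ a ∈ K, HasDerivWithinAt g (evalC f a) K a) {s : ℂ × ℂ} (h1 : s.1 ∈ K) (h2 : s.2 ∈ K) :
    segmentIntegral f s = g s.2 - g s.1 := by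
  have hsK : segment ℝ s.1 s.2 ⊆ K := hK.segment_subset h1 h2
  have hmaps : Set.MapsTo (fun t : ℝ => s.1 + t * (s.2 - s.1)) (Set.Icc 0 1) K :=
    fun t ht => hsK (mem_segment_param ht)
  have hder : ∀ t ∈ Set.Icc (0 : ℝ) 1,
      HasDerivWithinAt (fun t : ℝ => g (s.1 + t * (s.2 - s.1)))
        (evalC f (s.1 + t * (s.2 - s.1)) * (s.2 - s.1)) (Set.Icc 0 1) t := by
    intro t ht
    have hl : HasDerivWithinAt (fun t : ℝ => s.1 + t * (s.2 - s.1)) (s.2 - s.1)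
        (Set.Icc (0 : ℝ) 1) t := by
      have := ((Complex.ofRealCLM.hasDerivAt (x := t)).mul_const (s.2 - s.1)).const_add s.1
      simpa using this.hasDerivWithinAt
    exact (hg _ (hmaps ht)).comp t hl hmaps
  have := intervalIntegral.integral_eq_sub_of_hasDerivAt_of_le (zero_le_one' ℝ)
    (fun t ht => (hder t ht).continuousWithinAt)
    (fun t ht => (hder t (Set.Ioo_subset_Icc_self ht)).hasDerivAt (Icc_mem_nhds ht.1 ht.2))
    (intervalIntegrable_integrand hf (hsK.trans hKd))
  rw [segmentIntegral, this]
  simp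

lemma chainIntegral_triangle {d : Fin m ↪ Qbar} {f : RatFunc Qbar} (hf : f ∈ regularFunctions d)
    {u v w : ℂ} (h : convexHull ℝ {u, v, w} ⊆ puncturedLine d) :
    chainIntegral f (triangleBoundary u v w) = 0 := by
  have hK := convex_convexHull ℝ ({u, v, w} : Set ℂ)
  obtain ⟨g, hg⟩ := hK.exists_forall_hasDerivWithinAt (𝕜 := ℂ) (f := evalC f)
    (fun z hz => (hasDerivAt_evalC hf (h hz)).differentiableAt.differentiableWithinAt)
  have hu : u ∈ convexHull ℝ ({u, v, w} : Set ℂ) := subset_convexHull ℝ _ (by simp)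
  have hv : v ∈ convexHull ℝ ({u, v, w} : Set ℂ) := subset_convexHull ℝ _ (by simp)
  have hw : w ∈ convexHull ℝ ({u, v, w} : Set ℂ) := subset_convexHull ℝ _ (by simp)
  simp only [chainIntegral, triangleBoundary, map_add, map_sub,
    Finsupp.linearCombination_single, one_smul]
  rw [segmentIntegral_eq_sub hf hK h hg (s := (v, w)) hv hw,
    segmentIntegral_eq_sub hf hK h hg (s := (u, w)) hu hw,
    segmentIntegral_eq_sub hf hK h hg (s := (u, v)) hu hv]
  ring

lemma boundary_triangle (u v w : ℂ) : boundary (triangleBoundary u v w) = 0 := by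
  simp only [boundary, triangleBoundary, LinearMap.sub_apply, map_add, map_sub,
    Finsupp.lmapDomain_apply, Finsupp.mapDomain_single]
  abel

lemma chainIntegral_add {d : Fin m ↪ Qbar} {f g : RatFunc Qbar} (hf : f ∈ regularFunctions d)
    (hg : g ∈ regularFunctions d) {c : SegmentChain}
    (hc : c ∈ Finsupp.supported ℤ ℤ {s : ℂ × ℂ | segment ℝ s.1 s.2 ⊆ puncturedLine d}) :
    chainIntegral (f + g) c = chainIntegral f c + chainIntegral g c := by
  simp only [chainIntegral, Finsupp.linearCombination_apply, Finsupp.sum]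
  rw [← Finset.sum_add_distrib]
  refine Finset.sum_congr rfl fun s hs => ?_
  rw [segmentIntegral_add hf hg (hc hs), smul_add]

lemma chainIntegral_smul {d : Fin m ↪ Qbar} {f : RatFunc Qbar} (hf : f ∈ regularFunctions d)
    (a : Qbar) {c : SegmentChain}
    (hc : c ∈ Finsupp.supported ℤ ℤ {s : ℂ × ℂ | segment ℝ s.1 s.2 ⊆ puncturedLine d}) :
    chainIntegral (a • f) c = (a : ℂ) * chainIntegral f c := by
  simp only [chainIntegral, Finsupp.linearCombination_apply, Finsupp.sum]
  rw [Finset.mul_sum]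
  refine Finset.sum_congr rfl fun s hs => ?_
  rw [segmentIntegral_smul hf a (hc hs), mul_smul_comm]

/-- The integral of `df` along a chain is the value of `f` at its boundary. -/
lemma chainIntegral_ratDeriv {d : Fin m ↪ Qbar} {f : RatFunc Qbar} (hf : f ∈ regularFunctions d)
    (hf' : ratDeriv f ∈ regularFunctions d) {c : SegmentChain}
    (hc : c ∈ Finsupp.supported ℤ ℤ {s : ℂ × ℂ | segment ℝ s.1 s.2 ⊆ puncturedLine d}) :
    chainIntegral (ratDeriv f) c = Finsupp.linearCombination ℤ (evalC f) (boundary c) := by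
  have h1 : Finsupp.linearCombination ℤ (evalC f) (boundary c) =
      Finsupp.linearCombination ℤ (fun s : ℂ × ℂ => evalC f s.2 - evalC f s.1) c := by
    have h2 : Finsupp.linearCombination ℤ (evalC f) ∘ₗ boundary =
        Finsupp.linearCombination ℤ (fun s : ℂ × ℂ => evalC f s.2 - evalC f s.1) := by
      ext s
      simp [boundary]
    exact LinearMap.congr_fun h2 c
  rw [h1]
  simp only [chainIntegral, Finsupp.linearCombination_apply, Finsupp.sum]
  refine Finset.sum_congr rfl fun s hs => ?_
  rw [segmentIntegral_eq_sub hf' (convex_segment s.1 s.2) (hc hs)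
    (fun a ha => (hasDerivAt_evalC hf (hc hs ha)).hasDerivWithinAt)
    (left_mem_segment ℝ _ _) (right_mem_segment ℝ _ _)]

lemma evalC_algebraic (f : RatFunc Qbar) (a : Qbar) :
    ((RatFunc.eval (RingHom.id Qbar) a f : Qbar) : ℂ) = evalC f (a : ℂ) := by
  have key : ∀ p : Qbar[X], ((p.eval₂ (RingHom.id Qbar) a : Qbar) : ℂ) =
      p.eval₂ (algebraMap Qbar ℂ) (a : ℂ) := fun p =>
    Polynomial.hom_eval₂ p (RingHom.id Qbar) (algebraMap Qbar ℂ) a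
  rw [evalC, RatFunc.eval, RatFunc.eval, ← key, ← key]
  push_cast
  rfl

/-- The period along a fixed relative cycle, as a linear form on cocycles. -/
def periodForm {d : Fin m ↪ Qbar} {e : Fin n ↪ Qbar} (γ : relCycles d e) :
    DeRhamCocycle d e →ₗ[Qbar] ℂ where
  toFun x := period γ x
  map_add' x y := by
    simp only [period, evalZeroChain, Prod.fst_add, Prod.snd_add, Submodule.coe_add, Pi.add_apply]
    rw [chainIntegral_add x.2.2 y.2.2 γ.2.1]
    push_cast
    simp only [mul_add, Finset.sum_add_distrib]
    ring
  map_smul' a x := by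
    simp only [period, evalZeroChain, Prod.smul_fst, Prod.smul_snd, Submodule.coe_smul,
      Pi.smul_apply, smul_eq_mul, RingHom.id_apply]
    rw [chainIntegral_smul x.2.2 a γ.2.1, Algebra.smul_def, mul_add, Finset.mul_sum]
    congr 1
    refine Finset.sum_congr rfl fun j _ => ?_
    change _ * ((a : ℂ) * (x.1 j : ℂ)) = (a : ℂ) * _
    ring

lemma periodForm_exact {d : Fin m ↪ Qbar} {e : Fin n ↪ Qbar} (γ : relCycles d e) :
    exactCocycles d e ≤ LinearMap.ker (periodForm γ) := by
  refine Submodule.span_le.2 ?_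
  rintro x ⟨f, hf, hx1, hx2⟩
  have hf' : ratDeriv f ∈ regularFunctions d := hx2 ▸ x.2.2
  change period γ x = 0
  rw [period, hx2, chainIntegral_ratDeriv hf hf' γ.2.1, Finsupp.linearCombination_apply,
    evalZeroChain]
  have hinj : Function.Injective fun j => (e j : ℂ) := fun i j h => e.injective (Subtype.ext h)
  have hsupp : (boundary (γ : SegmentChain)).support ⊆
      Finset.univ.map ⟨fun j => (e j : ℂ), hinj⟩ := by
    intro z hz
    obtain ⟨j, hj⟩ := γ.2.2 hz
    simpa using ⟨j, hj⟩
  rw [Finsupp.sum_of_support_subset _ hsupp _ (by simp), Finset.sum_map,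
    ← Finset.sum_add_distrib]
  refine Finset.sum_eq_zero fun j _ => ?_
  have : ((x.1 j : Qbar) : ℂ) = -evalC f (e j : ℂ) := by
    rw [hx1 j, ← evalC_algebraic f (e j)]
    push_cast
    rfl
  simp [this]

/-- The period along a fixed relative cycle, as a linear form on cohomology classes. -/
def periodOfCycle (d : Fin m ↪ Qbar) (e : Fin n ↪ Qbar) :
    relCycles d e →ₗ[ℤ] (DeRhamH1 d e →ₗ[Qbar] ℂ) where
  toFun γ := (exactCocycles d e).liftQ (periodForm γ) (periodForm_exact γ)
  map_add' γ δ := by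
    apply Submodule.linearMap_qext
    apply LinearMap.ext
    intro x
    change period (γ + δ) x = period γ x + period δ x
    simp only [period, evalZeroChain, Submodule.coe_add, map_add, Finsupp.add_apply, Int.cast_add,
      add_mul, Finset.sum_add_distrib]
    ring
  map_smul' k γ := by
    apply Submodule.linearMap_qext
    apply LinearMap.ext
    intro x
    change period (k • γ) x = k • period γ x
    simp only [period, evalZeroChain, Submodule.coe_smul, map_smul, Finsupp.smul_apply, smul_add,
      Finset.smul_sum, zsmul_eq_mul, smul_eq_mul, Int.cast_mul, mul_assoc]

lemma periodOfCycle_boundaries (d : Fin m ↪ Qbar) (e : Fin n ↪ Qbar) :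
    (boundaries d).comap (relCycles d e).subtype ≤ LinearMap.ker (periodOfCycle d e) := by
  rintro ⟨c, hc⟩ hb
  have h1 : boundary c = 0 := by
    have : boundaries d ≤ LinearMap.ker boundary := by
      refine Submodule.span_le.2 ?_
      rintro _ ⟨u, v, w, _, rfl⟩
      exact boundary_triangle u v w
    exact this hb
  have h2 : ∀ f ∈ regularFunctions d, chainIntegral f c = 0 := by
    intro f hf
    have : boundaries d ≤ LinearMap.ker (chainIntegral f) := by
      refine Submodule.span_le.2 ?_
      rintro _ ⟨u, v, w, h, rfl⟩
      exact chainIntegral_triangle hf h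
    exact this hb
  apply Submodule.linearMap_qext
  apply LinearMap.ext
  intro x
  change period ⟨c, hc⟩ x = 0
  simp [period, evalZeroChain, h1, h2 x.2 x.2.2]

/-- The period pairing `H₁(ℙ¹ ∖ D, E; ℤ) × H¹_AdR(ℙ¹ ∖ D, E) → ℂ`. -/
def periodPairing (d : Fin m ↪ Qbar) (e : Fin n ↪ Qbar) :
    BettiH1 d e →ₗ[ℤ] (DeRhamH1 d e →ₗ[Qbar] ℂ) :=
  Submodule.liftQ _ (periodOfCycle d e) (periodOfCycle_boundaries d e)

/-- On representatives, the period pairing is the period `a(∂γ) + ∫_γ ω`. -/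
lemma periodPairing_mk (d : Fin m ↪ Qbar) (e : Fin n ↪ Qbar) (γ : relCycles d e)
    (x : DeRhamCocycle d e) :
    periodPairing d e (Submodule.Quotient.mk γ) (Submodule.Quotient.mk x) = period γ x :=
  rfl

/-! ### Finite encodings of the data

All the algebraic numbers in the data are given in one number field `ℚ(θ) ⊂ ℂ`. -/

/-- `(a, b)` encodes the rational number `a / (b + 1)`. -/
abbrev RatCode : Type := ℤ × ℕ

/-- The rational number with a given code. -/
def ratVal (q : RatCode) : ℚ := (q.1 : ℚ) / ((q.2 : ℚ) + 1)

/-- A complex number with rational real and imaginary parts. -/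
abbrev GaussCode : Type := RatCode × RatCode

/-- The complex number with a given code. -/
def gaussVal (q : GaussCode) : ℂ := (ratVal q.1 : ℂ) + (ratVal q.2 : ℂ) * Complex.I

/-- The code of an embedded number field `ℚ(θ)`: an integer polynomial (coefficients in increasing
degree), and the centre and the radius of a disc that isolates the root `θ`. -/
abbrev FieldCode : Type := List ℤ × GaussCode × RatCode

/-- The polynomial with given integer coefficients. -/
def intPoly (l : List ℤ) : ℚ[X] :=
  l.foldr (fun a p => Polynomial.C (a : ℚ) + Polynomial.X * p) 0

/-- The code `(p, c, r)` represents `θ`: `p` is irreducible over `ℚ`, and `θ` is the only root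
of `p` in the open disc with centre `c` and radius `r`. -/
def FieldRepresents (F : FieldCode) (θ : Qbar) : Prop :=
  Irreducible (intPoly F.1) ∧
    ∀ z : ℂ, (Polynomial.aeval z (intPoly F.1) = 0 ∧ ‖z - gaussVal F.2.1‖ < (ratVal F.2.2 : ℝ)) ↔
      z = (θ : ℂ)

/-- An element of `ℚ(θ)`, given as a polynomial in `θ` with rational coefficients (in increasing
degree). -/
abbrev NumCode : Type := List RatCode

/-- The algebraic number with a given code. -/
def numVal (θ : Qbar) (c : NumCode) : Qbar :=
  c.foldr (fun q x => algebraMap ℚ Qbar (ratVal q) + θ * x) 0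

/-- A polynomial with coefficients in `ℚ(θ)` (in increasing degree). -/
abbrev PolyCode : Type := List NumCode

/-- The polynomial with a given code. -/
def polyVal (θ : Qbar) (c : PolyCode) : Qbar[X] :=
  c.foldr (fun q p => Polynomial.C (numVal θ q) + Polynomial.X * p) 0

/-- A pair `(a, P/Q dx)`: the values of `a` at the points of `E`, then `P` and `Q`. -/
abbrev FormCode : Type := List NumCode × PolyCode × PolyCode

/-- A chain of segments: a list of segments `(z, w)` with integer multiplicities. -/
abbrev ChainCode : Type := List (ℤ × NumCode × NumCode)

/-- The list `l` represents the family `v` entrywise. -/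
def ListRepresents {α β : Type} (R : α → β → Prop) {k : ℕ} (l : List α) (v : Fin k → β) : Prop :=
  List.Forall₂ R l (List.ofFn v)

/-- The code `c` represents the algebraic number `x`. -/
def NumRepresents (θ : Qbar) (c : NumCode) (x : Qbar) : Prop := numVal θ c = x

/-- A branch `λ` of a logarithm is specified by a rational point at distance less than `1`; as the
branches differ by multiples of `2πi`, this determines `λ`. -/
def BranchRepresents (q : GaussCode) (l : ℂ) : Prop := ‖l - gaussVal q‖ < 1

/-- The code `c` represents the cocycle `x`. -/
def FormRepresents (θ : Qbar) {d : Fin m ↪ Qbar} {e : Fin n ↪ Qbar} (c : FormCode)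
    (x : DeRhamCocycle d e) : Prop :=
  ListRepresents (NumRepresents θ) c.1 x.1 ∧ polyVal θ c.2.2 ≠ 0 ∧
    (x.2 : RatFunc Qbar) = algebraMap Qbar[X] (RatFunc Qbar) (polyVal θ c.2.1) /
      algebraMap Qbar[X] (RatFunc Qbar) (polyVal θ c.2.2)

/-- The code `c` represents the relative cycle `γ`: each listed segment lies in `ℙ¹ ∖ D`, and `γ` is
the sum of the listed segments with their multiplicities. -/
def ChainRepresents (θ : Qbar) {d : Fin m ↪ Qbar} {e : Fin n ↪ Qbar} (c : ChainCode)
    (γ : relCycles d e) : Prop :=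
  (∀ s ∈ c, segment ℝ (numVal θ s.2.1 : ℂ) (numVal θ s.2.2 : ℂ) ⊆ puncturedLine d) ∧
    (γ : SegmentChain) = (c.map fun s =>
      Finsupp.single ((numVal θ s.2.1 : ℂ), (numVal θ s.2.2 : ℂ)) s.1).sum

/-- The input of the algorithm: the number field, the finite points of `D`, the points of `E`, the
branches of `log (e_j - d_i)` (a list over `i` of lists over `j`), the representatives of de Rham
classes, and the representatives of Betti classes. -/
abbrev InputCode : Type :=
  FieldCode × List NumCode × List NumCode × List (List GaussCode) × List FormCode × List ChainCode

/-- The input `x` represents the given points, branches, cocycles and relative cycles, with all the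
algebraic numbers involved written in terms of the generator `θ`. -/
def InputRepresents (x : InputCode) (θ : Qbar) {k l : ℕ} (d : Fin m ↪ Qbar) (e : Fin n ↪ Qbar)
    (L : Fin m → Fin n → ℂ) (ω : Fin k → DeRhamCocycle d e) (γ : Fin l → relCycles d e) : Prop :=
  FieldRepresents x.1 θ ∧
    ListRepresents (NumRepresents θ) x.2.1 d ∧
    ListRepresents (NumRepresents θ) x.2.2.1 e ∧
    ListRepresents (fun row v => ListRepresents BranchRepresents row v) x.2.2.2.1 L ∧
    ListRepresents (FormRepresents θ) x.2.2.2.2.1 ω ∧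
    ListRepresents (ChainRepresents θ) x.2.2.2.2.2 γ

/-- An expression in standard form: the coefficients of `1`, of `2πi`, and of the `log (e_j - d_i)`
(a list over `i` of lists over `j`). -/
abbrev StandardFormCode : Type := NumCode × NumCode × List (List NumCode)

/-- The complex number `z` is given by an expression in standard form, with respect to the
branches `L i j` of `log (e_j - d_i)`. -/
def StandardFormRepresents (θ : Qbar) (L : Fin m → Fin n → ℂ) (c : StandardFormCode) (z : ℂ) :
    Prop :=
  ∃ b : Fin m → Fin n → Qbar,
    ListRepresents (fun row v => ListRepresents (NumRepresents θ) row v) c.2.2 b ∧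
    z = (numVal θ c.1 : ℂ) + (numVal θ c.2.1 : ℂ) * (2 * (Real.pi : ℂ) * Complex.I) +
      ∑ i, ∑ j, (b i j : ℂ) * L i j

/-- A matrix of expressions in standard form, as a list of rows. -/
abbrev MatrixCode : Type := List (List StandardFormCode)

end BakerPeriod

end

/-! The algorithm is an unbounded search for a certificate. Being a matrix of certified entries is a
semidecidable property, uniformly in the code of the number field ℚ(θ) (`SD.matrixCert`). Every
valid input has a certified matrix (`exists_certifies`), and a certified entry is a correct standard
form of its period (`Certifies.standardFormRepresents`). So the search, which is partial recursive
by `SD.exists_partrec`, stops on every valid input with a correct answer; no bound on its length is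
needed.

The mathematics of a certificate is the following. Let T = ∏ (X - d_i). Hermite reduction over ℚ(θ)
writes ω = d(U / T^n) + ∑ r_i dx / (x - d_i) (`exists_primitiveIdentity`). Along a segment from z to
w that avoids D, the quotients (x - d_i) / (z - d_i) avoid (-∞, 0]. Hence the integral is the
increment of U / T^n plus ∑ r_i Log ((w - d_i) / (z - d_i)), with principal logarithms
(`segmentIntegral_eq`). Now sum over the segments of γ, and let ∂γ = ∑ b_j e_j. For each i the sum
of the logarithms has exponential ∏ (e_j - d_i)^(b_j), because the ratios telescope (`exp_sum_log`);
so it equals ∑ b_j λ_ij + 2πi k_i for an integer k_i. This gives c_ij = r_i b_j and c' = ∑ r_i k_i,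
while c consists of a(∂γ) and the increments of U / T^n.

What remains is to verify identities in ℚ(θ) and the integers k_i. An element of ℚ(θ) is shown to be
zero by a quotient by the defining polynomial of θ, and nonzero by an inverse. For a proposed k, the
defect of the relation between the logarithms is known to lie in 2πiℤ, so it vanishes exactly when
its absolute value is below 6 < 2π. When it vanishes, sufficiently good rational approximations
confirm this (`logSumSmall_iff`, `logRelation_iff`). Numbers in ℚ(θ) are approximated by ball
arithmetic around a Gaussian rational near θ; a logarithm of u is approximated by N h with (1 + h)^N
close to u. All numerical conditions are strict inequalities between continuous quantities, so
whenever they hold they can be confirmed with rational data. -/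

open scoped Polynomial

-- With this attribute, and closure lemmas stated for composed functions, `fun_prop` proves the
-- primitive recursiveness of explicit terms.
attribute [fun_prop] Primrec

noncomputable section

namespace BakerPeriod

/-! ### Primitive recursive functions -/

section Primrec

variable {α β γ σ : Type*} [Primcodable α] [Primcodable β] [Primcodable γ] [Primcodable σ]

@[fun_prop]
theorem primrec_id : Primrec fun a : α => a := Primrec.id

@[fun_prop]
theorem primrec_const (b : β) : Primrec fun _ : α => b := Primrec.const b

@[fun_prop]
theorem primrec_comp {f : β → σ} {g : α → β} (hf : Primrec f) (hg : Primrec g) :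
    Primrec fun a => f (g a) := hf.comp hg

@[fun_prop]
theorem primrec_pair {f : α → β} {g : α → γ} (hf : Primrec f) (hg : Primrec g) :
    Primrec fun a => (f a, g a) := hf.pair hg

@[fun_prop]
theorem primrec_fst {f : α → β × γ} (hf : Primrec f) : Primrec fun a => (f a).1 :=
  Primrec.fst.comp hf

@[fun_prop]
theorem primrec_snd {f : α → β × γ} (hf : Primrec f) : Primrec fun a => (f a).2 :=
  Primrec.snd.comp hf

@[fun_prop]
theorem primrec_nat_add {f g : α → ℕ} (hf : Primrec f) (hg : Primrec g) :
    Primrec fun a => f a + g a := Primrec.nat_add.comp hf hg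

@[fun_prop]
theorem primrec_nat_sub {f g : α → ℕ} (hf : Primrec f) (hg : Primrec g) :
    Primrec fun a => f a - g a := Primrec.nat_sub.comp hf hg

@[fun_prop]
theorem primrec_nat_mul {f g : α → ℕ} (hf : Primrec f) (hg : Primrec g) :
    Primrec fun a => f a * g a := Primrec.nat_mul.comp hf hg

@[fun_prop]
theorem primrec_nat_le {f g : α → ℕ} (hf : Primrec f) (hg : Primrec g) :
    Primrec fun a => decide (f a ≤ g a) := Primrec.nat_le.decide.comp hf hg

@[fun_prop]
theorem primrec_decide_eq [DecidableEq β] {f g : α → β} (hf : Primrec f) (hg : Primrec g) :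
    Primrec fun a => decide (f a = g a) := Primrec.eq.decide.comp hf hg

@[fun_prop]
theorem primrec_band {f g : α → Bool} (hf : Primrec f) (hg : Primrec g) :
    Primrec fun a => f a && g a := Primrec.and.comp hf hg

@[fun_prop]
theorem primrec_bor {f g : α → Bool} (hf : Primrec f) (hg : Primrec g) :
    Primrec fun a => f a || g a := Primrec.or.comp hf hg

@[fun_prop]
theorem primrec_cons {f : α → β} {g : α → List β} (hf : Primrec f) (hg : Primrec g) :
    Primrec fun a => f a :: g a := Primrec.list_cons.comp hf hg

@[fun_prop]
theorem primrec_append {f g : α → List β} (hf : Primrec f) (hg : Primrec g) :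
    Primrec fun a => f a ++ g a := Primrec.list_append.comp hf hg

@[fun_prop]
theorem primrec_length {f : α → List β} (hf : Primrec f) : Primrec fun a => (f a).length :=
  Primrec.list_length.comp hf

@[fun_prop]
theorem primrec_range {f : α → ℕ} (hf : Primrec f) : Primrec fun a => List.range (f a) :=
  Primrec.list_range.comp hf

@[fun_prop]
theorem primrec_getD (d : β) {f : α → List β} {g : α → ℕ} (hf : Primrec f) (hg : Primrec g) :
    Primrec fun a => (f a).getD (g a) d := (Primrec.list_getD d).comp hf hg

@[fun_prop]
theorem primrec_map {f : α → List β} {g : α → β → σ} (hf : Primrec f)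
    (hg : Primrec fun p : α × β => g p.1 p.2) : Primrec fun a => (f a).map (g a) :=
  Primrec.list_map hf hg

@[fun_prop]
theorem primrec_foldr {f : α → List β} {g : α → σ} {h : α → β → σ → σ} (hf : Primrec f)
    (hg : Primrec g) (hh : Primrec fun p : α × β × σ => h p.1 p.2.1 p.2.2) :
    Primrec fun a => (f a).foldr (h a) (g a) :=
  Primrec.list_foldr hf hg (h := fun a p => h a p.1 p.2) hh

@[fun_prop]
theorem primrec_all {f : α → List β} {g : α → β → Bool} (hf : Primrec f)
    (hg : Primrec fun p : α × β => g p.1 p.2) : Primrec fun a => (f a).all (g a) := by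
  refine (primrec_foldr (h := fun a b s => g a b && s) hf (primrec_const true)
    (by fun_prop)).of_eq fun a => ?_
  induction f a with
  | nil => rfl
  | cons b l ih => simp [ih]

/-! ### Integers -/

/-- The encoding of ℤ interleaves the two signs: the sign is the parity of the code, and the size is
found by halving it. -/
theorem encode_ofNat (n : ℕ) : Encodable.encode (Int.ofNat n) = 2 * n := rfl

theorem encode_negSucc (n : ℕ) : Encodable.encode (Int.negSucc n) = 2 * n + 1 := rfl

@[fun_prop]
theorem primrec_toNat {f : α → ℤ} (hf : Primrec f) : Primrec fun a => (f a).toNat := by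
  have h : Primrec fun z : ℤ => z.toNat := by
    refine (Primrec.cond (c := fun z : ℤ => decide (Encodable.encode z % 2 = 0))
      (f := fun z : ℤ => Encodable.encode z / 2) (g := fun _ => 0) ?_ ?_ ?_).of_eq ?_
    · exact primrec_decide_eq (Primrec.nat_mod.comp Primrec.encode (Primrec.const 2))
        (Primrec.const 0)
    · exact Primrec.nat_div.comp Primrec.encode (Primrec.const 2)
    · fun_prop
    · rintro (n | n)
      · rw [encode_ofNat]; simp
      · rw [encode_negSucc, show (2 * n + 1) % 2 = 1 by omega]; rfl
  exact h.comp hf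

@[fun_prop]
theorem primrec_neg_toNat {f : α → ℤ} (hf : Primrec f) : Primrec fun a => (-(f a)).toNat := by
  have h : Primrec fun z : ℤ => (-z).toNat := by
    refine (Primrec.cond (c := fun z : ℤ => decide (Encodable.encode z % 2 = 0))
      (f := fun _ => 0) (g := fun z : ℤ => Encodable.encode z / 2 + 1) ?_ ?_ ?_).of_eq ?_
    · exact primrec_decide_eq (Primrec.nat_mod.comp Primrec.encode (Primrec.const 2))
        (Primrec.const 0)
    · fun_prop
    · exact primrec_nat_add (Primrec.nat_div.comp Primrec.encode (Primrec.const 2))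
        (Primrec.const 1)
    · rintro (n | n)
      · rw [encode_ofNat]; simp
      · rw [encode_negSucc, show (2 * n + 1) % 2 = 1 by omega,
          show (2 * n + 1) / 2 = n by omega]; rfl
  exact h.comp hf

/-- The integer operations reduce to this case: each integer is the difference of the natural
numbers `z.toNat` and `(-z).toNat`, and the arithmetic is done in ℕ. -/
theorem primrec_nat_diff {f g : α → ℕ} (hf : Primrec f) (hg : Primrec g) :
    Primrec fun a => (f a : ℤ) - (g a : ℤ) := by
  rw [← Primrec.encode_iff]
  -- A negative integer `-k` has the code `2 * k - 1`.
  refine (Primrec.cond (c := fun a => decide (g a ≤ f a)) (f := fun a => 2 * (f a - g a))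
    (g := fun a => 2 * (g a - f a) - 1) (by fun_prop) (by fun_prop) (by fun_prop)).of_eq ?_
  intro a
  by_cases h : g a ≤ f a
  · rw [show (f a : ℤ) - (g a : ℤ) = Int.ofNat (f a - g a) by simp; omega, encode_ofNat]
    simp [h]
  · rw [show (f a : ℤ) - (g a : ℤ) = Int.negSucc (g a - f a - 1) by omega, encode_negSucc]
    simp [h]
    omega

@[fun_prop]
theorem primrec_natCast {f : α → ℕ} (hf : Primrec f) : Primrec fun a => (f a : ℤ) :=
  (primrec_nat_diff hf (primrec_const 0)).of_eq fun _ => by simp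

@[fun_prop]
theorem primrec_int_neg {f : α → ℤ} (hf : Primrec f) : Primrec fun a => -f a :=
  (primrec_nat_diff (primrec_neg_toNat hf) (primrec_toNat hf)).of_eq fun _ => by omega

@[fun_prop]
theorem primrec_int_add {f g : α → ℤ} (hf : Primrec f) (hg : Primrec g) :
    Primrec fun a => f a + g a :=
  (primrec_nat_diff (primrec_nat_add (primrec_toNat hf) (primrec_toNat hg))
    (primrec_nat_add (primrec_neg_toNat hf) (primrec_neg_toNat hg))).of_eq fun _ => by omega

@[fun_prop]
theorem primrec_int_sub {f g : α → ℤ} (hf : Primrec f) (hg : Primrec g) :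
    Primrec fun a => f a - g a :=
  (primrec_int_add hf (primrec_int_neg hg)).of_eq fun _ => by omega

@[fun_prop]
theorem primrec_int_mul {f g : α → ℤ} (hf : Primrec f) (hg : Primrec g) :
    Primrec fun a => f a * g a := by
  refine (primrec_nat_diff
    (f := fun a => (f a).toNat * (g a).toNat + (-(f a)).toNat * (-(g a)).toNat)
    (g := fun a => (f a).toNat * (-(g a)).toNat + (-(f a)).toNat * (g a).toNat)
    (by fun_prop) (by fun_prop)).of_eq fun a => ?_
  have h : ∀ z : ℤ, z = (z.toNat : ℤ) - ((-z).toNat : ℤ) := fun z => by omega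
  conv_rhs => rw [h (f a), h (g a)]
  push_cast
  ring

@[fun_prop]
theorem primrec_int_lt {f g : α → ℤ} (hf : Primrec f) (hg : Primrec g) :
    Primrec fun a => decide (f a < g a) := by
  refine (primrec_nat_le (f := fun a => (f a + 1 - g a).toNat) (g := fun _ => 0)
    (by fun_prop) (by fun_prop)).of_eq fun a => ?_
  congr 1
  exact propext (by omega)

@[fun_prop]
theorem primrec_natAbs {f : α → ℤ} (hf : Primrec f) : Primrec fun a => (f a).natAbs :=
  (primrec_nat_add (primrec_toNat hf) (primrec_neg_toNat hf)).of_eq fun _ => by omega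

end Primrec

/-! ### Rings of codes -/

/-- Primitive recursive ring operations on a type of codes. -/
class CodeRing (α : Type) [Primcodable α] where
  /-- a code of zero -/
  zero : α
  /-- a code of one -/
  one : α
  /-- addition of codes -/
  add : α → α → α
  /-- multiplication of codes -/
  mul : α → α → α
  /-- negation of codes -/
  neg : α → α
  primrec_add : Primrec fun p : α × α => add p.1 p.2
  primrec_mul : Primrec fun p : α × α => mul p.1 p.2
  primrec_neg : Primrec neg

/-- The map `v` from codes to values respects the ring operations. -/
structure IsVal {α : Type} [Primcodable α] [CodeRing α] {R : Type*} [CommRing R] (v : α → R) :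
    Prop where
  zero : v CodeRing.zero = 0
  one : v CodeRing.one = 1
  add : ∀ a b, v (CodeRing.add a b) = v a + v b
  mul : ∀ a b, v (CodeRing.mul a b) = v a * v b
  neg : ∀ a, v (CodeRing.neg a) = -v a

namespace CodeRing

variable {α : Type} [Primcodable α] [CodeRing α] {β γ : Type*} [Primcodable β] [Primcodable γ]

@[fun_prop]
theorem primrec_add' {f g : β → α} (hf : Primrec f) (hg : Primrec g) :
    Primrec fun a => add (f a) (g a) := primrec_add.comp (hf.pair hg)

@[fun_prop]
theorem primrec_mul' {f g : β → α} (hf : Primrec f) (hg : Primrec g) :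
    Primrec fun a => mul (f a) (g a) := primrec_mul.comp (hf.pair hg)

@[fun_prop]
theorem primrec_neg' {f : β → α} (hf : Primrec f) : Primrec fun a => neg (f a) :=
  primrec_neg.comp hf

/-- Subtraction of codes. -/
def sub (a b : α) : α := add a (neg b)

@[fun_prop]
theorem primrec_sub {f g : β → α} (hf : Primrec f) (hg : Primrec g) :
    Primrec fun a => sub (f a) (g a) := by
  unfold sub; fun_prop

/-- The sum of a list of codes. -/
def sum (l : List α) : α := l.foldr add zero

@[fun_prop]
theorem primrec_sum {f : β → List α} (hf : Primrec f) : Primrec fun a => sum (f a) := by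
  unfold sum; fun_prop

/-- The product of a list of codes. -/
def prod (l : List α) : α := l.foldr mul one

@[fun_prop]
theorem primrec_prod {f : β → List α} (hf : Primrec f) : Primrec fun a => prod (f a) := by
  unfold prod; fun_prop

/-- Powers of codes. -/
def pow (a : α) (n : ℕ) : α := prod ((List.range n).map fun _ => a)

@[fun_prop]
theorem primrec_pow {f : β → α} {g : β → ℕ} (hf : Primrec f) (hg : Primrec g) :
    Primrec fun a => pow (f a) (g a) := by
  unfold pow; fun_prop

/-- Horner evaluation at `x` of a polynomial given by the list of its coefficients. -/
def horner {δ : Type*} (φ : δ → α) (x : α) (l : List δ) : α :=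
  l.foldr (fun a s => add (φ a) (mul x s)) zero

@[fun_prop]
theorem primrec_horner {φ : β → γ → α} {x : β → α} {l : β → List γ}
    (hφ : Primrec fun p : β × γ => φ p.1 p.2) (hx : Primrec x) (hl : Primrec l) :
    Primrec fun a => horner (φ a) (x a) (l a) := by
  unfold horner; fun_prop

/-- Addition of polynomials, given by their lists of coefficients. -/
def listAdd (l m : List α) : List α :=
  -- The sum of the lengths is a crude bound; superfluous zero coefficients do not change the value
  -- of a list.
  (List.range (l.length + m.length)).map fun i => add (l.getD i zero) (m.getD i zero)

@[fun_prop]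
theorem primrec_listAdd {f g : β → List α} (hf : Primrec f) (hg : Primrec g) :
    Primrec fun a => listAdd (f a) (g a) := by
  unfold listAdd; fun_prop

instance : CodeRing (List α) where
  zero := []
  one := [one]
  add := listAdd
  -- This is the recursion (a + X p) m = a m + X (p m).
  mul l m := l.foldr (fun a s => listAdd (m.map fun b => mul a b) (zero :: s)) []
  neg l := l.map neg
  primrec_add := by fun_prop
  primrec_mul := by fun_prop
  primrec_neg := by fun_prop

/-- The derivative of a polynomial given by the list of its coefficients. -/
def derivList (l : List α) : List α :=
  -- The fold carries the pair (p, p') and uses (a + X p)' = p + X p'.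
  (l.foldr (fun a s => (a :: s.1, listAdd s.1 (zero :: s.2))) (([], []) : List α × List α)).2

@[fun_prop]
theorem primrec_derivList {f : β → List α} (hf : Primrec f) : Primrec fun a => derivList (f a) := by
  unfold derivList; fun_prop

end CodeRing

open CodeRing

/-! ### Values of codes in a commutative ring, and polynomials as lists of coefficients. -/

section IsVal

variable {α : Type} [Primcodable α] [CodeRing α] {R : Type*} [CommRing R] {v : α → R}

namespace IsVal

theorem map {S : Type*} [CommRing S] (hv : IsVal v) (f : R →+* S) : IsVal fun a => f (v a) where
  zero := by rw [hv.zero, map_zero]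
  one := by rw [hv.one, map_one]
  add a b := by rw [hv.add, map_add]
  mul a b := by rw [hv.mul, map_mul]
  neg a := by rw [hv.neg, map_neg]

theorem sub (hv : IsVal v) (a b : α) : v (CodeRing.sub a b) = v a - v b := by
  rw [CodeRing.sub, hv.add, hv.neg, sub_eq_add_neg]

theorem sum (hv : IsVal v) (l : List α) : v (CodeRing.sum l) = (l.map v).sum := by
  induction l with
  | nil => exact hv.zero
  | cons a l ih => rw [List.map_cons, List.sum_cons, ← ih, ← hv.add]; rfl

theorem prod (hv : IsVal v) (l : List α) : v (CodeRing.prod l) = (l.map v).prod := by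
  induction l with
  | nil => exact hv.one
  | cons a l ih => rw [List.map_cons, List.prod_cons, ← ih, ← hv.mul]; rfl

theorem pow (hv : IsVal v) (a : α) (n : ℕ) : v (CodeRing.pow a n) = v a ^ n := by
  rw [CodeRing.pow, hv.prod]
  simp

theorem horner (hv : IsVal v) {δ : Type*} (φ : δ → α) (x : α) (l : List δ) :
    v (CodeRing.horner φ x l) = l.foldr (fun a s => v (φ a) + v x * s) 0 := by
  induction l with
  | nil => exact hv.zero
  | cons a l ih => rw [List.foldr_cons, ← ih, ← hv.mul, ← hv.add]; rfl

end IsVal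

/-- The polynomial whose list of coefficients has values `v`. -/
def listVal {δ : Type*} (v : δ → R) (l : List δ) : R[X] :=
  l.foldr (fun a p => Polynomial.C (v a) + Polynomial.X * p) 0

@[simp]
theorem listVal_nil {δ : Type*} (v : δ → R) : listVal v [] = 0 := rfl

@[simp]
theorem listVal_cons {δ : Type*} (v : δ → R) (a : δ) (l : List δ) :
    listVal v (a :: l) = Polynomial.C (v a) + Polynomial.X * listVal v l := rfl

theorem eval₂_listVal {δ S : Type*} [CommRing S] (v : δ → R) (f : R →+* S) (x : S) (l : List δ) :
    (listVal v l).eval₂ f x = l.foldr (fun a s => f (v a) + x * s) 0 := by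
  induction l with
  | nil => simp
  | cons a l ih => simp [ih]

theorem listVal_map {δ S : Type*} [CommRing S] (v : δ → R) (f : R →+* S) (l : List δ) :
    (listVal v l).map f = listVal (fun a => f (v a)) l := by
  induction l with
  | nil => simp
  | cons a l ih => simp [ih]

theorem natDegree_listVal_le {δ : Type*} (v : δ → R) (l : List δ) :
    (listVal v l).natDegree ≤ l.length := by
  induction l with
  | nil => simp
  | cons a l ih =>
    rw [listVal_cons]
    refine (Polynomial.natDegree_add_le _ _).trans (max_le (by simp) ?_)
    refine Polynomial.natDegree_mul_le.trans ?_
    have := Polynomial.natDegree_X_le (R := R)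
    simp only [List.length_cons]
    omega

/-- The default `CodeRing.zero` has value 0, so lists of different lengths can be compared
coefficient by coefficient. -/
theorem coeff_listVal (hv : IsVal v) (l : List α) (i : ℕ) :
    (listVal v l).coeff i = v (l.getD i CodeRing.zero) := by
  induction l generalizing i with
  | nil => simp [hv.zero]
  | cons a l ih =>
    cases i with
    | zero => simp
    | succ i => simp [ih]

theorem listVal_listAdd (hv : IsVal v) (l m : List α) :
    listVal v (listAdd l m) = listVal v l + listVal v m := by
  ext i
  rw [Polynomial.coeff_add, coeff_listVal hv, coeff_listVal hv, coeff_listVal hv]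
  by_cases hi : i < l.length + m.length
  · rw [← hv.add, listAdd, List.getD_eq_getElem _ _ (by simpa using hi)]
    simp
  · rw [List.getD_eq_default _ _ (by simpa [listAdd] using hi), List.getD_eq_default _ _ (by omega),
      List.getD_eq_default _ _ (by omega), hv.zero, add_zero]

theorem listVal_map_mul (hv : IsVal v) (a : α) (l : List α) :
    listVal v (l.map fun b => CodeRing.mul a b) = Polynomial.C (v a) * listVal v l := by
  induction l with
  | nil => simp
  | cons b l ih =>
    rw [List.map_cons, listVal_cons, listVal_cons, ih, hv.mul, Polynomial.C_mul]
    ring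

theorem IsVal.listVal (hv : IsVal v) : IsVal (listVal v) where
  zero := rfl
  one := by
    change BakerPeriod.listVal v [CodeRing.one] = 1
    simp [hv.one]
  add := listVal_listAdd hv
  mul l m := by
    change BakerPeriod.listVal v (l.foldr (fun a s => listAdd (m.map fun b => CodeRing.mul a b)
      (CodeRing.zero :: s)) []) = _
    induction l with
    | nil => simp
    | cons a l ih =>
      rw [List.foldr_cons, listVal_listAdd hv, listVal_cons, ih, listVal_map_mul hv, listVal_cons,
        hv.zero, Polynomial.C_0]
      ring
  neg l := by
    change BakerPeriod.listVal v (l.map CodeRing.neg) = _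
    induction l with
    | nil => simp
    | cons a l ih =>
      rw [List.map_cons, listVal_cons, ih, hv.neg, listVal_cons, Polynomial.C_neg]
      ring

theorem listVal_derivList (hv : IsVal v) (l : List α) :
    listVal v (derivList l) = Polynomial.derivative (listVal v l) := by
  have key : ∀ l : List α, (l.foldr (fun a s => (a :: s.1, listAdd s.1 (CodeRing.zero :: s.2)))
      (([], []) : List α × List α)).1 = l := by
    intro l
    induction l with
    | nil => rfl
    | cons a l ih => rw [List.foldr_cons, ih]
  induction l with
  | nil => simp [derivList]
  | cons a l ih =>
    rw [derivList, List.foldr_cons, key, listVal_listAdd hv, listVal_cons, hv.zero]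
    change BakerPeriod.listVal v l + (Polynomial.C 0 + Polynomial.X * listVal v (derivList l)) = _
    rw [ih, listVal_cons]
    simp

theorem listVal_eq_zero_iff {δ : Type*} (v : δ → R) (l : List δ) :
    listVal v l = 0 ↔ ∀ a ∈ l, v a = 0 := by
  induction l with
  | nil => simp
  | cons a l ih =>
    rw [listVal_cons, List.forall_mem_cons, ← ih]
    constructor
    · intro h
      have h0 : v a = 0 := by simpa using congrArg (fun p => Polynomial.coeff p 0) h
      refine ⟨h0, ?_⟩
      ext i
      simpa [Polynomial.coeff_C] using congrArg (fun p => Polynomial.coeff p (i + 1)) h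
    · rintro ⟨h1, h2⟩
      simp [h1, h2]

/-- Produces codes for polynomials obtained abstractly, such as Bézout coefficients and primitives.
-/
theorem exists_listVal_eq {δ : Type*} {v : δ → R} {p : R[X]} (h : ∀ i, ∃ a, v a = p.coeff i) :
    ∃ l, listVal v l = p := by
  have key : ∀ (n : ℕ) (p : R[X]), p.natDegree ≤ n → (∀ i, ∃ a, v a = p.coeff i) →
      ∃ l, listVal v l = p := by
    intro n
    induction n with
    | zero =>
      intro p hp h
      obtain ⟨a, ha⟩ := h 0
      exact ⟨[a], by simpa [ha] using (Polynomial.eq_C_of_natDegree_le_zero hp).symm⟩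
    | succ n ih =>
      intro p hp h
      obtain ⟨a, ha⟩ := h 0
      obtain ⟨l, hl⟩ := ih p.divX
        (by rw [Polynomial.natDegree_divX_eq_natDegree_tsub_one]; omega)
        (fun i => by simpa using h (i + 1))
      refine ⟨a :: l, ?_⟩
      rw [listVal_cons, hl, ha, add_comm]
      exact Polynomial.X_mul_divX_add p
  exact key _ p le_rfl h

end IsVal

/-! ### Rational numbers and Gaussian rationals -/

instance : CodeRing (ℤ × ℕ) where
  zero := (0, 0)
  one := (1, 0)
  -- Denominators are stored minus one, and (x + 1)(y + 1) - 1 = x y + x + y.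
  add a b := (a.1 * ((b.2 + 1 : ℕ) : ℤ) + b.1 * ((a.2 + 1 : ℕ) : ℤ), a.2 * b.2 + a.2 + b.2)
  mul a b := (a.1 * b.1, a.2 * b.2 + a.2 + b.2)
  neg a := (-a.1, a.2)
  primrec_add := by fun_prop
  primrec_mul := by fun_prop
  primrec_neg := by fun_prop

theorem isVal_ratVal : IsVal ratVal where
  zero := by simp [ratVal, CodeRing.zero]
  one := by simp [ratVal, CodeRing.one]
  add a b := by
    have ha : (a.2 : ℚ) + 1 ≠ 0 := by positivity
    have hb : (b.2 : ℚ) + 1 ≠ 0 := by positivity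
    simp only [ratVal, CodeRing.add]
    push_cast
    rw [show (a.2 : ℚ) * b.2 + a.2 + b.2 + 1 = (a.2 + 1) * (b.2 + 1) by ring]
    field_simp
  mul a b := by
    have ha : (a.2 : ℚ) + 1 ≠ 0 := by positivity
    have hb : (b.2 : ℚ) + 1 ≠ 0 := by positivity
    simp only [ratVal, CodeRing.mul]
    push_cast
    rw [show (a.2 : ℚ) * b.2 + a.2 + b.2 + 1 = (a.2 + 1) * (b.2 + 1) by ring]
    field_simp
  neg a := by simp [ratVal, CodeRing.neg, neg_div]

theorem ratVal_surjective (q : ℚ) : ∃ c, ratVal c = q := by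
  refine ⟨(q.num, q.den - 1), ?_⟩
  have h : ((q.den - 1 : ℕ) : ℚ) + 1 = q.den := by
    rw [Nat.cast_sub q.den_pos]; simp
  rw [ratVal, h, Rat.num_div_den]

/-- The code of an integer. -/
def intCode (a : ℤ) : RatCode := (a, 0)

@[simp]
theorem ratVal_intCode (a : ℤ) : ratVal (intCode a) = a := by simp [ratVal, intCode]

/-- Comparison of rational numbers. -/
def ratLt (a b : RatCode) : Bool := decide (a.1 * ((b.2 + 1 : ℕ) : ℤ) < b.1 * ((a.2 + 1 : ℕ) : ℤ))

theorem ratLt_iff (a b : RatCode) : ratLt a b = true ↔ ratVal a < ratVal b := by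
  have ha : (0 : ℚ) < (a.2 : ℚ) + 1 := by positivity
  have hb : (0 : ℚ) < (b.2 : ℚ) + 1 := by positivity
  rw [ratLt, decide_eq_true_iff, ratVal, ratVal, div_lt_div_iff₀ ha hb]
  exact_mod_cast Iff.rfl

/-- The absolute value of a rational number. -/
def ratAbs (a : RatCode) : RatCode := ((a.1.natAbs : ℤ), a.2)

theorem ratVal_ratAbs (a : RatCode) : ratVal (ratAbs a) = |ratVal a| := by
  have ha : (0 : ℚ) < (a.2 : ℚ) + 1 := by positivity
  rw [ratVal, ratVal, ratAbs, abs_div, abs_of_pos ha]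
  simp

instance : CodeRing ((ℤ × ℕ) × (ℤ × ℕ)) where
  zero := (zero, zero)
  one := (one, zero)
  add a b := (add a.1 b.1, add a.2 b.2)
  mul a b := (CodeRing.sub (mul a.1 b.1) (mul a.2 b.2), add (mul a.1 b.2) (mul a.2 b.1))
  neg a := (neg a.1, neg a.2)
  primrec_add := by fun_prop
  primrec_mul := by fun_prop
  primrec_neg := by fun_prop

theorem isVal_gaussVal : IsVal gaussVal where
  zero := by simp [gaussVal, CodeRing.zero, ratVal]
  one := by simp [gaussVal, CodeRing.zero, CodeRing.one, ratVal]
  add a b := by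
    simp only [gaussVal]
    rw [show CodeRing.add a b = (add a.1 b.1, add a.2 b.2) from rfl]
    simp only [isVal_ratVal.add]
    push_cast
    ring
  mul a b := by
    simp only [gaussVal]
    rw [show CodeRing.mul a b = (CodeRing.sub (mul a.1 b.1) (mul a.2 b.2),
      add (mul a.1 b.2) (mul a.2 b.1)) from rfl]
    simp only [isVal_ratVal.add, isVal_ratVal.mul, isVal_ratVal.sub]
    push_cast
    linear_combination (-(ratVal a.2 : ℂ) * ratVal b.2) * Complex.I_sq
  neg a := by
    simp only [gaussVal]
    rw [show CodeRing.neg a = (neg a.1, neg a.2) from rfl]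
    simp only [isVal_ratVal.neg]
    push_cast
    ring

theorem gaussVal_re (g : GaussCode) : (gaussVal g).re = ratVal g.1 := by simp [gaussVal]

theorem gaussVal_im (g : GaussCode) : (gaussVal g).im = ratVal g.2 := by simp [gaussVal]

/-- The square of the absolute value of a Gaussian rational. -/
def gaussNormSq (g : GaussCode) : RatCode := add (mul g.1 g.1) (mul g.2 g.2)

theorem ratVal_gaussNormSq (g : GaussCode) : (ratVal (gaussNormSq g) : ℝ) = ‖gaussVal g‖ ^ 2 := by
  rw [gaussNormSq, isVal_ratVal.add, isVal_ratVal.mul, isVal_ratVal.mul,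
    ← Complex.normSq_eq_norm_sq,
    Complex.normSq_apply, gaussVal_re, gaussVal_im]
  push_cast
  rfl

/-- The sum of the absolute values of the real and imaginary parts. -/
def gaussAbs (g : GaussCode) : RatCode := add (ratAbs g.1) (ratAbs g.2)

theorem ratVal_gaussAbs (g : GaussCode) :
    (ratVal (gaussAbs g) : ℝ) = |(gaussVal g).re| + |(gaussVal g).im| := by
  rw [gaussAbs, isVal_ratVal.add, ratVal_ratAbs, ratVal_ratAbs, gaussVal_re, gaussVal_im]
  push_cast
  rfl

/-- `‖g‖ < r`, for a Gaussian rational `g` and a rational `r`. -/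
def gaussLt (g : GaussCode) (r : RatCode) : Bool :=
  ratLt zero r && ratLt (gaussNormSq g) (mul r r)

theorem gaussLt_iff (g : GaussCode) (r : RatCode) :
    gaussLt g r = true ↔ ‖gaussVal g‖ < (ratVal r : ℝ) := by
  rw [gaussLt, Bool.and_eq_true, ratLt_iff, ratLt_iff, isVal_ratVal.zero, isVal_ratVal.mul,
    ← Rat.cast_lt (K := ℝ), ← Rat.cast_lt (K := ℝ), ratVal_gaussNormSq]
  push_cast
  constructor
  · rintro ⟨h1, h2⟩
    nlinarith [norm_nonneg (gaussVal g)]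
  · intro h
    have := norm_nonneg (gaussVal g)
    exact ⟨by linarith, by nlinarith⟩

section Primrec

variable {α : Type*} [Primcodable α]

@[fun_prop]
theorem primrec_intCode {f : α → ℤ} (hf : Primrec f) : Primrec fun a => intCode (f a) := by
  unfold intCode; fun_prop

@[fun_prop]
theorem primrec_ratLt {f g : α → RatCode} (hf : Primrec f) (hg : Primrec g) :
    Primrec fun a => ratLt (f a) (g a) := by
  unfold ratLt; fun_prop

@[fun_prop]
theorem primrec_ratAbs {f : α → RatCode} (hf : Primrec f) : Primrec fun a => ratAbs (f a) := by
  unfold ratAbs; fun_prop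

@[fun_prop]
theorem primrec_gaussNormSq {f : α → GaussCode} (hf : Primrec f) :
    Primrec fun a => gaussNormSq (f a) := by
  unfold gaussNormSq; fun_prop

@[fun_prop]
theorem primrec_gaussAbs {f : α → GaussCode} (hf : Primrec f) :
    Primrec fun a => gaussAbs (f a) := by
  unfold gaussAbs; fun_prop

@[fun_prop]
theorem primrec_gaussLt {f : α → GaussCode} {g : α → RatCode} (hf : Primrec f) (hg : Primrec g) :
    Primrec fun a => gaussLt (f a) (g a) := by
  unfold gaussLt; fun_prop

end Primrec

/-- The form in which density serves the completeness proofs: an open condition with a complex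
solution has a solution with a code. -/
theorem exists_gaussVal_mem {U : Set ℂ} (hU : IsOpen U) {z : ℂ} (hz : z ∈ U) :
    ∃ g, gaussVal g ∈ U := by
  obtain ⟨ε, hε, hball⟩ := Metric.isOpen_iff.1 hU z hz
  obtain ⟨a, ha1, ha2⟩ := exists_rat_btwn (show z.re - ε / 2 < z.re + ε / 2 by linarith)
  obtain ⟨b, hb1, hb2⟩ := exists_rat_btwn (show z.im - ε / 2 < z.im + ε / 2 by linarith)
  obtain ⟨ca, rfl⟩ := ratVal_surjective a
  obtain ⟨cb, rfl⟩ := ratVal_surjective b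
  refine ⟨(ca, cb), hball ?_⟩
  rw [Metric.mem_ball, dist_eq_norm]
  refine (Complex.norm_le_abs_re_add_abs_im _).trans_lt ?_
  rw [Complex.sub_re, Complex.sub_im, gaussVal_re, gaussVal_im]
  have h1 : |(ratVal ca : ℝ) - z.re| < ε / 2 := abs_lt.2 ⟨by linarith, by linarith⟩
  have h2 : |(ratVal cb : ℝ) - z.im| < ε / 2 := abs_lt.2 ⟨by linarith, by linarith⟩
  simp only
  linarith

theorem exists_ratVal_btwn {a b : ℝ} (h : a < b) :
    ∃ r, a < (ratVal r : ℝ) ∧ (ratVal r : ℝ) < b := by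
  obtain ⟨q, h1, h2⟩ := exists_rat_btwn h
  obtain ⟨r, rfl⟩ := ratVal_surjective q
  exact ⟨r, h1, h2⟩

/-! ### Semidecidable properties of codes over an embedded number field -/

@[fun_prop]
theorem primrec_any {α β : Type*} [Primcodable α] [Primcodable β] {f : α → List β}
    {g : α → β → Bool} (hf : Primrec f) (hg : Primrec fun p : α × β => g p.1 p.2) :
    Primrec fun a => (f a).any (g a) := by
  refine (primrec_foldr (h := fun a b s => g a b || s) hf (primrec_const false)
    (by fun_prop)).of_eq fun a => ?_
  induction f a with
  | nil => rfl
  | cons b l ih => simp [ih]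

/-- The property `Φ θ b` of codes `b` is semidecidable, uniformly in the number field `ℚ(θ)`. -/
def SD {β : Type} [Primcodable β] (Φ : Qbar → β → Prop) : Prop :=
  -- The test sees the code of the field but not θ, and is only constrained on codes that do
  -- represent some θ.
  ∃ C : (FieldCode × β) × ℕ → Bool, Primrec C ∧
    ∀ F θ, FieldRepresents F θ → ∀ b, Φ θ b ↔ ∃ n, C ((F, b), n) = true

namespace SD

variable {β γ δ : Type} [Primcodable β] [Primcodable γ] [Primcodable δ]

/-- A search over any encodable type becomes a search over ℕ by decoding; numbers that decode to
nothing count as failures. -/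
theorem of_search {Φ : Qbar → β → Prop} {f : (FieldCode × β) × γ → Bool} (hf : Primrec f)
    (h : ∀ F θ, FieldRepresents F θ → ∀ b, Φ θ b ↔ ∃ c, f ((F, b), c) = true) : SD Φ := by
  refine ⟨fun p => Option.casesOn (Encodable.decode (α := γ) p.2) false fun c => f (p.1, c),
    ?_, fun F θ hF b => ?_⟩
  · exact Primrec.option_casesOn (Primrec.decode.comp Primrec.snd) (Primrec.const false)
      (show Primrec fun q : ((FieldCode × β) × ℕ) × γ => f (q.1.1, q.2) by fun_prop)
  · rw [h F θ hF b]
    constructor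
    · rintro ⟨c, hc⟩
      exact ⟨Encodable.encode c, by simpa using hc⟩
    · rintro ⟨n, hn⟩
      simp only at hn
      cases hd : Encodable.decode (α := γ) n with
      | none => simp [hd] at hn
      | some c => exact ⟨c, by simpa [hd] using hn⟩

theorem of_bool {f : β → Bool} (hf : Primrec f) : SD fun _ b => f b = true :=
  of_search (γ := Unit) (f := fun p => f p.1.2) (by fun_prop) (by simp)

theorem of_eq {Φ Ψ : Qbar → β → Prop} (h : SD Φ)
    (H : ∀ F θ, FieldRepresents F θ → ∀ b, Ψ θ b ↔ Φ θ b) : SD Ψ := by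
  obtain ⟨C, hC, hΦ⟩ := h
  exact ⟨C, hC, fun F θ hF b => (H F θ hF b).trans (hΦ F θ hF b)⟩

theorem decide_eq {f g : β → γ} (hf : Primrec f) (hg : Primrec g) :
    SD fun _ b => f b = g b := by
  classical
  exact (of_bool (primrec_decide_eq hf hg)).of_eq (by simp)

theorem comp {Φ : Qbar → β → Prop} (h : SD Φ) {g : γ → β} (hg : Primrec g) :
    SD fun θ c => Φ θ (g c) := by
  obtain ⟨C, hC, hΦ⟩ := h
  exact ⟨fun p => C ((p.1.1, g p.1.2), p.2), by fun_prop, fun F θ hF b => hΦ F θ hF (g b)⟩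

theorem and {Φ Ψ : Qbar → β → Prop} (h : SD Φ) (h' : SD Ψ) : SD fun θ b => Φ θ b ∧ Ψ θ b := by
  obtain ⟨C, hC, hΦ⟩ := h
  obtain ⟨C', hC', hΨ⟩ := h'
  refine of_search (γ := ℕ × ℕ) (f := fun p => C (p.1, p.2.1) && C' (p.1, p.2.2)) (by fun_prop) ?_
  intro F θ hF b
  rw [hΦ F θ hF, hΨ F θ hF]
  simp only [Bool.and_eq_true, Prod.exists, exists_and_left, exists_and_right]

theorem or {Φ Ψ : Qbar → β → Prop} (h : SD Φ) (h' : SD Ψ) : SD fun θ b => Φ θ b ∨ Ψ θ b := by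
  obtain ⟨C, hC, hΦ⟩ := h
  obtain ⟨C', hC', hΨ⟩ := h'
  refine ⟨fun p => C p || C' p, by fun_prop, ?_⟩
  intro F θ hF b
  simp only [hΦ F θ hF, hΨ F θ hF, Bool.or_eq_true, exists_or]

theorem ex {Φ : Qbar → β × γ → Prop} (h : SD Φ) : SD fun θ b => ∃ c, Φ θ (b, c) := by
  obtain ⟨C, hC, hΦ⟩ := h
  refine of_search (γ := γ × ℕ) (f := fun p => C ((p.1.1, (p.1.2, p.2.1)), p.2.2))
    (by fun_prop) ?_
  intro F θ hF b
  simp only [hΦ F θ hF, Prod.exists]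

/-- Finitely many witnesses have a common bound, so one index `n` suffices: run the search for every
member of the list up to `n`. -/
theorem forall_mem {Φ : Qbar → β × γ → Prop} (h : SD Φ) {l : β → List γ} (hl : Primrec l) :
    SD fun θ b => ∀ c ∈ l b, Φ θ (b, c) := by
  obtain ⟨C, hC, hΦ⟩ := h
  refine ⟨fun p => (l p.1.2).all fun c => (List.range p.2).any fun n =>
    C ((p.1.1, (p.1.2, c)), n), by fun_prop, ?_⟩
  intro F θ hF b
  simp only [hΦ F θ hF, List.all_eq_true, List.any_eq_true, List.mem_range]
  constructor
  · generalize l b = m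
    induction m with
    | nil => simp
    | cons a m ih =>
      intro hm
      obtain ⟨N, hN⟩ := ih fun c hc => hm c (List.mem_cons_of_mem _ hc)
      obtain ⟨n, hn⟩ := hm a List.mem_cons_self
      refine ⟨max N (n + 1), ?_⟩
      rw [List.forall_mem_cons]
      refine ⟨⟨n, by simp, hn⟩, fun c hc => ?_⟩
      obtain ⟨k, hk, hk'⟩ := hN c hc
      exact ⟨k, lt_max_of_lt_left hk, hk'⟩
  · rintro ⟨N, hN⟩ c hc
    obtain ⟨n, _, hn⟩ := hN c hc
    exact ⟨n, hn⟩

/-- Trades a relation between two lists for an existential and a bounded universal quantifier, which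
`SD.ex` and `SD.forall_mem` handle. -/
theorem _root_.List.forall₂_iff_exists_pairs {γ δ : Type*} {R : γ → δ → Prop} {l : List γ}
    {m : List δ} : List.Forall₂ R l m ↔
      ∃ T : List (γ × δ), T.map Prod.fst = l ∧ T.map Prod.snd = m ∧ ∀ t ∈ T, R t.1 t.2 := by
  constructor
  · intro h
    induction h with
    | nil => exact ⟨[], by simp⟩
    | cons h _ ih =>
      obtain ⟨T, rfl, rfl, hT⟩ := ih
      exact ⟨(_, _) :: T, rfl, rfl, by simpa using ⟨h, by simpa using hT⟩⟩
  · rintro ⟨T, rfl, rfl, hT⟩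
    rw [List.forall₂_map_left_iff, List.forall₂_map_right_iff, List.forall₂_same]
    exact hT

theorem forall₂ {Φ : Qbar → β × γ × δ → Prop} (h : SD Φ)
    {l : β → List γ} (hl : Primrec l) {m : β → List δ} (hm : Primrec m) :
    SD fun θ b => List.Forall₂ (fun c d => Φ θ (b, c, d)) (l b) (m b) := by
  have : SD fun θ b => ∃ T : List (γ × δ), T.map Prod.fst = l b ∧ T.map Prod.snd = m b ∧
      ∀ t ∈ T, Φ θ (b, t) := by
    refine ex (Φ := fun θ (p : β × List (γ × δ)) =>
      p.2.map Prod.fst = l p.1 ∧ p.2.map Prod.snd = m p.1 ∧ ∀ t ∈ p.2, Φ θ (p.1, t)) ?_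
    refine (decide_eq (by fun_prop) (by fun_prop)).and
      ((decide_eq (by fun_prop) (by fun_prop)).and ?_)
    exact forall_mem (β := β × List (γ × δ)) (Φ := fun θ q => Φ θ (q.1.1, q.2))
      (h.comp (g := fun q : (β × List (γ × δ)) × γ × δ => (q.1.1, q.2)) (by fun_prop))
      (by fun_prop)
  exact this.of_eq fun F θ _ b => List.forall₂_iff_exists_pairs

/-- A semidecidable relation is uniformised by a partial recursive function. -/
theorem exists_partrec {Φ : Qbar → β × γ → Prop} (h : SD Φ) {field : β → FieldCode}
    (hfield : Primrec field) : ∃ A : β →. γ, Partrec A ∧ ∀ b θ, FieldRepresents (field b) θ →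
      (∃ c, Φ θ (b, c)) → ∃ c ∈ A b, Φ θ (b, c) := by
  obtain ⟨C, hC, hΦ⟩ := h
  -- Dovetailing: `n` codes a candidate together with a search index for its verification, and
  -- `Nat.rfindOpt` stops at the first success.
  let f : β → ℕ → Option γ := fun b n => Option.casesOn (Encodable.decode (α := γ × ℕ) n) none
    fun c => bif C ((field b, (b, c.1)), c.2) then some c.1 else none
  have hf : Primrec₂ f := by
    refine Primrec.option_casesOn (Primrec.decode.comp Primrec.snd) (Primrec.const none) ?_
    refine Primrec.cond (c := fun q : (β × ℕ) × γ × ℕ => C ((field q.1.1, (q.1.1, q.2.1)), q.2.2))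
      (by fun_prop) ?_ (by fun_prop)
    exact Primrec.option_some.comp (by fun_prop)
  have hspec : ∀ b n c, c ∈ f b n → ∃ k, C ((field b, (b, c)), k) = true := by
    intro b n c hc
    simp only [f] at hc
    cases hd : Encodable.decode (α := γ × ℕ) n with
    | none => simp [hd] at hc
    | some p =>
      simp only [hd] at hc
      cases hp : C ((field b, (b, p.1)), p.2) with
      | false => simp [hp] at hc
      | true =>
        simp only [hp, cond_true, Option.mem_some_iff] at hc
        exact ⟨p.2, hc ▸ hp⟩
  refine ⟨fun b => Nat.rfindOpt (f b), Partrec.rfindOpt hf.to_comp, ?_⟩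
  rintro b θ hF ⟨c, hc⟩
  obtain ⟨k, hk⟩ := (hΦ _ θ hF _).1 hc
  have hdom : (Nat.rfindOpt (f b)).Dom := by
    rw [Nat.rfindOpt_dom]
    exact ⟨Encodable.encode (c, k), c, by simp [f, hk]⟩
  -- The value found need not be the given `c`; it satisfies the relation because its own test
  -- succeeded.
  obtain ⟨c', hc'⟩ := Part.dom_iff_mem.1 hdom
  obtain ⟨n, hn⟩ := Nat.rfindOpt_spec hc'
  exact ⟨c', hc', (hΦ _ θ hF _).2 (hspec b n c' hn)⟩

end SD

/-! ### Arithmetic in the embedded number field -/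

theorem numVal_eq_aeval (θ : Qbar) (c : NumCode) :
    numVal θ c = Polynomial.aeval θ (listVal ratVal c) := by
  rw [Polynomial.aeval_def, eval₂_listVal]
  rfl

theorem isVal_numVal (θ : Qbar) : IsVal (numVal θ) := by
  have := isVal_ratVal.listVal.map (Polynomial.aeval θ : ℚ[X] →ₐ[ℚ] Qbar).toRingHom
  convert this using 2 with c
  exact numVal_eq_aeval θ c

theorem isVal_polyVal (θ : Qbar) : IsVal (polyVal θ) := (isVal_numVal θ).listVal

theorem intPoly_eq_listVal (l : List ℤ) : intPoly l = listVal (fun a : ℤ => (a : ℚ)) l := by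
  induction l with
  | nil => rfl
  | cons a l ih => rw [listVal_cons, ← ih]; rfl

theorem listVal_map_intCode (l : List ℤ) : listVal ratVal (l.map intCode) = intPoly l := by
  induction l with
  | nil => rfl
  | cons a l ih =>
    rw [List.map_cons, listVal_cons, ih, ratVal_intCode]
    rfl

namespace FieldRepresents

variable {F : FieldCode} {θ : Qbar}

theorem aeval_eq_zero (h : FieldRepresents F θ) : Polynomial.aeval θ (intPoly F.1) = 0 := by
  have h1 := ((h.2 (θ : ℂ)).2 rfl).1
  apply (algebraMap Qbar ℂ).injective
  rw [← Polynomial.aeval_algebraMap_apply, map_zero]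
  exact h1

/-- A polynomial not divisible by the irreducible `intPoly F.1` is coprime to it, and a Bézout
identity evaluated at θ shows that it does not vanish there. -/
theorem dvd_iff (h : FieldRepresents F θ) (c : NumCode) :
    numVal θ c = 0 ↔ intPoly F.1 ∣ listVal ratVal c := by
  rw [numVal_eq_aeval]
  constructor
  · intro hc
    rcases (dvd_or_isCoprime _ (listVal ratVal c) h.1).symm with hcop | hdvd
    · obtain ⟨a, b, hab⟩ := hcop
      have := congrArg (Polynomial.aeval θ) hab
      simp [h.aeval_eq_zero, hc] at this
    · exact hdvd
  · rintro ⟨q, hq⟩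
    rw [hq, map_mul, h.aeval_eq_zero, zero_mul]

/-- Gives nonvanishing the form of an existential statement, hence a searchable one; the inverse is
a Bézout coefficient. -/
theorem exists_numVal_inv (h : FieldRepresents F θ) (c : NumCode) :
    numVal θ c ≠ 0 ↔ ∃ b, numVal θ (CodeRing.sub (mul c b) one) = 0 := by
  have hsub : ∀ b, numVal θ (CodeRing.sub (mul c b) one) = numVal θ c * numVal θ b - 1 := by
    intro b
    rw [(isVal_numVal θ).sub, (isVal_numVal θ).mul, (isVal_numVal θ).one]
  constructor
  · intro hc
    rcases (dvd_or_isCoprime _ (listVal ratVal c) h.1).symm with hcop | hdvd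
    · obtain ⟨a, b, hab⟩ := hcop
      obtain ⟨b', rfl⟩ := exists_listVal_eq (v := ratVal) (p := b) fun i => ratVal_surjective _
      refine ⟨b', ?_⟩
      have := congrArg (Polynomial.aeval θ) hab
      rw [map_add, map_mul, map_mul, h.aeval_eq_zero, mul_zero, zero_add, map_one,
        ← numVal_eq_aeval, ← numVal_eq_aeval] at this
      rw [hsub, mul_comm, this, sub_self]
    · exact absurd ((h.dvd_iff c).2 hdvd) hc
  · rintro ⟨b, hb⟩ hc
    rw [hsub, hc] at hb
    simp at hb

end FieldRepresents

/-- Whether all the coefficients of a polynomial vanish. -/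
def isZeroPoly (c : NumCode) : Bool := c.all fun q => decide (q.1 = 0)

@[fun_prop]
theorem primrec_isZeroPoly {α : Type*} [Primcodable α] {f : α → NumCode} (hf : Primrec f) :
    Primrec fun a => isZeroPoly (f a) := by
  unfold isZeroPoly; fun_prop

theorem isZeroPoly_iff (c : NumCode) : isZeroPoly c = true ↔ listVal ratVal c = 0 := by
  rw [listVal_eq_zero_iff, isZeroPoly, List.all_eq_true]
  refine forall₂_congr fun q _ => ?_
  have : (q.2 : ℚ) + 1 ≠ 0 := by positivity
  simp [ratVal, this]

namespace SD

variable {β : Type} [Primcodable β]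

/-- The search is for the quotient by the defining polynomial; equality of rational polynomials is
decidable. -/
theorem numVal_eq_zero {c : β → NumCode} (hc : Primrec c) : SD fun θ b => numVal θ (c b) = 0 := by
  refine comp (Φ := fun θ c => numVal θ c = 0) ?_ hc
  refine of_search (γ := NumCode) (f := fun p => isZeroPoly
    (CodeRing.sub (mul (p.1.1.1.map intCode) p.2) p.1.2)) (by fun_prop) ?_
  intro F θ hF c
  rw [hF.dvd_iff]
  simp only [isZeroPoly_iff, isVal_ratVal.listVal.sub, isVal_ratVal.listVal.mul,
    listVal_map_intCode, sub_eq_zero]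
  constructor
  · rintro ⟨q, hq⟩
    obtain ⟨q', rfl⟩ := exists_listVal_eq (v := ratVal) (p := q) fun i => ratVal_surjective _
    exact ⟨q', hq.symm⟩
  · rintro ⟨q, hq⟩
    exact ⟨_, hq.symm⟩

theorem numVal_eq {c d : β → NumCode} (hc : Primrec c) (hd : Primrec d) :
    SD fun θ b => numVal θ (c b) = numVal θ (d b) :=
  (numVal_eq_zero (c := fun b => CodeRing.sub (c b) (d b)) (by fun_prop)).of_eq
    fun _ θ _ b => by rw [(isVal_numVal θ).sub, sub_eq_zero]

theorem numVal_ne {c d : β → NumCode} (hc : Primrec c) (hd : Primrec d) :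
    SD fun θ b => numVal θ (c b) ≠ numVal θ (d b) := by
  refine (ex (Φ := fun θ (p : β × NumCode) =>
    numVal θ (CodeRing.sub (mul (CodeRing.sub (c p.1) (d p.1)) p.2) one) = 0)
    (numVal_eq_zero (by fun_prop))).of_eq fun F θ hF b => ?_
  simp only [← hF.exists_numVal_inv]
  rw [(isVal_numVal θ).sub, sub_ne_zero]

theorem polyVal_eq {c d : β → PolyCode} (hc : Primrec c) (hd : Primrec d) :
    SD fun θ b => polyVal θ (c b) = polyVal θ (d b) := by
  refine (forall_mem (Φ := fun θ (p : β × NumCode) => numVal θ p.2 = 0)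
    (numVal_eq_zero (by fun_prop)) (l := fun b => CodeRing.sub (c b) (d b)) (by fun_prop)).of_eq
    fun F θ hF b => ?_
  rw [← sub_eq_zero, ← (isVal_polyVal θ).sub]
  exact listVal_eq_zero_iff (numVal θ) _

end SD

/-! ### Numerical approximation -/

/-- If every root were at distance at least ε from `q`, then |p(q)| = |lead| ∏ |q - root| ≥ ε^deg,
since the leading coefficient is a nonzero integer; and ε^deg ≥ ε^length because ε < 1. -/
theorem exists_root_near {l : List ℤ} (hl : intPoly l ≠ 0) {q : ℂ} {ε : ℝ} (hε : 0 < ε)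
    (hε1 : ε < 1) (h : ‖Polynomial.aeval q (intPoly l)‖ < ε ^ l.length) :
    ∃ z : ℂ, Polynomial.aeval z (intPoly l) = 0 ∧ ‖z - q‖ < ε := by
  by_contra! hcon
  set P : ℂ[X] := (intPoly l).map (algebraMap ℚ ℂ) with hP
  have hP0 : P ≠ 0 := (Polynomial.map_ne_zero_iff (algebraMap ℚ ℂ).injective).2 hl
  have heval : ∀ z, P.eval z = Polynomial.aeval z (intPoly l) := fun z => by
    rw [hP, Polynomial.eval_map, Polynomial.aeval_def]
  have hlead : 1 ≤ ‖P.leadingCoeff‖ := by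
    have h1 : P = (listVal (fun a : ℤ => a) l).map (Int.castRingHom ℂ) := by
      rw [hP, intPoly_eq_listVal, listVal_map, listVal_map]
      simp
    have h2 : P.leadingCoeff = (((listVal (fun a : ℤ => a) l).coeff P.natDegree : ℤ) : ℂ) := by
      conv_lhs => rw [Polynomial.leadingCoeff, h1, Polynomial.coeff_map]
      rw [← h1]
      rfl
    have h3 : (listVal (fun a : ℤ => a) l).coeff P.natDegree ≠ 0 := by
      intro h0
      rw [h0, Int.cast_zero, Polynomial.leadingCoeff_eq_zero] at h2
      exact hP0 h2
    rw [h2, Complex.norm_intCast]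
    exact_mod_cast Int.one_le_abs h3
  have hdeg : P.natDegree ≤ l.length :=
    Polynomial.natDegree_map_le.trans
      (intPoly_eq_listVal l ▸ natDegree_listVal_le (fun a : ℤ => (a : ℚ)) l)
  have hprod : P.eval q = P.leadingCoeff * (P.roots.map fun a => q - a).prod := by
    exact (IsAlgClosed.splits P).eval_eq_prod_roots q
  have hcard : P.roots.card = P.natDegree := (IsAlgClosed.splits P).natDegree_eq_card_roots.symm
  have hge : ε ^ P.roots.card ≤ ‖(P.roots.map fun a => q - a).prod‖ := by
    have hroots : ∀ a ∈ P.roots, ε ≤ ‖q - a‖ := by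
      intro a ha
      rw [norm_sub_rev]
      exact hcon a (by rw [← heval]; exact Polynomial.isRoot_of_mem_roots ha)
    clear hprod hcard
    generalize P.roots = s at hroots
    induction s using Multiset.induction_on with
    | empty => simp
    | cons a s ih =>
      rw [Multiset.map_cons, Multiset.prod_cons, Multiset.card_cons, norm_mul, pow_succ']
      exact mul_le_mul (hroots a (Multiset.mem_cons_self a s))
        (ih fun b hb => hroots b (Multiset.mem_cons_of_mem hb)) (by positivity) (by positivity)
  have : ε ^ l.length ≤ ‖P.eval q‖ := by
    rw [hprod, norm_mul]
    calc ε ^ l.length ≤ ε ^ P.roots.card :=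
          pow_le_pow_of_le_one hε.le hε1.le (hcard ▸ hdeg)
      _ ≤ ‖(P.roots.map fun a => q - a).prod‖ := hge
      _ ≤ _ := le_mul_of_one_le_left (norm_nonneg _) hlead
  rw [heval] at this
  exact absurd h (not_lt.2 this)

/-- The value of the defining polynomial at a Gaussian rational. -/
def fieldEval (F : FieldCode) (q : GaussCode) : GaussCode :=
  horner (fun a : ℤ => (intCode a, zero)) q F.1

theorem gaussVal_real (a : RatCode) : gaussVal (a, zero) = ratVal a := by
  simp [gaussVal, isVal_ratVal.zero]

theorem gaussVal_fieldEval (F : FieldCode) (q : GaussCode) :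
    gaussVal (fieldEval F q) = Polynomial.aeval (gaussVal q) (intPoly F.1) := by
  rw [fieldEval, isVal_gaussVal.horner, intPoly_eq_listVal, Polynomial.aeval_def, eval₂_listVal]
  congr 1
  funext a s
  rw [gaussVal_real, ratVal_intCode]
  rfl

/-- A certificate for `‖θ - q‖ < ε`. -/
def nearField (F : FieldCode) (q : GaussCode) (ε : RatCode) : Bool :=
  ratLt zero ε && (ratLt ε one && (gaussLt (fieldEval F q) (pow ε F.1.length) &&
    gaussLt (CodeRing.sub q F.2.1) (CodeRing.sub F.2.2 ε)))

theorem nearField_iff (F : FieldCode) (q : GaussCode) (ε : RatCode) : nearField F q ε = true ↔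
    (0 < (ratVal ε : ℝ) ∧ (ratVal ε : ℝ) < 1 ∧
      ‖Polynomial.aeval (gaussVal q) (intPoly F.1)‖ < (ratVal ε : ℝ) ^ F.1.length ∧
      ‖gaussVal q - gaussVal F.2.1‖ < (ratVal F.2.2 : ℝ) - (ratVal ε : ℝ)) := by
  simp only [nearField, Bool.and_eq_true, ratLt_iff, gaussLt_iff, isVal_ratVal.zero,
    isVal_ratVal.one, isVal_ratVal.pow, isVal_ratVal.sub, isVal_gaussVal.sub, gaussVal_fieldEval]
  push_cast
  rw [show (0 : ℚ) < ratVal ε ↔ (0 : ℝ) < (ratVal ε : ℝ) by exact_mod_cast Iff.rfl,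
    show ratVal ε < (1 : ℚ) ↔ (ratVal ε : ℝ) < (1 : ℝ) by exact_mod_cast Iff.rfl]

/-- The value at `q` is so small that some root lies within ε of `q`; the last condition of the
certificate puts that root in the isolating disc, so it is θ. -/
theorem FieldRepresents.norm_sub_lt {F : FieldCode} {θ : Qbar} (h : FieldRepresents F θ)
    {q : GaussCode} {ε : RatCode} (hq : nearField F q ε = true) :
    ‖(θ : ℂ) - gaussVal q‖ < (ratVal ε : ℝ) := by
  obtain ⟨h1, h2, h3, h4⟩ := (nearField_iff F q ε).1 hq
  obtain ⟨z, hz, hzq⟩ := exists_root_near h.1.ne_zero h1 h2 h3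
  have := (h.2 z).1 ⟨hz, by
    calc ‖z - gaussVal F.2.1‖ = ‖(z - gaussVal q) + (gaussVal q - gaussVal F.2.1)‖ := by ring_nf
      _ ≤ ‖z - gaussVal q‖ + ‖gaussVal q - gaussVal F.2.1‖ := norm_add_le _ _
      _ < (ratVal F.2.2 : ℝ) := by linarith⟩
  rw [← this]
  exact hzq

/-- Horner evaluation in ball arithmetic, for an argument in the ball of centre `q` and
radius `ε`. -/
def ballHorner (q : ℂ) (ε : ℝ) (c : NumCode) : ℂ × ℝ :=
  c.foldr (fun a s => ((ratVal a : ℂ) + q * s.1,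
    -- From θ s - q s₁ = θ (s - s₁) + (θ - q) s₁. Absolute values are bounded by |Re| + |Im|, which
    -- keeps the radius rational for rational data.
    (|q.re| + |q.im| + ε) * s.2 + ε * (|s.1.re| + |s.1.im|))) (0, 0)

theorem ballHorner_zero (θ : Qbar) (c : NumCode) :
    ballHorner (θ : ℂ) 0 c = ((numVal θ c : ℂ), 0) := by
  induction c with
  | nil => simp [ballHorner, numVal]
  | cons a c ih =>
    rw [ballHorner, List.foldr_cons, ← ballHorner, ih]
    simp only [numVal, List.foldr_cons]
    push_cast
    simp

theorem continuous_ballHorner (c : NumCode) :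
    Continuous fun p : ℂ × ℝ => ballHorner p.1 p.2 c := by
  induction c with
  | nil => exact continuous_const
  | cons a c ih =>
    simp only [ballHorner, List.foldr_cons] at ih ⊢
    have h1 := Complex.continuous_re
    have h2 := Complex.continuous_im
    fun_prop

theorem norm_sub_ballHorner_le {θ : Qbar} {q : ℂ} {ε : ℝ} (h : ‖(θ : ℂ) - q‖ < ε) (c : NumCode) :
    ‖(numVal θ c : ℂ) - (ballHorner q ε c).1‖ ≤ (ballHorner q ε c).2 := by
  induction c with
  | nil => simp [ballHorner, numVal]
  | cons a c ih =>
    have hε := (norm_nonneg _).trans_lt h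
    rw [ballHorner, List.foldr_cons, ← ballHorner]
    set s := ballHorner q ε c
    have hval : (numVal θ (a :: c) : ℂ) = ratVal a + θ * (numVal θ c : ℂ) := by
      simp only [numVal, List.foldr_cons]
      push_cast
      rfl
    have hθ : ‖(θ : ℂ)‖ ≤ |q.re| + |q.im| + ε := by
      have h1 : ‖(θ : ℂ)‖ ≤ ‖q‖ + ‖(θ : ℂ) - q‖ := by
        simpa using norm_add_le q ((θ : ℂ) - q)
      have h2 := Complex.norm_le_abs_re_add_abs_im q
      linarith
    calc ‖(numVal θ (a :: c) : ℂ) - (ratVal a + q * s.1)‖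
        = ‖(θ : ℂ) * ((numVal θ c : ℂ) - s.1) + ((θ : ℂ) - q) * s.1‖ := by rw [hval]; ring_nf
      _ ≤ ‖(θ : ℂ)‖ * ‖(numVal θ c : ℂ) - s.1‖ + ‖(θ : ℂ) - q‖ * ‖s.1‖ := by
        rw [← norm_mul, ← norm_mul]; exact norm_add_le _ _
      _ ≤ (|q.re| + |q.im| + ε) * s.2 + ε * (|s.1.re| + |s.1.im|) := by
        refine add_le_add (mul_le_mul hθ ih (norm_nonneg _) (by positivity))
          (mul_le_mul h.le (Complex.norm_le_abs_re_add_abs_im _) (norm_nonneg _) hε.le)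

/-- The computation of `ballHorner` on codes. -/
def ballCode (q : GaussCode) (ε : RatCode) (c : NumCode) : GaussCode × RatCode :=
  c.foldr (fun a s => (add (a, zero) (mul q s.1),
    add (mul (add (gaussAbs q) ε) s.2) (mul ε (gaussAbs s.1)))) (zero, zero)

theorem ballCode_val (q : GaussCode) (ε : RatCode) (c : NumCode) :
    ballHorner (gaussVal q) (ratVal ε) c =
      (gaussVal (ballCode q ε c).1, (ratVal (ballCode q ε c).2 : ℝ)) := by
  induction c with
  | nil => simp [ballHorner, ballCode, isVal_gaussVal.zero, isVal_ratVal.zero]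
  | cons a c ih =>
    rw [ballHorner, List.foldr_cons, ← ballHorner, ih,
      show ballCode q ε (a :: c) = (add (a, zero) (mul q (ballCode q ε c).1),
        add (mul (add (gaussAbs q) ε) (ballCode q ε c).2)
          (mul ε (gaussAbs (ballCode q ε c).1))) from rfl]
    simp only [isVal_gaussVal.add, isVal_gaussVal.mul, isVal_ratVal.add, isVal_ratVal.mul,
      gaussVal_real]
    push_cast
    rw [ratVal_gaussAbs, ratVal_gaussAbs]

section Primrec

variable {α : Type*} [Primcodable α]

@[fun_prop]
theorem primrec_nearField {F : α → FieldCode} {q : α → GaussCode} {ε : α → RatCode}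
    (hF : Primrec F) (hq : Primrec q) (hε : Primrec ε) :
    Primrec fun a => nearField (F a) (q a) (ε a) := by
  unfold nearField fieldEval; fun_prop

@[fun_prop]
theorem primrec_ballCode {q : α → GaussCode} {ε : α → RatCode} {c : α → NumCode}
    (hq : Primrec q) (hε : Primrec ε) (hc : Primrec c) :
    Primrec fun a => ballCode (q a) (ε a) (c a) := by
  unfold ballCode; fun_prop

end Primrec

/-- Completeness of ball arithmetic: `ballHorner` is continuous and is exact at (θ, 0), so a strict
inequality for the exact value persists for the computed ball once (q, ε) is close to (θ, 0). -/
theorem FieldRepresents.exists_ballCode {F : FieldCode} {θ : Qbar} (h : FieldRepresents F θ)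
    {c : NumCode} {z : ℂ} {r : ℝ} (hc : ‖(numVal θ c : ℂ) - z‖ < r) :
    ∃ q ε, nearField F q ε = true ∧
      ‖gaussVal (ballCode q ε c).1 - z‖ < r - ratVal (ballCode q ε c).2 := by
  have hroot := (h.2 (θ : ℂ)).2 rfl
  have hcont : Continuous fun p : ℂ × ℝ =>
      ‖(ballHorner p.1 p.2 c).1 - z‖ + (ballHorner p.1 p.2 c).2 := by
    have := continuous_ballHorner c
    fun_prop
  have hopen : IsOpen {p : ℂ × ℝ | ‖(ballHorner p.1 p.2 c).1 - z‖ + (ballHorner p.1 p.2 c).2 < r} :=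
    isOpen_lt hcont continuous_const
  have hmem : ((θ : ℂ), (0 : ℝ)) ∈
      {p : ℂ × ℝ | ‖(ballHorner p.1 p.2 c).1 - z‖ + (ballHorner p.1 p.2 c).2 < r} := by
    rw [Set.mem_ofPred_eq, ballHorner_zero]
    simpa using hc
  obtain ⟨δ, hδ, hball⟩ := Metric.isOpen_iff.1 hopen _ hmem
  -- Fixing ε first, below the margin of θ in the isolating disc, makes the conditions on `q` open
  -- and true at `q = θ`.
  obtain ⟨ε, hε0, hε1⟩ := exists_ratVal_btwn (show (0 : ℝ) < min (min δ 1)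
    (ratVal F.2.2 - ‖(θ : ℂ) - gaussVal F.2.1‖) from
      lt_min (lt_min hδ one_pos) (by linarith [hroot.2]))
  rw [lt_min_iff, lt_min_iff] at hε1
  have hopen2 : IsOpen ({q : ℂ | ‖q - (θ : ℂ)‖ < δ} ∩
      ({q : ℂ | ‖Polynomial.aeval q (intPoly F.1)‖ < (ratVal ε : ℝ) ^ F.1.length} ∩
      {q : ℂ | ‖q - gaussVal F.2.1‖ < (ratVal F.2.2 : ℝ) - (ratVal ε : ℝ)})) := by
    refine IsOpen.inter ?_ (IsOpen.inter ?_ ?_)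
    · exact isOpen_lt (by fun_prop) continuous_const
    · exact isOpen_lt (Polynomial.continuous_aeval _).norm continuous_const
    · exact isOpen_lt (by fun_prop) continuous_const
  obtain ⟨q, hq1, hq2, hq3⟩ := exists_gaussVal_mem hopen2 (z := (θ : ℂ))
    ⟨by simpa using hδ, by simpa [hroot.1] using pow_pos hε0 _, by
      simp only [Set.mem_ofPred_eq]; linarith [hε1.2]⟩
  refine ⟨q, ε, (nearField_iff F q ε).2 ⟨hε0, hε1.1.2, hq2, hq3⟩, ?_⟩
  have : (gaussVal q, (ratVal ε : ℝ)) ∈ Metric.ball ((θ : ℂ), (0 : ℝ)) δ := by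
    rw [Metric.mem_ball, Prod.dist_eq, max_lt_iff]
    refine ⟨by simpa [dist_eq_norm] using hq1, ?_⟩
    rw [Real.dist_eq, sub_zero, abs_of_pos hε0]
    exact hε1.1.1
  have := hball this
  rw [Set.mem_ofPred_eq, ballCode_val] at this
  simp only at this
  linarith

/-- The witness is an approximation of θ precise enough for the whole computed ball to lie in the
given disc. -/
theorem SD.norm_sub_lt {β : Type} [Primcodable β] {c : β → NumCode} {g : β → GaussCode}
    {r : β → RatCode} (hc : Primrec c) (hg : Primrec g) (hr : Primrec r) :
    SD fun θ b => ‖(numVal θ (c b) : ℂ) - gaussVal (g b)‖ < (ratVal (r b) : ℝ) := by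
  refine of_search (γ := GaussCode × RatCode) (f := fun p => nearField p.1.1 p.2.1 p.2.2 &&
    gaussLt (CodeRing.sub (ballCode p.2.1 p.2.2 (c p.1.2)).1 (g p.1.2))
      (CodeRing.sub (r p.1.2) (ballCode p.2.1 p.2.2 (c p.1.2)).2)) (by fun_prop) ?_
  intro F θ hF b
  simp only [Bool.and_eq_true, gaussLt_iff, isVal_gaussVal.sub, isVal_ratVal.sub, Rat.cast_sub]
  constructor
  · intro h
    obtain ⟨q, ε, h1, h2⟩ := hF.exists_ballCode h
    exact ⟨(q, ε), h1, h2⟩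
  · rintro ⟨⟨q, ε⟩, h1, h2⟩
    have h3 := norm_sub_ballHorner_le (hF.norm_sub_lt h1) (c b)
    rw [ballCode_val] at h3
    simp only at h3
    calc _ = ‖((numVal θ (c b) : ℂ) - gaussVal (ballCode q ε (c b)).1) +
          (gaussVal (ballCode q ε (c b)).1 - gaussVal (g b))‖ := by ring_nf
      _ ≤ _ := norm_add_le _ _
      _ < _ := by linarith

/-! ### Logarithms -/

theorem norm_log_one_add_le_two_mul {z : ℂ} (hz : ‖z‖ ≤ 1 / 2) :
    ‖Complex.log (1 + z)‖ ≤ 2 * ‖z‖ := by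
  have := Complex.norm_log_one_add_half_le_self hz
  linarith [norm_nonneg z]

theorem norm_log_one_add_sub_le_sq {z : ℂ} (hz : ‖z‖ ≤ 1 / 2) :
    ‖Complex.log (1 + z) - z‖ ≤ ‖z‖ ^ 2 := by
  refine (Complex.norm_log_one_add_sub_self_le (by linarith)).trans ?_
  have h1 : (1 - ‖z‖)⁻¹ ≤ 2 := by
    rw [inv_le_comm₀ (by linarith) (by norm_num)]
    linarith
  nlinarith [sq_nonneg ‖z‖]

/-- A logarithm of `u` near `N h`, if `u` is close to `(1 + h) ^ N`. -/
theorem exists_exp_eq_of_near {u h : ℂ} {N : ℕ} {δ : ℝ} (hδ1 : δ < 1) (hh : ‖h‖ < 1 / 2)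
    (hN : N * ‖h‖ ^ 2 < δ / 2) (hu : ‖u - (1 + h) ^ N‖ < δ / 4 * ‖(1 + h) ^ N‖) :
    ∃ l, Complex.exp l = u ∧ ‖l - N * h‖ < δ := by
  have h0 : (1 : ℂ) + h ≠ 0 := by
    intro h0
    have : h = -1 := by linear_combination h0
    rw [this, norm_neg, norm_one] at hh
    norm_num at hh
  set v := (1 + h) ^ N with hv
  have hv0 : v ≠ 0 := pow_ne_zero _ h0
  have hvpos : 0 < ‖v‖ := norm_pos_iff.2 hv0
  set η := (u - v) / v with hη
  have hηn : ‖η‖ < δ / 4 := by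
    rw [hη, norm_div, div_lt_iff₀ hvpos]
    exact hu
  have huη : u = v * (1 + η) := by
    rw [hη]; field_simp; ring
  have h1η : (1 : ℂ) + η ≠ 0 := by
    intro h0
    have : η = -1 := by linear_combination h0
    rw [this, norm_neg, norm_one] at hηn
    linarith
  -- Here u = (1 + h)^N (1 + η). Replacing log (1 + h) by h costs at most N ‖h‖² < δ / 2, and log (1
  -- + η) is at most 2 ‖η‖ < δ / 2.
  refine ⟨N * Complex.log (1 + h) + Complex.log (1 + η), ?_, ?_⟩
  · rw [Complex.exp_add, Complex.exp_nat_mul, Complex.exp_log h0, Complex.exp_log h1η, huη]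
  · have e1 : ‖(N : ℂ) * (Complex.log (1 + h) - h)‖ ≤ N * ‖h‖ ^ 2 := by
      rw [norm_mul, Complex.norm_natCast]
      exact mul_le_mul_of_nonneg_left (norm_log_one_add_sub_le_sq hh.le) (Nat.cast_nonneg _)
    have e2 := norm_log_one_add_le_two_mul (z := η) (by linarith)
    calc _ = ‖(N : ℂ) * (Complex.log (1 + h) - h) + Complex.log (1 + η)‖ := by ring_nf
      _ ≤ _ := norm_add_le _ _
      _ < δ := by linarith

/-- Take N large: (1 + l / N)^N tends to exp l, while N ‖l / N‖² = ‖l‖² / N tends to 0. -/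
theorem exists_near_exp (l : ℂ) {δ : ℝ} (hδ : 0 < δ) : ∃ N : ℕ, 0 < N ∧ ‖l / N‖ < 1 / 2 ∧
    N * ‖l / N‖ ^ 2 < δ ∧ ‖Complex.exp l - (1 + l / N) ^ N‖ < δ * ‖(1 + l / N) ^ N‖ := by
  have h1 := Complex.tendsto_one_add_div_pow_exp l
  have h2 : Filter.Tendsto (fun N : ℕ => ‖Complex.exp l - (1 + l / N) ^ N‖ -
      δ * ‖(1 + l / N) ^ N‖) Filter.atTop (nhds (‖Complex.exp l - Complex.exp l‖ -
      δ * ‖Complex.exp l‖)) :=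
    (tendsto_const_nhds.sub h1).norm.sub (h1.norm.const_mul δ)
  have h3 : ‖Complex.exp l - Complex.exp l‖ - δ * ‖Complex.exp l‖ < 0 := by
    rw [sub_self, norm_zero, zero_sub, neg_lt_zero]
    exact mul_pos hδ (norm_pos_iff.2 (Complex.exp_ne_zero l))
  have h4 : Filter.Tendsto (fun N : ℕ => ‖l‖ / N) Filter.atTop (nhds 0) :=
    tendsto_const_div_atTop_nhds_zero_nat _
  have h5 : Filter.Tendsto (fun N : ℕ => ‖l‖ * (‖l‖ / N)) Filter.atTop (nhds 0) := by
    simpa using h4.const_mul ‖l‖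
  obtain ⟨N, hN⟩ := ((h2.eventually_lt_const h3).and ((h4.eventually_lt_const
    (show (0 : ℝ) < 1 / 2 by norm_num)).and ((h5.eventually_lt_const hδ).and
      (Filter.eventually_gt_atTop 0)))).exists
  have hN0 : (0 : ℝ) < N := by exact_mod_cast hN.2.2.2
  refine ⟨N, hN.2.2.2, ?_, ?_, by linarith [hN.1]⟩
  · rw [norm_div, Complex.norm_natCast]
    exact hN.2.1
  · rw [norm_div, Complex.norm_natCast]
    rw [show (N : ℝ) * (‖l‖ / N) ^ 2 = ‖l‖ * (‖l‖ / N) by field_simp]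
    exact hN.2.2.1

/-- `N h` lies near a logarithm, up to `δ`, of every number within `t` of `(1 + h) ^ N`, and the
ball with centre `N h` and radius `δ` lies in the balls `(q, 1)` and `(g, r)`. -/
def logTest (q g : GaussCode) (r : RatCode) (h : GaussCode) (N : ℕ) (δ t : RatCode) : Bool :=
  ratLt zero t && (ratLt zero δ && (ratLt δ one && (gaussLt (add h h) one &&
    (ratLt (mul (intCode (2 * N)) (gaussNormSq h)) δ &&
    (gaussLt (CodeRing.sub (mul (intCode N, zero) h) q) (CodeRing.sub one δ) &&
    (gaussLt (CodeRing.sub (mul (intCode N, zero) h) g) (CodeRing.sub r δ) &&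
    -- The inequality t < δ / 4 * ‖(1 + h)^N‖, squared so that only rational numbers occur.
    ratLt (mul (intCode 16) (mul t t))
      (mul (mul δ δ) (gaussNormSq (pow (add one h) N)))))))))

theorem logTest_iff (q g : GaussCode) (r : RatCode) (h : GaussCode) (N : ℕ) (δ t : RatCode) :
    logTest q g r h N δ t = true ↔
      (0 < (ratVal t : ℝ) ∧ 0 < (ratVal δ : ℝ) ∧ (ratVal δ : ℝ) < 1 ∧ ‖gaussVal h‖ < 1 / 2 ∧
        N * ‖gaussVal h‖ ^ 2 < (ratVal δ : ℝ) / 2 ∧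
        ‖N * gaussVal h - gaussVal q‖ < 1 - (ratVal δ : ℝ) ∧
        ‖N * gaussVal h - gaussVal g‖ < (ratVal r : ℝ) - (ratVal δ : ℝ) ∧
        (ratVal t : ℝ) < (ratVal δ : ℝ) / 4 * ‖(1 + gaussVal h) ^ N‖) := by
  simp only [logTest, Bool.and_eq_true, ratLt_iff, gaussLt_iff, isVal_gaussVal.add,
    isVal_gaussVal.mul, isVal_gaussVal.sub, gaussVal_real, ratVal_intCode]
  simp only [← Rat.cast_lt (K := ℝ), isVal_ratVal.zero, isVal_ratVal.one, isVal_ratVal.mul,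
    isVal_ratVal.sub, Rat.cast_mul, ratVal_gaussNormSq, isVal_gaussVal.pow, isVal_gaussVal.add,
    isVal_gaussVal.one, ratVal_intCode]
  push_cast
  have e1 : ‖gaussVal h + gaussVal h‖ = 2 * ‖gaussVal h‖ := by
    rw [← two_mul, norm_mul]; simp
  rw [e1]
  refine and_congr_right fun ht => and_congr_right fun hδ => and_congr_right fun _ =>
    and_congr (by constructor <;> intro <;> linarith) (and_congr
    (by constructor <;> intro <;> linarith) (and_congr_right fun _ => and_congr_right fun _ => ?_))
  set V := ‖(1 + gaussVal h) ^ N‖ with hV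
  have hV0 : 0 ≤ V := norm_nonneg _
  rw [show 16 * ((ratVal t : ℝ) * ratVal t) = (4 * ratVal t) ^ 2 by ring,
    show (ratVal δ : ℝ) * ratVal δ * V ^ 2 = (ratVal δ * V) ^ 2 by ring,
    sq_lt_sq₀ (by positivity) (by positivity)]
  constructor <;> intro <;> linarith

@[fun_prop]
theorem primrec_logTest {α : Type*} [Primcodable α] {q g : α → GaussCode} {r : α → RatCode}
    {h : α → GaussCode} {N : α → ℕ} {δ t : α → RatCode} (hq : Primrec q) (hg : Primrec g)
    (hr : Primrec r) (hh : Primrec h) (hN : Primrec N) (hδ : Primrec δ) (ht : Primrec t) :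
    Primrec fun a => logTest (q a) (g a) (r a) (h a) (N a) (δ a) (t a) := by
  unfold logTest; fun_prop

/-- All conditions are strict and hold at h = l / N for large N, hence at some Gaussian rational
nearby. The intermediate bound `t` separates a decidable condition on rational data from the
closeness of `u`, which is only semidecidable. -/
theorem exists_logTest {u l : ℂ} (hl : Complex.exp l = u) {q g : GaussCode} {r : RatCode}
    (hq : ‖l - gaussVal q‖ < 1) (hg : ‖l - gaussVal g‖ < (ratVal r : ℝ)) :
    ∃ h N δ t, logTest q g r h N δ t = true ∧
      ‖u - gaussVal (pow (add one h) N)‖ < (ratVal t : ℝ) := by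
  obtain ⟨δ, hδ0, hδ1⟩ := exists_ratVal_btwn (show (0 : ℝ) < min (min 1 (1 - ‖l - gaussVal q‖))
    (ratVal r - ‖l - gaussVal g‖) from
      lt_min (lt_min one_pos (by linarith)) (by linarith))
  rw [lt_min_iff, lt_min_iff] at hδ1
  obtain ⟨N, hN0, hN1, hN2, hN3⟩ := exists_near_exp l (show (0 : ℝ) < ratVal δ / 4 by positivity)
  have hopen : IsOpen ({h : ℂ | ‖h‖ < 1 / 2} ∩ ({h : ℂ | N * ‖h‖ ^ 2 < (ratVal δ : ℝ) / 2} ∩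
      ({h : ℂ | ‖N * h - gaussVal q‖ < 1 - (ratVal δ : ℝ)} ∩
      ({h : ℂ | ‖N * h - gaussVal g‖ < (ratVal r : ℝ) - (ratVal δ : ℝ)} ∩
      {h : ℂ | ‖u - (1 + h) ^ N‖ < (ratVal δ : ℝ) / 4 * ‖(1 + h) ^ N‖})))) := by
    refine IsOpen.inter ?_ (IsOpen.inter ?_ (IsOpen.inter ?_ (IsOpen.inter ?_ ?_))) <;>
      exact isOpen_lt (by fun_prop) (by fun_prop)
  have hNl : (N : ℂ) * (l / N) = l := by
    have : (N : ℂ) ≠ 0 := by exact_mod_cast hN0.ne'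
    field_simp
  obtain ⟨h, h1, h2, h3, h4, h5⟩ := exists_gaussVal_mem hopen (z := l / N)
    ⟨hN1, by simp only [Set.mem_ofPred_eq]; linarith,
      by simp only [Set.mem_ofPred_eq, hNl]; linarith [hδ1.1.2],
      by simp only [Set.mem_ofPred_eq, hNl]; linarith [hδ1.2], by rw [← hl]; exact hN3⟩
  obtain ⟨t, ht1, ht2⟩ := exists_ratVal_btwn (Set.mem_ofPred_eq ▸ h5)
  refine ⟨h, N, δ, t, (logTest_iff _ _ _ _ _ _ _).2 ⟨(norm_nonneg _).trans_lt ht1, hδ0, hδ1.1.1,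
    h1, h2, h3, h4, ht2⟩, ?_⟩
  rw [isVal_gaussVal.pow, isVal_gaussVal.add, isVal_gaussVal.one]
  exact ht1

/-- Some logarithm lies within δ of `N h`, and the test leaves room δ inside both balls. -/
theorem exists_exp_eq_of_logTest {u : ℂ} {q g : GaussCode} {r : RatCode} {h : GaussCode} {N : ℕ}
    {δ t : RatCode} (hT : logTest q g r h N δ t = true)
    (hu : ‖u - gaussVal (pow (add one h) N)‖ < (ratVal t : ℝ)) :
    ∃ l, Complex.exp l = u ∧ ‖l - gaussVal q‖ < 1 ∧ ‖l - gaussVal g‖ < (ratVal r : ℝ) := by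
  obtain ⟨_, _, h1, h2, h3, h4, h5, h6⟩ := (logTest_iff _ _ _ _ _ _ _).1 hT
  rw [isVal_gaussVal.pow, isVal_gaussVal.add, isVal_gaussVal.one] at hu
  obtain ⟨l, hl, hl'⟩ := exists_exp_eq_of_near h1 h2 h3 (hu.trans h6)
  have key : ∀ c : ℂ, ‖l - c‖ ≤ ‖l - N * gaussVal h‖ + ‖N * gaussVal h - c‖ := fun c => by
    simpa using norm_add_le (l - N * gaussVal h) (N * gaussVal h - c)
  exact ⟨l, hl, by linarith [key (gaussVal q)], by linarith [key (gaussVal g)]⟩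

/-- The logarithm of `u` near `q` lies within `r` of `g`. -/
def LogNear (u : ℂ) (q g : GaussCode) (r : RatCode) : Prop :=
  ∃ l, Complex.exp l = u ∧ ‖l - gaussVal q‖ < 1 ∧ ‖l - gaussVal g‖ < (ratVal r : ℝ)

theorem SD.logNear {β : Type} [Primcodable β] {u : β → NumCode} {q g : β → GaussCode}
    {r : β → RatCode} (hu : Primrec u) (hq : Primrec q) (hg : Primrec g) (hr : Primrec r) :
    SD fun θ b => LogNear (numVal θ (u b)) (q b) (g b) (r b) := by
  refine (ex (Φ := fun θ (p : β × GaussCode × ℕ × RatCode × RatCode) =>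
    logTest (q p.1) (g p.1) (r p.1) p.2.1 p.2.2.1 p.2.2.2.1 p.2.2.2.2 = true ∧
      ‖(numVal θ (u p.1) : ℂ) - gaussVal (pow (add one p.2.1) p.2.2.1)‖ <
        (ratVal p.2.2.2.2 : ℝ)) ?_).of_eq fun F θ hF b => ?_
  · exact (of_bool (by fun_prop)).and (norm_sub_lt (by fun_prop) (by fun_prop) (by fun_prop))
  · constructor
    · rintro ⟨l, h1, h2, h3⟩
      obtain ⟨h, N, δ, t, h4⟩ := exists_logTest h1 h2 h3
      exact ⟨(h, N, δ, t), h4⟩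
    · rintro ⟨p, h1, h2⟩
      exact exists_exp_eq_of_logTest h1 h2

/-- Two logarithms of one number differ by a multiple of 2πi, and 2π > 6. -/
theorem eq_of_exp_eq_of_norm_sub_lt {a b : ℂ} (h : Complex.exp a = Complex.exp b)
    (hab : ‖a - b‖ < 6) : a = b := by
  obtain ⟨n, hn⟩ := Complex.exp_eq_exp_iff_exists_int.1 h
  have hn' : a - b = n * (2 * Real.pi * Complex.I) := by linear_combination hn
  rw [hn', norm_mul, Complex.norm_intCast] at hab
  have h2 : ‖(2 * Real.pi * Complex.I : ℂ)‖ = 2 * Real.pi := by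
    simp [abs_of_pos Real.pi_pos]
  rw [h2] at hab
  have hn0 : n = 0 := by
    by_contra hne
    have h1 : (1 : ℝ) ≤ |(n : ℝ)| := by exact_mod_cast Int.one_le_abs hne
    nlinarith [Real.pi_gt_three]
  rw [hn0] at hn
  simpa using hn

theorem eq_of_exp_eq_of_near {a b c : ℂ} (h : Complex.exp a = Complex.exp b) (ha : ‖a - c‖ < 1)
    (hb : ‖b - c‖ < 1) : a = b := by
  refine eq_of_exp_eq_of_norm_sub_lt h ?_
  calc ‖a - b‖ = ‖(a - c) - (b - c)‖ := by ring_nf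
    _ ≤ _ := norm_sub_le _ _
    _ < 6 := by linarith

theorem exists_gaussVal_near (z : ℂ) {ε : ℝ} (hε : 0 < ε) : ∃ g, ‖z - gaussVal g‖ < ε := by
  obtain ⟨g, hg⟩ := exists_gaussVal_mem (Metric.isOpen_ball (x := z) (ε := ε))
    (Metric.mem_ball_self hε)
  exact ⟨g, by rwa [Metric.mem_ball, dist_comm, dist_eq_norm] at hg⟩

/-- The terms `n log u` of a linear form in logarithms, where `log u` is the logarithm near `q`. -/
abbrev LogTerm := ℤ × NumCode × GaussCode

/-- The numerical test for the vanishing of a linear form in logarithms whose value is known to be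
a multiple of `2πi`. -/
def LogSumSmall (θ : Qbar) (l : List LogTerm) : Prop :=
  ∃ (T : List (LogTerm × GaussCode)) (ε : RatCode), T.map Prod.fst = l ∧
    -- The true sum is within ε ∑ |n| of the approximate one, so passing this test forces its
    -- absolute value below 6.
    (gaussLt (CodeRing.sum (T.map fun t => mul (intCode t.1.1, zero) t.2))
      (CodeRing.sub (intCode 6) (mul ε
        (CodeRing.sum (T.map fun t => intCode (t.1.1.natAbs : ℤ))))) = true) ∧
    ∀ t ∈ T, LogNear (numVal θ t.1.2.1) t.1.2.2 t.2 ε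

theorem SD.logSumSmall {β : Type} [Primcodable β] {l : β → List LogTerm} (hl : Primrec l) :
    SD fun θ b => LogSumSmall θ (l b) := by
  refine ex (Φ := fun θ (p : β × List (LogTerm × GaussCode)) =>
    ∃ (ε : RatCode), p.2.map Prod.fst = l p.1 ∧
    (gaussLt (CodeRing.sum (p.2.map fun t => mul (intCode t.1.1, zero) t.2))
      (CodeRing.sub (intCode 6) (mul ε
        (CodeRing.sum (p.2.map fun t => intCode (t.1.1.natAbs : ℤ))))) = true) ∧
    ∀ t ∈ p.2, LogNear (numVal θ t.1.2.1) t.1.2.2 t.2 ε) ?_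
  refine ex (Φ := fun θ (p : (β × List (LogTerm × GaussCode)) × RatCode) =>
    p.1.2.map Prod.fst = l p.1.1 ∧
    (gaussLt (CodeRing.sum (p.1.2.map fun t => mul (intCode t.1.1, zero) t.2))
      (CodeRing.sub (intCode 6) (mul p.2
        (CodeRing.sum (p.1.2.map fun t => intCode (t.1.1.natAbs : ℤ))))) = true) ∧
    ∀ t ∈ p.1.2, LogNear (numVal θ t.1.2.1) t.1.2.2 t.2 p.2) ?_
  refine (decide_eq (by fun_prop) (by fun_prop)).and ((of_bool (by fun_prop)).and ?_)
  exact forall_mem (Φ := fun θ (p : ((β × List (LogTerm × GaussCode)) × RatCode) × LogTerm ×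
    GaussCode) => LogNear (numVal θ p.2.1.2.1) p.2.1.2.2 p.2.2 p.1.2)
    (logNear (by fun_prop) (by fun_prop) (by fun_prop) (by fun_prop)) (by fun_prop)

/-- `μ` is the list of the logarithms in the terms `l`. -/
def LogValues (θ : Qbar) (l : List LogTerm) (μ : LogTerm → ℂ) : Prop :=
  ∀ t ∈ l, Complex.exp (μ t) = numVal θ t.2.1 ∧ ‖μ t - gaussVal t.2.2‖ < 1

theorem norm_sum_sub_le {ι : Type*} (T : List ι) (n : ι → ℤ) (x y : ι → ℂ) {ε : ℝ}
    (h : ∀ t ∈ T, ‖x t - y t‖ ≤ ε) :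
    ‖(T.map fun t => (n t : ℂ) * x t).sum - (T.map fun t => (n t : ℂ) * y t).sum‖ ≤
      ε * (T.map fun t => |(n t : ℝ)|).sum := by
  induction T with
  | nil => simp
  | cons t T ih =>
    simp only [List.map_cons, List.sum_cons]
    have h1 := ih fun s hs => h s (List.mem_cons_of_mem _ hs)
    have h2 : ‖(n t : ℂ) * (x t - y t)‖ ≤ ε * |(n t : ℝ)| := by
      rw [norm_mul, Complex.norm_intCast, mul_comm]
      exact mul_le_mul_of_nonneg_right (h t List.mem_cons_self) (abs_nonneg _)
    calc _ = ‖(n t : ℂ) * (x t - y t) + ((T.map fun t => (n t : ℂ) * x t).sum -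
          (T.map fun t => (n t : ℂ) * y t).sum)‖ := by ring_nf
      _ ≤ _ := norm_add_le _ _
      _ ≤ _ := by linarith

/-- The sum is a multiple of 2πi, so a bound by 6 makes it vanish. Conversely, if it vanishes, fine
enough approximations of the logarithms pass the test. -/
theorem logSumSmall_iff {θ : Qbar} {l : List LogTerm} {μ : LogTerm → ℂ} (hμ : LogValues θ l μ)
    (hexp : Complex.exp (l.map fun t => (t.1 : ℂ) * μ t).sum = 1) :
    LogSumSmall θ l ↔ (l.map fun t => (t.1 : ℂ) * μ t).sum = 0 := by
  have hval : ∀ (T : List (LogTerm × GaussCode)) (ε : RatCode),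
      gaussLt (CodeRing.sum (T.map fun t => mul (intCode t.1.1, zero) t.2))
        (CodeRing.sub (intCode 6) (mul ε
          (CodeRing.sum (T.map fun t => intCode (t.1.1.natAbs : ℤ))))) = true ↔
      ‖(T.map fun t => (t.1.1 : ℂ) * gaussVal t.2).sum‖ <
        6 - ratVal ε * (T.map fun t => |(t.1.1 : ℝ)|).sum := by
    intro T ε
    rw [gaussLt_iff, isVal_gaussVal.sum, isVal_ratVal.sub, isVal_ratVal.mul, isVal_ratVal.sum,
      List.map_map, List.map_map, ratVal_intCode]
    have e1 : (gaussVal ∘ fun t : LogTerm × GaussCode => mul (intCode t.1.1, zero) t.2) =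
        fun t => (t.1.1 : ℂ) * gaussVal t.2 := by
      funext t
      rw [Function.comp_apply, isVal_gaussVal.mul, gaussVal_real, ratVal_intCode]
      simp
    have e2 : (((T.map (ratVal ∘ fun t : LogTerm × GaussCode =>
        intCode (t.1.1.natAbs : ℤ))).sum : ℚ) : ℝ) = (T.map fun t => |(t.1.1 : ℝ)|).sum := by
      rw [← Rat.coe_castHom, map_list_sum, List.map_map]
      congr 2
      funext t
      simp
    rw [e1]
    rw [Rat.cast_sub, Rat.cast_mul, e2]
    norm_num
  constructor
  · rintro ⟨T, ε, rfl, hT, hnear⟩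
    rw [hval] at hT
    have hT' : ∀ t ∈ T, ‖μ t.1 - gaussVal t.2‖ ≤ ratVal ε := by
      intro t ht
      obtain ⟨z, hz1, hz2, hz3⟩ := hnear t ht
      have hm := hμ t.1 (List.mem_map_of_mem ht)
      rw [eq_of_exp_eq_of_near (hm.1.trans hz1.symm) hm.2 hz2]
      exact hz3.le
    have h1 := norm_sum_sub_le T (fun t => t.1.1) (fun t => μ t.1) (fun t => gaussVal t.2) hT'
    rw [List.map_map] at hexp ⊢
    refine eq_of_exp_eq_of_norm_sub_lt (b := 0) (by rw [hexp, Complex.exp_zero]) ?_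
    rw [sub_zero]
    have h2 := norm_add_le ((T.map fun t => (t.1.1 : ℂ) * μ t.1).sum -
      (T.map fun t => (t.1.1 : ℂ) * gaussVal t.2).sum)
      (T.map fun t => (t.1.1 : ℂ) * gaussVal t.2).sum
    rw [sub_add_cancel] at h2
    refine lt_of_le_of_lt h2 ?_
    linarith
  · intro h0
    set S : ℝ := (l.map fun t => |(t.1 : ℝ)|).sum with hS
    have hS0 : 0 ≤ S := List.sum_nonneg fun x hx => by
      obtain ⟨t, _, rfl⟩ := List.mem_map.1 hx
      exact abs_nonneg _
    -- This gives ε S < 1, so the approximate sum, at most ε S, is below 6 - ε S.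
    obtain ⟨ε, hε0, hε1⟩ := exists_ratVal_btwn (show (0 : ℝ) < 1 / (S + 1) by positivity)
    rw [lt_div_iff₀ (by positivity)] at hε1
    choose g hg using fun t => exists_gaussVal_near (μ t) hε0
    refine ⟨l.map fun t => (t, g t), ε, by rw [List.map_map]; exact List.map_id l, ?_, ?_⟩
    · rw [hval, List.map_map, List.map_map]
      have h1 := norm_sum_sub_le l (fun t => t.1) (fun t => gaussVal (g t)) μ
        (ε := ratVal ε) fun t _ => by rw [norm_sub_rev]; exact (hg t).le
      rw [h0, sub_zero] at h1
      change ‖(l.map fun t => (t.1 : ℂ) * gaussVal (g t)).sum‖ < 6 - ratVal ε * S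
      refine h1.trans_lt ?_
      rw [← hS]
      nlinarith
    · intro t ht
      obtain ⟨s, hs, rfl⟩ := List.mem_map.1 ht
      exact ⟨μ s, (hμ s hs).1, (hμ s hs).2, hg s⟩

/-! ### Recognising the principal logarithm. -/

theorem SD.im_pos {β : Type} [Primcodable β] {c : β → NumCode} (hc : Primrec c) :
    SD fun θ b => 0 < (numVal θ (c b) : ℂ).im := by
  refine (ex (Φ := fun θ (p : β × GaussCode × RatCode) => ratLt p.2.2 p.2.1.2 = true ∧
    ‖(numVal θ (c p.1) : ℂ) - gaussVal p.2.1‖ < (ratVal p.2.2 : ℝ))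
    ((of_bool (by fun_prop)).and (norm_sub_lt (by fun_prop) (by fun_prop)
      (by fun_prop)))).of_eq fun F θ _ b => ?_
  have key : ∀ z w : ℂ, |z.im - w.im| ≤ ‖z - w‖ := fun z w => by
    rw [← Complex.sub_im]; exact Complex.abs_im_le_norm _
  simp only [ratLt_iff, ← Rat.cast_lt (K := ℝ), ← gaussVal_im]
  constructor
  · intro h
    obtain ⟨r, hr0, hr1⟩ := exists_ratVal_btwn (half_pos h)
    obtain ⟨g, hg⟩ := exists_gaussVal_near (numVal θ (c b) : ℂ) hr0
    refine ⟨(g, r), ?_, hg⟩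
    have := abs_le.1 ((key _ _).trans hg.le)
    simp only
    linarith [this.2]
  · rintro ⟨p, h1, h2⟩
    have := abs_le.1 ((key _ _).trans h2.le)
    linarith [this.1]

/-- A condition on `q` under which every logarithm of `u` at distance less than `1` from `q` is the
principal one. -/
def PrincipalNear (u : ℂ) (q : GaussCode) : Prop :=
  (ratLt (ratAbs q.2) (intCode 2) = true) ∨
    (0 < u.im ∧ (ratLt zero q.2 && ratLt q.2 (intCode 4)) = true) ∨
    (0 < (-u).im ∧ (ratLt (intCode (-4)) q.2 && ratLt q.2 zero) = true)

theorem SD.principalNear {β : Type} [Primcodable β] {u : β → NumCode} {q : β → GaussCode}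
    (hu : Primrec u) (hq : Primrec q) : SD fun θ b => PrincipalNear (numVal θ (u b)) (q b) := by
  have hneg : SD fun θ b => 0 < (-(numVal θ (u b) : ℂ)).im :=
    (im_pos (c := fun b => neg (u b)) (by fun_prop)).of_eq fun F θ _ b => by
      rw [(isVal_numVal θ).neg]; rfl
  exact (of_bool (by fun_prop)).or (((im_pos hu).and (of_bool (by fun_prop))).or
    (hneg.and (of_bool (by fun_prop))))

theorem principalNear_iff (u : ℂ) (q : GaussCode) : PrincipalNear u q ↔
    |(gaussVal q).im| < 2 ∨ (0 < u.im ∧ 0 < (gaussVal q).im ∧ (gaussVal q).im < 4) ∨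
      (u.im < 0 ∧ -4 < (gaussVal q).im ∧ (gaussVal q).im < 0) := by
  simp only [PrincipalNear, Bool.and_eq_true, ratLt_iff, ← Rat.cast_lt (K := ℝ), ratVal_ratAbs,
    gaussVal_im, ratVal_intCode, isVal_ratVal.zero, Complex.neg_im, neg_pos]
  norm_num

/-- Im l is within 1 of Im q. If |Im q| < 2, this gives |Im l| < 3 < π. Otherwise -1 < Im l < 5, or
the mirror image of this, and the sign of sin (Im l), which is that of Im u, excludes the part
beyond ±π. -/
theorem PrincipalNear.eq_log {u l : ℂ} {q : GaussCode} (h : PrincipalNear u q)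
    (hl : Complex.exp l = u) (hlq : ‖l - gaussVal q‖ < 1) : l = Complex.log u := by
  have him := abs_lt.1 ((Complex.abs_im_le_norm _).trans_lt hlq)
  rw [Complex.sub_im] at him
  have hsin : u.im = Real.exp l.re * Real.sin l.im := by rw [← hl, Complex.exp_im]
  have hexp := Real.exp_pos l.re
  have hpi := Real.pi_gt_three
  have hI : -Real.pi < l.im ∧ l.im ≤ Real.pi := by
    rcases (principalNear_iff u q).1 h with h1 | ⟨h1, h2, h3⟩ | ⟨h1, h2, h3⟩
    · rw [abs_lt] at h1
      constructor <;> linarith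
    · have h4 : 0 < Real.sin l.im := by
        rw [hsin] at h1
        exact pos_of_mul_pos_right h1 hexp.le
      refine ⟨by linarith, ?_⟩
      by_contra! h5
      have := Real.sin_nonneg_of_nonneg_of_le_pi (x := l.im - Real.pi) (by linarith) (by linarith)
      rw [Real.sin_sub_pi] at this
      linarith
    · have h4 : Real.sin l.im < 0 := by
        rw [hsin] at h1
        by_contra! h5
        exact absurd h1 (not_lt.2 (mul_nonneg hexp.le h5))
      refine ⟨?_, by linarith⟩
      by_contra! h5
      have := Real.sin_nonneg_of_nonneg_of_le_pi (x := l.im + 2 * Real.pi) (by linarith)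
        (by linarith)
      rw [Real.sin_add_two_pi] at this
      linarith
  rw [← hl, Complex.log_exp hI.1 hI.2]

/-- Off the negative real axis, either |arg u| < 2, or arg u is near ±π without being π. In the
second case Im u is nonzero and its sign tells the side; the bound 4 exceeds π. -/
theorem exists_principalNear {u : ℂ} (hu : u ∈ Complex.slitPlane) :
    ∃ q, PrincipalNear u q ∧ ‖Complex.log u - gaussVal q‖ < 1 := by
  have hball : IsOpen {z : ℂ | ‖Complex.log u - z‖ < 1} :=
    isOpen_lt (by fun_prop) continuous_const
  have him : Continuous fun z : ℂ => z.im := Complex.continuous_im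
  have hself : Complex.log u ∈ {z : ℂ | ‖Complex.log u - z‖ < 1} := by simp
  have harg := (Complex.mem_slitPlane_iff_arg.1 hu).1
  have hle := Complex.arg_le_pi u
  have hpi := Real.pi_lt_four
  have hsin : ∀ h : 0 < ‖u‖, u.im = ‖u‖ * Real.sin u.arg := fun h => by
    rw [Complex.sin_arg]; field_simp
  have hnorm : 0 < ‖u‖ := norm_pos_iff.2 (Complex.mem_slitPlane_iff_arg.1 hu).2
  by_cases h1 : |u.arg| < 2
  · obtain ⟨q, hq1, hq2⟩ := exists_gaussVal_mem (hball.inter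
      (isOpen_lt him.abs continuous_const : IsOpen {z : ℂ | |z.im| < 2}))
      ⟨hself, by simpa [Complex.log_im] using h1⟩
    exact ⟨q, (principalNear_iff u q).2 (Or.inl hq2), hq1⟩
  · rw [not_lt, le_abs] at h1
    rcases h1 with h1 | h1
    · have hpos : 0 < u.im := by
        rw [hsin hnorm]
        exact mul_pos hnorm (Real.sin_pos_of_pos_of_lt_pi (by linarith) (lt_of_le_of_ne hle harg))
      obtain ⟨q, hq1, hq2, hq3⟩ := exists_gaussVal_mem (hball.inter
        (((isOpen_lt continuous_const him) : IsOpen {z : ℂ | 0 < z.im}).inter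
        (isOpen_lt him continuous_const : IsOpen {z : ℂ | z.im < 4}))) (z := Complex.log u)
        ⟨hself, by simp only [Set.mem_ofPred_eq, Complex.log_im]; linarith,
          by simp only [Set.mem_ofPred_eq, Complex.log_im]; linarith⟩
      exact ⟨q, (principalNear_iff u q).2 (Or.inr (Or.inl ⟨hpos, hq2, hq3⟩)), hq1⟩
    · have hgt := Complex.neg_pi_lt_arg u
      have hneg : u.im < 0 := by
        rw [hsin hnorm]
        exact mul_neg_of_pos_of_neg hnorm (Real.sin_neg_of_neg_of_neg_pi_lt (by linarith) hgt)
      obtain ⟨q, hq1, hq2, hq3⟩ := exists_gaussVal_mem (hball.inter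
        (((isOpen_lt continuous_const him) : IsOpen {z : ℂ | -4 < z.im}).inter
        (isOpen_lt him continuous_const : IsOpen {z : ℂ | z.im < 0}))) (z := Complex.log u)
        ⟨hself, by simp only [Set.mem_ofPred_eq, Complex.log_im]; linarith,
          by simp only [Set.mem_ofPred_eq, Complex.log_im]; linarith⟩
      exact ⟨q, (principalNear_iff u q).2 (Or.inr (Or.inr ⟨hneg, hq2, hq3⟩)), hq1⟩

/-! ### Hermite reduction -/

section Hermite

open Polynomial

variable {m : ℕ} {K : Type*} [Field K]

/-- The monic polynomial with roots `d i`. -/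
def rootPoly (d : Fin m → K) : K[X] := ∏ i, (X - C (d i))

/-- The product of the factors `X - d j`, `j ≠ i`. -/
def rootCofactor (d : Fin m → K) (i : Fin m) : K[X] := ∏ j ∈ Finset.univ.erase i, (X - C (d j))

theorem rootCofactor_mul (d : Fin m → K) (i : Fin m) :
    rootCofactor d i * (X - C (d i)) = rootPoly d :=
  Finset.prod_erase_mul _ _ (Finset.mem_univ i)

theorem rootPoly_ne_zero (d : Fin m → K) : rootPoly d ≠ 0 :=
  (monic_prod_of_monic _ _ fun i _ => monic_X_sub_C (d i)).ne_zero

theorem eval₂_rootPoly_ne_zero {L : Type*} [Field L] (f : K →+* L) {d : Fin m → K} {z : L}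
    (h : ∀ i, f (d i) ≠ z) : (rootPoly d).eval₂ f z ≠ 0 := by
  rw [rootPoly, eval₂_finsetProd, Finset.prod_ne_zero_iff]
  intro i _
  rw [eval₂_sub, eval₂_X, eval₂_C, sub_ne_zero]
  exact (h i).symm

theorem exists_derivative_eq [CharZero K] (p : K[X]) : ∃ q, derivative q = p := by
  induction p using Polynomial.induction_on' with
  | add p q hp hq =>
    obtain ⟨a, rfl⟩ := hp
    obtain ⟨b, rfl⟩ := hq
    exact ⟨a + b, derivative_add⟩
  | monomial n a =>
    refine ⟨monomial (n + 1) (a / (n + 1)), ?_⟩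
    have : (n : K) + 1 ≠ 0 := by exact_mod_cast Nat.succ_ne_zero n
    rw [derivative_monomial]
    congr 1
    push_cast
    field_simp

/-- Lagrange interpolation: with r_i = S(d_i) / ∏ (d_i - d_j), the difference vanishes at every d_i,
hence is divisible by the product of the coprime linear factors. -/
theorem exists_partial_fractions {d : Fin m → K} (hd : Function.Injective d) (S : K[X]) :
    ∃ (G : K[X]) (r : Fin m → K), S = G * rootPoly d + ∑ i, C (r i) * rootCofactor d i := by
  have hne : ∀ i, (rootCofactor d i).eval (d i) ≠ 0 := by
    intro i
    rw [rootCofactor, eval_prod, Finset.prod_ne_zero_iff]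
    intro j hj
    rw [eval_sub, eval_X, eval_C, sub_ne_zero]
    exact fun h => Finset.ne_of_mem_erase hj (hd h).symm
  have hzero : ∀ i j, j ≠ i → (rootCofactor d j).eval (d i) = 0 := by
    intro i j hij
    rw [rootCofactor, eval_prod]
    exact Finset.prod_eq_zero (Finset.mem_erase.2 ⟨hij.symm, Finset.mem_univ i⟩) (by simp)
  let r : Fin m → K := fun i => S.eval (d i) / (rootCofactor d i).eval (d i)
  have hdvd : rootPoly d ∣ S - ∑ i, C (r i) * rootCofactor d i := by
    refine Fintype.prod_dvd_of_coprime (pairwise_coprime_X_sub_C hd) fun i => ?_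
    rw [dvd_iff_isRoot, IsRoot, eval_sub, eval_finsetSum, Finset.sum_eq_single i]
    · simp [r, hne i]
    · intro j _ hj
      simp [hzero i j hj]
    · simp
  obtain ⟨G, hG⟩ := hdvd
  exact ⟨G, r, by rw [mul_comm G, ← hG]; ring⟩

/-- Hermite reduction: `S / T ^ (n + 1)` is the sum of the derivative of some `U / T ^ n` and of a
linear combination of the `1 / (X - d i)`, where `T` is the product of the `X - d i`. -/
theorem exists_hermite_reduction [CharZero K] {d : Fin m → K} (hd : Function.Injective d) (n : ℕ) :
    ∀ S : K[X], ∃ (U : K[X]) (r : Fin m → K), S = derivative U * rootPoly d -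
      n * (U * derivative (rootPoly d)) + rootPoly d ^ n * ∑ i, C (r i) * rootCofactor d i := by
  induction n with
  | zero =>
    intro S
    obtain ⟨G, r, hS⟩ := exists_partial_fractions hd S
    obtain ⟨U, rfl⟩ := exists_derivative_eq G
    exact ⟨U, r, by rw [hS]; simp⟩
  | succ n ih =>
    intro S
    set T := rootPoly d with hT
    obtain ⟨a, b, hab⟩ : IsCoprime T (derivative T) := separable_prod_X_sub_C_iff.2 hd
    have hn : (C ((n : K) + 1)⁻¹ : K[X]) * (n + 1) = 1 := by
      have : (n : K) + 1 ≠ 0 := by exact_mod_cast Nat.succ_ne_zero n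
      rw [show ((n : K[X]) + 1) = C ((n : K) + 1) by simp, ← C_mul, inv_mul_cancel₀ this, C_1]
    set e : K[X] := C ((n : K) + 1)⁻¹ with he
    have hde : derivative e = 0 := derivative_C
    -- Integration by parts: since a T + b T' = 1, one has S / T^(n+2) = (S a + e (S b)') / T^(n+1)
    -- - (e S b / T^(n+1))' with e = 1 / (n + 1).
    obtain ⟨U, r, hS⟩ := ih (S * a + e * derivative (S * b))
    refine ⟨U * T - e * (S * b), r, ?_⟩
    have h1 : derivative (U * T - e * (S * b)) =
        derivative U * T + U * derivative T - e * derivative (S * b) := by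
      rw [derivative_sub, derivative_mul, derivative_mul (f := e), hde]
      ring
    rw [h1]
    push_cast
    set R := ∑ i, C (r i) * rootCofactor d i
    linear_combination (-S) * hab + T * hS - S * b * derivative T * hn

end Hermite

/-! ### Regular functions over the embedded number field -/

open scoped IntermediateField in
theorem exists_numVal_eq {θ x : Qbar} (hx : x ∈ ℚ⟮θ⟯) : ∃ c, numVal θ c = x := by
  have hθ : IsAlgebraic ℚ θ := (algebraicClosure.isAlgebraic ℚ ℂ).isAlgebraic θ
  rw [← IntermediateField.mem_toSubalgebra,
    IntermediateField.adjoin_simple_toSubalgebra_of_isAlgebraic hθ,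
    Algebra.adjoin_singleton_eq_range_aeval] at hx
  obtain ⟨p, rfl⟩ := hx
  obtain ⟨c, rfl⟩ := exists_listVal_eq (v := ratVal) (p := p) fun i => ratVal_surjective _
  exact ⟨c, numVal_eq_aeval θ c⟩

open scoped IntermediateField in
theorem numVal_mem (θ : Qbar) (c : NumCode) : numVal θ c ∈ ℚ⟮θ⟯ := by
  induction c with
  | nil => exact zero_mem _
  | cons a c ih =>
    exact add_mem (algebraMap_mem _ _) (mul_mem (IntermediateField.mem_adjoin_simple_self ℚ θ) ih)

/-- The field of algebraic numbers is algebraically closed, so the denominator splits; by regularity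
all its roots are among the d_i. -/
theorem denom_dvd_rootPoly_pow {m : ℕ} {d : Fin m ↪ Qbar} {f : RatFunc Qbar}
    (hf : f ∈ regularFunctions d) : ∃ N, f.denom ∣ rootPoly d ^ N := by
  have : IsAlgClosed Qbar := (algebraicClosure.isAlgClosure ℚ ℂ).isAlgClosed
  have hsplit : f.denom.Splits := IsAlgClosed.splits _
  refine ⟨f.denom.roots.card, ?_⟩
  have hroot : ∀ a ∈ f.denom.roots, Polynomial.X - Polynomial.C a ∣ rootPoly d := by
    intro a ha
    have ha0 : f.denom.eval a = 0 := Polynomial.isRoot_of_mem_roots ha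
    have : (a : ℂ) ∉ puncturedLine d := by
      intro hmem
      refine hf _ hmem ?_
      change f.denom.eval₂ (algebraMap Qbar ℂ) (algebraMap Qbar ℂ a) = 0
      rw [Polynomial.eval₂_at_apply, ha0, map_zero]
    simp only [puncturedLine, Set.mem_compl_iff, not_not, Set.mem_range] at this
    obtain ⟨i, hi⟩ := this
    rw [← Subtype.ext hi]
    exact Dvd.intro_left _ (rootCofactor_mul d i)
  have hprod : ∀ s : Multiset Qbar, (∀ a ∈ s, Polynomial.X - Polynomial.C a ∣ rootPoly d) →
      (s.map fun a => Polynomial.X - Polynomial.C a).prod ∣ rootPoly d ^ s.card := by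
    intro s
    induction s using Multiset.induction_on with
    | empty => simp
    | cons a s ih =>
      intro h
      rw [Multiset.map_cons, Multiset.prod_cons, Multiset.card_cons, pow_succ']
      exact mul_dvd_mul (h a (Multiset.mem_cons_self a s))
        (ih fun b hb => h b (Multiset.mem_cons_of_mem hb))
  rw [hsplit.eq_prod_roots_of_monic f.monic_denom]
  simpa using hprod _ hroot

/-- The fraction `P / Q` need not be reduced. The extra factor T gives the exponent the shape used
in Hermite reduction. -/
theorem dvd_mul_rootPoly_pow {m : ℕ} {d : Fin m ↪ Qbar} {f : RatFunc Qbar}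
    (hf : f ∈ regularFunctions d) {P Q : Qbar[X]} (hQ : Q ≠ 0)
    (hPQ : f = algebraMap Qbar[X] (RatFunc Qbar) P / algebraMap Qbar[X] (RatFunc Qbar) Q) :
    ∃ n, Q ∣ P * rootPoly d ^ (n + 1) := by
  obtain ⟨N, E, hE⟩ := denom_dvd_rootPoly_pow hf
  have h1 : P * f.denom = f.num * Q := by
    apply RatFunc.algebraMap_injective Qbar
    have hQ' : algebraMap Qbar[X] (RatFunc Qbar) Q ≠ 0 := by simpa using hQ
    have hd' : algebraMap Qbar[X] (RatFunc Qbar) f.denom ≠ 0 := by simpa using f.denom_ne_zero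
    rw [map_mul, map_mul, ← div_eq_div_iff hQ' hd', ← hPQ, RatFunc.num_div_denom]
  refine ⟨N, f.num * E * rootPoly d, ?_⟩
  rw [pow_succ, hE]
  linear_combination E * rootPoly d * h1

/-- The polynomial identity which says that `P / Q` is the sum of the derivative of `U / T ^ n` and
of the `r i / (X - d i)`, where `T` is the product of the `X - d i`. -/
def PrimitiveIdentity {m : ℕ} {K : Type*} [Field K] (d : Fin m → K) (P Q : K[X]) (n : ℕ)
    (U : K[X]) (r : Fin m → K) : Prop :=
  P * rootPoly d ^ (n + 1) = Q * (Polynomial.derivative U * rootPoly d -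
    n * (U * Polynomial.derivative (rootPoly d)) +
    rootPoly d ^ n * ∑ i, Polynomial.C (r i) * rootCofactor d i)

theorem map_rootPoly {m : ℕ} {K L : Type*} [Field K] [Field L] (f : K →+* L) (d : Fin m → K) :
    (rootPoly d).map f = rootPoly fun i => f (d i) := by
  simp [rootPoly, Polynomial.map_prod]

theorem map_rootCofactor {m : ℕ} {K L : Type*} [Field K] [Field L] (f : K →+* L) (d : Fin m → K)
    (i : Fin m) : (rootCofactor d i).map f = rootCofactor (fun i => f (d i)) i := by
  simp [rootCofactor, Polynomial.map_prod]

theorem PrimitiveIdentity.map {m : ℕ} {K L : Type*} [Field K] [Field L] (f : K →+* L)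
    {d : Fin m → K} {P Q : K[X]} {n : ℕ} {U : K[X]} {r : Fin m → K}
    (h : PrimitiveIdentity d P Q n U r) :
    PrimitiveIdentity (fun i => f (d i)) (P.map f) (Q.map f) n (U.map f) fun i => f (r i) := by
  have := congrArg (Polynomial.map f) h
  simpa only [PrimitiveIdentity, Polynomial.map_mul, Polynomial.map_pow, Polynomial.map_sub,
      Polynomial.map_add, Polynomial.map_sum, Polynomial.map_natCast, map_rootPoly,
      map_rootCofactor,
      ← Polynomial.derivative_map, Polynomial.map_C] using this

open scoped IntermediateField in
-- Divisibility descends from the algebraic numbers to ℚ(θ), so Hermite reduction can be carried out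
-- over ℚ(θ), where all coefficients have codes in terms of θ; the identity is then mapped back.
theorem exists_primitiveIdentity {m : ℕ} {θ : Qbar} {d : Fin m ↪ Qbar} {f : RatFunc Qbar}
    (hf : f ∈ regularFunctions d) {dc : Fin m → NumCode} (hd : ∀ i, numVal θ (dc i) = d i)
    {P Q : PolyCode} (hQ : polyVal θ Q ≠ 0)
    (hPQ : f = algebraMap Qbar[X] (RatFunc Qbar) (polyVal θ P) /
      algebraMap Qbar[X] (RatFunc Qbar) (polyVal θ Q)) :
    ∃ (n : ℕ) (U : PolyCode) (r : Fin m → NumCode) (G : Fin m → PolyCode),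
      PrimitiveIdentity d (polyVal θ P) (polyVal θ Q) n (polyVal θ U) (fun i => numVal θ (r i)) ∧
        ∀ i, polyVal θ (G i) = rootCofactor d i := by
  let v : NumCode → ℚ⟮θ⟯ := fun c => ⟨numVal θ c, numVal_mem θ c⟩
  let φ : ℚ⟮θ⟯ →+* Qbar := algebraMap ℚ⟮θ⟯ Qbar
  have hv : ∀ x, ∃ c, v c = x := fun x => by
    obtain ⟨c, hc⟩ := exists_numVal_eq x.2
    exact ⟨c, Subtype.ext hc⟩
  have hφv : ∀ c, φ (v c) = numVal θ c := fun c => rfl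
  have hmap : ∀ l : PolyCode, (listVal v l).map φ = polyVal θ l := fun l => by
    rw [listVal_map]
    rfl
  have hlift : ∀ p : ℚ⟮θ⟯[X], ∃ l : PolyCode, listVal v l = p := fun p =>
    exists_listVal_eq fun i => hv _
  have hdφ : (fun i => φ (v (dc i))) = d := funext fun i => (hφv _).trans (hd i)
  have hinj : Function.Injective fun i => v (dc i) := by
    intro i j hij
    apply d.injective
    rw [← hd, ← hd, ← hφv, ← hφv]
    exact congrArg φ hij
  obtain ⟨n, hn⟩ := dvd_mul_rootPoly_pow hf hQ hPQ
  rw [← hmap, ← hmap, ← hdφ, ← map_rootPoly, ← Polynomial.map_pow, ← Polynomial.map_mul,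
    Polynomial.map_dvd_map'] at hn
  obtain ⟨S, hS⟩ := hn
  obtain ⟨U, r, hU⟩ := exists_hermite_reduction hinj n S
  obtain ⟨Uc, rfl⟩ := hlift U
  choose rc hrc using fun i => hv (r i)
  choose Gc hGc using fun i => hlift (rootCofactor (fun i => v (dc i)) i)
  refine ⟨n, Uc, rc, Gc, ?_, fun i => ?_⟩
  · have hK : PrimitiveIdentity (fun i => v (dc i)) (listVal v P) (listVal v Q) n (listVal v Uc)
        r := by
      rw [PrimitiveIdentity, hS, hU]
    have := hK.map φ
    rw [hmap, hmap, hmap, hdφ] at this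
    simpa only [← hrc, hφv] using this
  · rw [← hmap, hGc, map_rootCofactor, hdφ]

/-! ### Integration along segments -/

variable {m n : ℕ}

/-- If the quotient were -t with t ≥ 0, then d = (t z + w) / (1 + t) would be a point of the
segment. -/
theorem div_mem_slitPlane {d z w : ℂ} (h : d ∉ segment ℝ z w) :
    (w - d) / (z - d) ∈ Complex.slitPlane := by
  by_contra hcon
  have hz : z - d ≠ 0 := fun h0 => h (sub_eq_zero.1 h0 ▸ left_mem_segment ℝ z w)
  rw [Complex.mem_slitPlane_iff, not_or, not_lt, not_ne_iff] at hcon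
  set t : ℝ := -((w - d) / (z - d)).re with ht
  have ht0 : 0 ≤ t := by linarith [hcon.1]
  have hρ : (w - d) / (z - d) = ((-t : ℝ) : ℂ) := by
    apply Complex.ext
    · simp [ht]
    · simpa using hcon.2
  rw [div_eq_iff hz] at hρ
  have h1 : (1 + t : ℝ) ≠ 0 := by positivity
  have h1' : (1 + t : ℂ) ≠ 0 := by exact_mod_cast h1
  refine h ⟨t / (1 + t), 1 / (1 + t), by positivity, by positivity, by field_simp; ring, ?_⟩
  rw [Complex.real_smul, Complex.real_smul]
  push_cast at hρ ⊢
  field_simp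
  linear_combination hρ

/-- The value at `z` of `U / T ^ n`, where `T` is the product of the `X - d i`. -/
def primVal (d : Fin m ↪ Qbar) (U : Qbar[X]) (k : ℕ) (z : ℂ) : ℂ :=
  U.eval₂ (algebraMap Qbar ℂ) z / (rootPoly d).eval₂ (algebraMap Qbar ℂ) z ^ k

theorem hasDerivAt_eval₂ (p : Qbar[X]) (z : ℂ) :
    HasDerivAt (fun w => p.eval₂ (algebraMap Qbar ℂ) w)
      ((Polynomial.derivative p).eval₂ (algebraMap Qbar ℂ) z) z := by
  have h := (p.map (algebraMap Qbar ℂ)).hasDerivAt z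
  simpa [Polynomial.derivative_map, Polynomial.eval_map] using h

theorem rootPoly_eval₂_ne_zero {d : Fin m ↪ Qbar} {z : ℂ} (hz : z ∈ puncturedLine d) :
    (rootPoly d).eval₂ (algebraMap Qbar ℂ) z ≠ 0 :=
  eval₂_rootPoly_ne_zero _ fun i h => hz ⟨i, h⟩

theorem hasDerivAt_primVal {d : Fin m ↪ Qbar} (U : Qbar[X]) (k : ℕ) {z : ℂ}
    (hz : z ∈ puncturedLine d) : HasDerivAt (primVal d U k)
      (((Polynomial.derivative U).eval₂ (algebraMap Qbar ℂ) z *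
        (rootPoly d).eval₂ (algebraMap Qbar ℂ) z - k * (U.eval₂ (algebraMap Qbar ℂ) z *
        (Polynomial.derivative (rootPoly d)).eval₂ (algebraMap Qbar ℂ) z)) /
        (rootPoly d).eval₂ (algebraMap Qbar ℂ) z ^ (k + 1)) z := by
  have hT := rootPoly_eval₂_ne_zero hz
  have h := (hasDerivAt_eval₂ U z).div ((hasDerivAt_eval₂ (rootPoly d) z).pow k)
    (pow_ne_zero k hT)
  refine HasDerivAt.congr_deriv h ?_
  cases k with
  | zero => simp; field_simp
  | succ k =>
    simp only [Nat.add_sub_cancel, Pi.pow_apply]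
    field_simp
    ring

/-- The function U / T^k + ∑ r_i Log ((a - d_i) / (z - d_i)) of `a` is a primitive along the whole
segment: dividing by z - d_i keeps the arguments of Log off the cut and makes the logarithms vanish
at the start. -/
theorem segmentIntegral_eq {d : Fin m ↪ Qbar} {f : RatFunc Qbar} (hf : f ∈ regularFunctions d)
    {P Q : Qbar[X]} (hQ : Q ≠ 0)
    (hPQ : f = algebraMap Qbar[X] (RatFunc Qbar) P / algebraMap Qbar[X] (RatFunc Qbar) Q)
    {k : ℕ} {U : Qbar[X]} {r : Fin m → Qbar} (h : PrimitiveIdentity d P Q k U r) {z w : ℂ}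
    (hs : segment ℝ z w ⊆ puncturedLine d) :
    segmentIntegral f (z, w) = primVal d U k w - primVal d U k z +
      ∑ i, (r i : ℂ) * Complex.log ((w - d i) / (z - d i)) := by
  set N := Polynomial.derivative U * rootPoly d -
    k * (U * Polynomial.derivative (rootPoly d)) +
    rootPoly d ^ k * ∑ i, Polynomial.C (r i) * rootCofactor d i with hN
  have hfN : f = algebraMap Qbar[X] (RatFunc Qbar) N /
      algebraMap Qbar[X] (RatFunc Qbar) (rootPoly d ^ (k + 1)) := by
    have hQ' : algebraMap Qbar[X] (RatFunc Qbar) Q ≠ 0 := by simpa using hQ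
    have hT' : algebraMap Qbar[X] (RatFunc Qbar) (rootPoly d ^ (k + 1)) ≠ 0 := by
      simpa using rootPoly_ne_zero (d : Fin m → Qbar)
    rw [hPQ, div_eq_div_iff hQ' hT', ← map_mul, ← map_mul, h, mul_comm]
  have hz : ∀ i, z - d i ≠ 0 := fun i h0 =>
    hs (left_mem_segment ℝ z w) ⟨i, (sub_eq_zero.1 h0).symm⟩
  have key := segmentIntegral_eq_sub hf (convex_segment z w) hs
    (g := fun a => primVal d U k a + ∑ i, (r i : ℂ) * Complex.log ((a - d i) / (z - d i)))
    (s := (z, w)) ?_ (left_mem_segment ℝ z w) (right_mem_segment ℝ z w)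
  · rw [key]
    simp only [div_self (hz _), Complex.log_one, mul_zero, Finset.sum_const_zero]
    ring
  · intro a ha
    have hT := rootPoly_eval₂_ne_zero (hs ha)
    have hda : ∀ i, a - d i ≠ 0 := fun i h0 => hs ha ⟨i, (sub_eq_zero.1 h0).symm⟩
    have hlog : ∀ i, HasDerivAt (fun a => (r i : ℂ) * Complex.log ((a - d i) / (z - d i)))
        ((r i : ℂ) * (a - d i)⁻¹) a := by
      intro i
      have hslit : (a - d i) / (z - d i) ∈ Complex.slitPlane := by
        refine div_mem_slitPlane fun hd => hs ?_ ⟨i, rfl⟩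
        exact (convex_segment z w).segment_subset (left_mem_segment ℝ z w) ha hd
      have h1 : HasDerivAt (fun a : ℂ => (a - d i) / (z - d i)) (1 / (z - d i)) a :=
        ((hasDerivAt_id a).sub_const _).div_const _
      refine ((h1.clog hslit).const_mul _).congr_deriv ?_
      have := hz i
      have := hda i
      field_simp
    have hsum := (hasDerivAt_primVal U k (hs ha)).add
      (HasDerivAt.fun_sum (u := Finset.univ) fun i _ => hlog i)
    refine (hsum.congr_deriv ?_).hasDerivWithinAt
    have hcof : ∀ i, (rootCofactor d i).eval₂ (algebraMap Qbar ℂ) a =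
        (rootPoly d).eval₂ (algebraMap Qbar ℂ) a * (a - d i)⁻¹ := by
      intro i
      rw [← rootCofactor_mul d i, Polynomial.eval₂_mul, Polynomial.eval₂_sub, Polynomial.eval₂_X,
        Polynomial.eval₂_C, mul_assoc]
      change _ = _ * ((a - d i) * (a - d i)⁻¹)
      rw [mul_inv_cancel₀ (hda i), mul_one]
    rw [eval_of_div hfN (by rw [Polynomial.eval₂_pow]; exact pow_ne_zero _ hT), hN]
    simp only [Polynomial.eval₂_add, Polynomial.eval₂_sub, Polynomial.eval₂_mul,
      Polynomial.eval₂_pow, Polynomial.eval₂_finsetSum, Polynomial.eval₂_C, hcof,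
      Polynomial.eval₂_natCast]
    rw [add_div]
    congr 1
    rw [Finset.mul_sum, Finset.sum_div]
    refine Finset.sum_congr rfl fun i _ => ?_
    have := hda i
    change (r i : ℂ) * _ = _ * ((r i : ℂ) * _) / _
    field_simp
    ring

/-! ### Chains given by lists of segments -/

/-- The chain with a given code. -/
def chainVal (θ : Qbar) (c : ChainCode) : SegmentChain :=
  (c.map fun s => Finsupp.single ((numVal θ s.2.1 : ℂ), (numVal θ s.2.2 : ℂ)) s.1).sum

theorem map_chainVal {M : Type*} [AddCommGroup M] (φ : SegmentChain →ₗ[ℤ] M) (θ : Qbar)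
    (c : ChainCode) : φ (chainVal θ c) = (c.map fun s =>
      s.1 • φ (Finsupp.single ((numVal θ s.2.1 : ℂ), (numVal θ s.2.2 : ℂ)) 1)).sum := by
  rw [chainVal, map_list_sum, List.map_map]
  congr 2
  funext s
  rw [Function.comp_apply, ← map_smul, Finsupp.smul_single_one]

theorem chainIntegral_chainVal (f : RatFunc Qbar) (θ : Qbar) (c : ChainCode) :
    chainIntegral f (chainVal θ c) = (c.map fun s =>
      (s.1 : ℂ) * segmentIntegral f ((numVal θ s.2.1 : ℂ), (numVal θ s.2.2 : ℂ))).sum := by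
  rw [map_chainVal]
  simp [chainIntegral]

/-- The coefficient of the point `e` in the boundary of a chain. -/
def bdCoeff (θ : Qbar) (c : ChainCode) (e : NumCode) : ℤ :=
  (c.map fun s => s.1 * ((if numVal θ s.2.2 = numVal θ e then 1 else 0) -
    (if numVal θ s.2.1 = numVal θ e then 1 else 0))).sum

theorem boundary_chainVal (θ : Qbar) (c : ChainCode) (e : NumCode) :
    boundary (chainVal θ c) (numVal θ e : ℂ) = bdCoeff θ c e := by
  have h := map_chainVal ((Finsupp.lapply (numVal θ e : ℂ)).comp boundary) θ c
  rw [LinearMap.comp_apply, Finsupp.lapply_apply] at h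
  rw [h, bdCoeff]
  congr 2
  funext s
  rw [LinearMap.comp_apply, Finsupp.lapply_apply, boundary, LinearMap.sub_apply,
    Finsupp.lmapDomain_apply, Finsupp.lmapDomain_apply, Finsupp.mapDomain_single,
    Finsupp.mapDomain_single, Finsupp.sub_apply, Finsupp.single_apply, Finsupp.single_apply,
    smul_eq_mul]
  simp only [Subtype.ext_iff]

theorem linearCombination_boundary (g : ℂ → ℂ) (θ : Qbar) (c : ChainCode) :
    Finsupp.linearCombination ℤ g (boundary (chainVal θ c)) = (c.map fun s =>
      (s.1 : ℂ) * (g (numVal θ s.2.2) - g (numVal θ s.2.1))).sum := by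
  have h := map_chainVal ((Finsupp.linearCombination ℤ g).comp boundary) θ c
  rw [LinearMap.comp_apply] at h
  rw [h]
  congr 2
  funext s
  simp [boundary]

theorem linearCombination_eq_sum {e : Fin n ↪ Qbar} (g : ℂ → ℂ) {b : ℂ →₀ ℤ}
    (hb : b ∈ Finsupp.supported ℤ ℤ (Set.range fun j => (e j : ℂ))) :
    Finsupp.linearCombination ℤ g b = ∑ j, (b (e j : ℂ) : ℂ) * g (e j) := by
  have hinj : Function.Injective fun j => (e j : ℂ) := fun i j h => e.injective (Subtype.ext h)
  have hsupp : b.support ⊆ Finset.univ.map ⟨fun j => (e j : ℂ), hinj⟩ := by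
    intro z hz
    obtain ⟨j, hj⟩ := hb hz
    simpa using ⟨j, hj⟩
  rw [Finsupp.linearCombination_apply, Finsupp.sum_of_support_subset _ hsupp _ (by simp),
    Finset.sum_map]
  simp

/-- For integral multiplicities, exp (k x) depends only on exp x, whatever the branch. -/
theorem exp_list_sum_congr {ι : Type*} (l : List ι) (k : ι → ℤ) {x y : ι → ℂ}
    (h : ∀ s ∈ l, Complex.exp (x s) = Complex.exp (y s)) :
    Complex.exp (l.map fun s => (k s : ℂ) * x s).sum =
      Complex.exp (l.map fun s => (k s : ℂ) * y s).sum := by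
  induction l with
  | nil => rfl
  | cons s l ih =>
    rw [List.map_cons, List.sum_cons, Complex.exp_add, Complex.exp_int_mul,
      h s List.mem_cons_self, ih fun t ht => h t (List.mem_cons_of_mem _ ht), ← Complex.exp_int_mul,
      ← Complex.exp_add, List.map_cons, List.sum_cons]

/-- The sum of the principal logarithms along a relative cycle is determined modulo `2πi` by its
boundary. -/
theorem exp_sum_log {d : Fin m ↪ Qbar} {e : Fin n ↪ Qbar} {θ : Qbar} {c : ChainCode}
    (hc : ∀ s ∈ c, segment ℝ (numVal θ s.2.1 : ℂ) (numVal θ s.2.2 : ℂ) ⊆ puncturedLine d)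
    (hb : boundary (chainVal θ c) ∈ Finsupp.supported ℤ ℤ (Set.range fun j => (e j : ℂ)))
    (i : Fin m) {l : Fin n → ℂ} (hl : ∀ j, Complex.exp (l j) = (e j : ℂ) - d i) :
    Complex.exp ((c.map fun s => (s.1 : ℂ) *
      Complex.log (((numVal θ s.2.2 : ℂ) - d i) / ((numVal θ s.2.1 : ℂ) - d i))).sum -
      ∑ j, (boundary (chainVal θ c) (e j : ℂ) : ℂ) * l j) = 1 := by
  have hne : ∀ z ∈ puncturedLine d, z - (d i : ℂ) ≠ 0 := fun z hz h0 =>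
    hz ⟨i, (sub_eq_zero.1 h0).symm⟩
  -- Log of a ratio and the difference of the logarithms have the same exponential; the differences
  -- sum to the value of z ↦ Log (z - d_i) on the boundary, which is supported on E.
  rw [Complex.exp_sub, div_eq_one_iff_eq (Complex.exp_ne_zero _),
    exp_list_sum_congr c (fun s => s.1) (y := fun s =>
      Complex.log ((numVal θ s.2.2 : ℂ) - d i) - Complex.log ((numVal θ s.2.1 : ℂ) - d i)),
    ← linearCombination_boundary (fun z => Complex.log (z - d i)), linearCombination_eq_sum _ hb,
    Complex.exp_sum, Complex.exp_sum]
  · refine Finset.prod_congr rfl fun j _ => ?_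
    rw [Complex.exp_int_mul, Complex.exp_int_mul, hl,
      Complex.exp_log (by rw [← hl]; exact Complex.exp_ne_zero _)]
  · intro s hs
    have h1 := hne _ (hc s hs (left_mem_segment ℝ _ _))
    have h2 := hne _ (hc s hs (right_mem_segment ℝ _ _))
    rw [Complex.exp_log (div_ne_zero h2 h1), Complex.exp_sub, Complex.exp_log h1,
      Complex.exp_log h2]

/-! ### Families given by lists of codes -/

section Lists

theorem exists_ofFn_of_map_eq {α β : Type*} {n : ℕ} {f : α → β} {l : List α} {v : Fin n → β}
    (h : l.map f = List.ofFn v) : ∃ w : Fin n → α, l = List.ofFn w ∧ ∀ i, f (w i) = v i := by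
  have hlen : l.length = n := by simpa using congrArg List.length h
  subst hlen
  refine ⟨l.get, (List.ofFn_get l).symm, fun i => ?_⟩
  have := congrArg (fun L => L[(i : ℕ)]?) h
  simpa using this

theorem listRepresents_ofFn {α β : Type} {R : α → β → Prop} {n : ℕ} {c : Fin n → α}
    {v : Fin n → β} : ListRepresents R (List.ofFn c) v ↔ ∀ i, R (c i) (v i) := by
  rw [ListRepresents, List.forall₂_iff_get]
  simp only [List.length_ofFn, List.get_ofFn, true_and]
  exact ⟨fun h i => h i i.2 i.2, fun h i h1 h2 => h ⟨i, h1⟩⟩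

theorem listRepresents_iff {α β : Type} {R : α → β → Prop} {n : ℕ} {l : List α} {v : Fin n → β} :
    ListRepresents R l v ↔ ∃ c : Fin n → α, l = List.ofFn c ∧ ∀ i, R (c i) (v i) := by
  constructor
  · intro h
    have hlen : l.length = n := by simpa using List.Forall₂.length_eq h
    subst hlen
    refine ⟨l.get, (List.ofFn_get l).symm, ?_⟩
    rw [← listRepresents_ofFn, List.ofFn_get]
    exact h
  · rintro ⟨c, rfl, hc⟩
    exact listRepresents_ofFn.2 hc

end Lists

/-! ### Functions with a semidecidable graph. -/

@[fun_prop]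
theorem primrec_intSum {α : Type*} [Primcodable α] {f : α → List ℤ} (hf : Primrec f) :
    Primrec fun a => (f a).sum := by
  unfold List.sum; fun_prop

/-- The function `F` has a semidecidable graph. -/
def SDFun {β δ : Type} [Primcodable β] [Primcodable δ] (F : Qbar → β → δ) : Prop :=
  SD fun θ (p : β × δ) => p.2 = F θ p.1

namespace SDFun

variable {β γ δ : Type} [Primcodable β] [Primcodable γ] [Primcodable δ]

/-- The value of `F` is guessed, checked against the graph and then used. -/
theorem subst {F : Qbar → β → δ} (hF : SDFun F) {Φ : Qbar → β × δ → Prop} (hΦ : SD Φ) :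
    SD fun θ b => Φ θ (b, F θ b) :=
  (SD.ex (Φ := fun θ (p : β × δ) => p.2 = F θ p.1 ∧ Φ θ p) (SD.and hF hΦ)).of_eq
    fun F θ _ b => by simp

theorem map {F : Qbar → β × γ → δ} (hF : SDFun F) {l : β → List γ} (hl : Primrec l) :
    SDFun fun θ b => (l b).map fun c => F θ (b, c) := by
  refine (SD.forall₂ (Φ := fun θ (p : (β × List δ) × γ × δ) => p.2.2 = F θ (p.1.1, p.2.1))
    (SD.comp hF (g := fun p : (β × List δ) × γ × δ => ((p.1.1, p.2.1), p.2.2)) (by fun_prop))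
    (l := fun p => l p.1) (m := fun p => p.2) (by fun_prop) (by fun_prop)).of_eq
    fun _ θ _ p => ?_
  obtain ⟨b, m⟩ := p
  simp only
  generalize l b = L
  induction L generalizing m with
  | nil => simp
  | cons c L ih =>
    cases m with
    | nil => simp
    | cons y m => simp [ih]

theorem comp_primrec {F : Qbar → β → δ} (hF : SDFun F) {g : β × δ → γ} (hg : Primrec g) :
    SDFun fun θ b => g (b, F θ b) := by
  refine (SD.ex (Φ := fun θ (p : (β × γ) × δ) => p.2 = F θ p.1.1 ∧ p.1.2 = g (p.1.1, p.2)) ?_).of_eq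
    fun _ θ _ p => by simp
  exact (SD.comp hF (g := fun p : (β × γ) × δ => (p.1.1, p.2)) (by fun_prop)).and
    (SD.decide_eq (by fun_prop) (by fun_prop))

theorem prod {F : Qbar → β → δ} {G : Qbar → β → γ} (hF : SDFun F) (hG : SDFun G) :
    SDFun fun θ b => (F θ b, G θ b) := by
  refine (SD.and (SD.comp hF (g := fun p : β × δ × γ => (p.1, p.2.1)) (by fun_prop))
    (SD.comp hG (g := fun p : β × δ × γ => (p.1, p.2.2)) (by fun_prop))).of_eq
    fun _ θ _ p => by simp [Prod.ext_iff]

/-- Both the equality and its negation are semidecidable, so the right value can be certified in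
either case. -/
theorem ite_numVal_eq {c e : β → NumCode} (hc : Primrec c) (he : Primrec e) :
    SDFun fun θ b => (if numVal θ (c b) = numVal θ (e b) then 1 else 0 : ℤ) := by
  refine (SD.or (SD.and (SD.numVal_eq (β := β × ℤ) (c := fun p => c p.1) (d := fun p => e p.1)
    (by fun_prop) (by fun_prop)) (SD.decide_eq (f := fun p : β × ℤ => p.2) (g := fun _ => 1)
    (by fun_prop) (by fun_prop))) (SD.and (SD.numVal_ne (c := fun p => c p.1) (d := fun p => e p.1)
    (by fun_prop) (by fun_prop)) (SD.decide_eq (f := fun p : β × ℤ => p.2) (g := fun _ => 0)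
    (by fun_prop) (by fun_prop)))).of_eq fun _ θ _ p => ?_
  by_cases h : numVal θ (c p.1) = numVal θ (e p.1) <;> simp [h]

theorem bdCoeff {c : β → ChainCode} {e : β → NumCode} (hc : Primrec c) (he : Primrec e) :
    SDFun fun θ b => bdCoeff θ (c b) (e b) := by
  have h1 : SDFun fun θ (p : β × ℤ × NumCode × NumCode) =>
      p.2.1 * ((if numVal θ p.2.2.2 = numVal θ (e p.1) then 1 else 0 : ℤ) -
        (if numVal θ p.2.2.1 = numVal θ (e p.1) then 1 else 0)) :=
    comp_primrec (prod (ite_numVal_eq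
      (c := fun p : β × ℤ × NumCode × NumCode => p.2.2.2) (e := fun p => e p.1) (by fun_prop)
      (by fun_prop)) (ite_numVal_eq (c := fun p : β × ℤ × NumCode × NumCode => p.2.2.1)
      (e := fun p => e p.1) (by fun_prop) (by fun_prop)))
      (g := fun q : (β × ℤ × NumCode × NumCode) × ℤ × ℤ => q.1.2.1 * (q.2.1 - q.2.2)) (by fun_prop)
  exact comp_primrec (map h1 hc) (g := fun q : β × List ℤ => q.2.sum) (by fun_prop)

end SDFun

/-! ### Logarithms along a chain -/

/-- The linear factor `X - d`. -/
def linearCode (d : NumCode) : PolyCode := [neg d, one]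

theorem polyVal_linearCode (θ : Qbar) (d : NumCode) :
    polyVal θ (linearCode d) = Polynomial.X - Polynomial.C (numVal θ d) := by
  have h1 := (isVal_numVal θ).one
  have h2 := (isVal_numVal θ).neg d
  simp only [polyVal, linearCode, List.foldr_cons, List.foldr_nil, h1, h2]
  simp
  ring

/-- The term `t` stands for `n` times the principal logarithm of `(w - d) / (z - d)`, where `s` is
`n` times the segment from `z` to `w`. -/
def SegmentTerm (θ : Qbar) (d : NumCode) (s : ℤ × NumCode × NumCode) (t : LogTerm) : Prop :=
  t.1 = s.1 ∧ numVal θ (mul t.2.1 (CodeRing.sub s.2.1 d)) = numVal θ (CodeRing.sub s.2.2 d) ∧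
    PrincipalNear (numVal θ t.2.1) t.2.2

/-- The term of the logarithm of `e - d`. -/
def pointTerm (d : NumCode) (t : LogTerm) : LogTerm := (-t.1, CodeRing.sub t.2.1 d, t.2.2)

/-- The term of `-k * 2πi`, with `πi` as the logarithm of `-1` near `3i`. -/
def piTerm (k : ℤ) : LogTerm := (-(2 * k), neg one, (zero, intCode 3))

/-- The sum of the logarithms of the `(w - d) / (z - d)` over the segments of the chain `c` exceeds
the sum of the `b log (e - d)` by `k * 2πi`; here `b` ranges over the coefficients of the boundary
of `c` and `e` over the points in its support. -/
def LogRelation (θ : Qbar) (c : ChainCode) (d : NumCode) (b : List ℤ) (e : List NumCode)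
    (q : List GaussCode) (k : ℤ) : Prop :=
  ∃ (Y X : List LogTerm), (Y.map (fun t => t.1) = b ∧ Y.map (fun t => t.2.1) = e ∧
    Y.map (fun t => t.2.2) = q) ∧ List.Forall₂ (SegmentTerm θ d) c X ∧
    LogSumSmall θ (X ++ (Y.map (pointTerm d) ++ [piTerm k]))

section SD

variable {β : Type} [Primcodable β]

@[fun_prop]
theorem primrec_linearCode {α : Type*} [Primcodable α] {d : α → NumCode} (hd : Primrec d) :
    Primrec fun a => linearCode (d a) := by
  unfold linearCode; fun_prop

@[fun_prop]
theorem primrec_pointTerm {α : Type*} [Primcodable α] {d : α → NumCode} {t : α → LogTerm}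
    (hd : Primrec d) (ht : Primrec t) : Primrec fun a => pointTerm (d a) (t a) := by
  unfold pointTerm; fun_prop

@[fun_prop]
theorem primrec_piTerm {α : Type*} [Primcodable α] {k : α → ℤ} (hk : Primrec k) :
    Primrec fun a => piTerm (k a) := by
  unfold piTerm; fun_prop

theorem SD.segmentTerm {d : β → NumCode} {s : β → ℤ × NumCode × NumCode} {t : β → LogTerm}
    (hd : Primrec d) (hs : Primrec s) (ht : Primrec t) :
    SD fun θ b => SegmentTerm θ (d b) (s b) (t b) :=
  (decide_eq (by fun_prop) (by fun_prop)).and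
    ((numVal_eq (by fun_prop) (by fun_prop)).and (principalNear (by fun_prop) (by fun_prop)))

theorem SD.logRelation {c : β → ChainCode} {d : β → NumCode} {b : β → List ℤ}
    {e : β → List NumCode} {q : β → List GaussCode} {k : β → ℤ} (hc : Primrec c) (hd : Primrec d)
    (hb : Primrec b) (he : Primrec e) (hq : Primrec q) (hk : Primrec k) :
    SD fun θ x => LogRelation θ (c x) (d x) (b x) (e x) (q x) (k x) := by
  refine ex (Φ := fun θ (p : β × List LogTerm) => ∃ X : List LogTerm,
    (p.2.map (fun t => t.1) = b p.1 ∧ p.2.map (fun t => t.2.1) = e p.1 ∧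
    p.2.map (fun t => t.2.2) = q p.1) ∧ List.Forall₂ (SegmentTerm θ (d p.1)) (c p.1) X ∧
    LogSumSmall θ (X ++ (p.2.map (pointTerm (d p.1)) ++ [piTerm (k p.1)]))) ?_
  refine ex (Φ := fun θ (p : (β × List LogTerm) × List LogTerm) =>
    (p.1.2.map (fun t => t.1) = b p.1.1 ∧ p.1.2.map (fun t => t.2.1) = e p.1.1 ∧
    p.1.2.map (fun t => t.2.2) = q p.1.1) ∧
    List.Forall₂ (SegmentTerm θ (d p.1.1)) (c p.1.1) p.2 ∧
    LogSumSmall θ (p.2 ++ (p.1.2.map (pointTerm (d p.1.1)) ++ [piTerm (k p.1.1)]))) ?_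
  refine ((decide_eq (by fun_prop) (by fun_prop)).and ((decide_eq (by fun_prop) (by fun_prop)).and
    (decide_eq (by fun_prop) (by fun_prop)))).and (.and ?_ (logSumSmall (by fun_prop)))
  exact forall₂ (Φ := fun θ (p : ((β × List LogTerm) × List LogTerm) ×
    (ℤ × NumCode × NumCode) × LogTerm) => SegmentTerm θ (d p.1.1.1) p.2.1 p.2.2)
    (segmentTerm (by fun_prop) (by fun_prop) (by fun_prop)) (by fun_prop) (by fun_prop)

end SD

theorem LogSumSmall.exists_log {θ : Qbar} {l : List LogTerm} (h : LogSumSmall θ l) {t : LogTerm}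
    (ht : t ∈ l) : ∃ z, Complex.exp z = numVal θ t.2.1 ∧ ‖z - gaussVal t.2.2‖ < 1 := by
  obtain ⟨T, ε, rfl, -, hT⟩ := h
  obtain ⟨s, hs, rfl⟩ := List.mem_map.1 ht
  obtain ⟨z, h1, h2, _⟩ := hT s hs
  exact ⟨z, h1, h2⟩

/-- The logarithm of the value of a term near the given Gaussian rational, if there is one. -/
def termLog (θ : Qbar) (t : LogTerm) : ℂ :=
  open Classical in
  if h : ∃ z, Complex.exp z = numVal θ t.2.1 ∧ ‖z - gaussVal t.2.2‖ < 1 then h.choose else 0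

theorem termLog_spec {θ : Qbar} {t : LogTerm}
    (h : ∃ z, Complex.exp z = numVal θ t.2.1 ∧ ‖z - gaussVal t.2.2‖ < 1) :
    Complex.exp (termLog θ t) = numVal θ t.2.1 ∧ ‖termLog θ t - gaussVal t.2.2‖ < 1 := by
  rw [termLog, dif_pos h]
  exact h.choose_spec

theorem termLog_eq {θ : Qbar} {t : LogTerm} {z : ℂ} (h1 : Complex.exp z = numVal θ t.2.1)
    (h2 : ‖z - gaussVal t.2.2‖ < 1) : termLog θ t = z := by
  have h := termLog_spec (θ := θ) (t := t) ⟨z, h1, h2⟩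
  exact eq_of_exp_eq_of_near (h.1.trans h1.symm) h.2 h2

theorem exp_pi_near (θ : Qbar) (k : ℤ) :
    Complex.exp (Real.pi * Complex.I) = numVal θ (piTerm k).2.1 ∧
      ‖(Real.pi * Complex.I : ℂ) - gaussVal (piTerm k).2.2‖ < 1 := by
  constructor
  · rw [Complex.exp_pi_mul_I]
    have h1 := (isVal_numVal θ).one
    have h2 := (isVal_numVal θ).neg (one : NumCode)
    simp only [piTerm, h2, h1]
    simp
  · have : (Real.pi * Complex.I : ℂ) - gaussVal (piTerm k).2.2 =
        ((Real.pi - 3 : ℝ) : ℂ) * Complex.I := by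
      simp only [piTerm, gaussVal, isVal_ratVal.zero, ratVal_intCode]
      push_cast
      ring
    rw [this, norm_mul, Complex.norm_real, Complex.norm_I, mul_one, Real.norm_eq_abs,
      abs_of_pos (by linarith [Real.pi_gt_three])]
    linarith [Real.pi_lt_four]

/-- The ratio `(w - d) / (z - d)` for a segment from `z` to `w`. -/
def segRatio (θ : Qbar) (d : ℂ) (s : ℤ × NumCode × NumCode) : ℂ :=
  ((numVal θ s.2.2 : ℂ) - d) / ((numVal θ s.2.1 : ℂ) - d)

theorem SegmentTerm.val_eq {θ : Qbar} {d : NumCode} {s : ℤ × NumCode × NumCode} {t : LogTerm}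
    (h : SegmentTerm θ d s t) (hz : numVal θ s.2.1 ≠ numVal θ d) :
    (numVal θ t.2.1 : ℂ) = segRatio θ (numVal θ d) s := by
  have h2 := h.2.1
  rw [(isVal_numVal θ).mul, (isVal_numVal θ).sub, (isVal_numVal θ).sub] at h2
  have hz' : (numVal θ s.2.1 : ℂ) - numVal θ d ≠ 0 := by
    rw [sub_ne_zero]
    exact fun h => hz (Subtype.ext h)
  rw [segRatio, eq_div_iff hz']
  exact_mod_cast congrArg (fun x : Qbar => (x : ℂ)) h2

/-- `PrincipalNear` forces the logarithm selected by each term to be the principal one. -/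
theorem sum_log_terms {θ : Qbar} {c : ChainCode} {d : NumCode}
    (hc : ∀ s ∈ c, numVal θ s.2.1 ≠ numVal θ d) {X : List LogTerm}
    (hX : List.Forall₂ (SegmentTerm θ d) c X)
    (hlog : ∀ t ∈ X, ∃ z, Complex.exp z = numVal θ t.2.1 ∧ ‖z - gaussVal t.2.2‖ < 1) :
    (X.map fun t => (t.1 : ℂ) * termLog θ t).sum =
      (c.map fun s => (s.1 : ℂ) * Complex.log (segRatio θ (numVal θ d) s)).sum := by
  induction hX with
  | nil => rfl
  | @cons s t c X hst _ ih =>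
    rw [List.map_cons, List.sum_cons, List.map_cons, List.sum_cons,
      ih (fun s hs => hc s (List.mem_cons_of_mem _ hs))
        fun t ht => hlog t (List.mem_cons_of_mem _ ht)]
    have h1 := termLog_spec (hlog t List.mem_cons_self)
    rw [hst.2.2.eq_log h1.1 h1.2, hst.1, hst.val_eq (hc s List.mem_cons_self)]

/-- By `hexp` the two sides differ by a multiple of 2πi, so the numerical test is exact. `hrat`
supplies codes for the ratios when the terms have to be constructed. -/
theorem logRelation_iff {θ : Qbar} {c : ChainCode} {d : NumCode} {b : Fin n → ℤ}
    {e : Fin n → NumCode} {q : Fin n → GaussCode} {l : Fin n → ℂ} (k : ℤ)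
    (hc : ∀ s ∈ c, (numVal θ d : ℂ) ∉ segment ℝ (numVal θ s.2.1 : ℂ) (numVal θ s.2.2 : ℂ))
    (hl : ∀ j, Complex.exp (l j) = (numVal θ (e j) : ℂ) - numVal θ d)
    (hq : ∀ j, BranchRepresents (q j) (l j))
    (hexp : Complex.exp ((c.map fun s => (s.1 : ℂ) *
      Complex.log (segRatio θ (numVal θ d) s)).sum - ∑ j, (b j : ℂ) * l j) = 1)
    (hrat : ∀ s ∈ c, ∃ u, (numVal θ u : ℂ) = segRatio θ (numVal θ d) s) :
    LogRelation θ c d (List.ofFn b) (List.ofFn e) (List.ofFn q) k ↔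
      (c.map fun s => (s.1 : ℂ) * Complex.log (segRatio θ (numVal θ d) s)).sum =
        ∑ j, (b j : ℂ) * l j + k * (2 * Real.pi * Complex.I) := by
  have hz : ∀ s ∈ c, numVal θ s.2.1 ≠ numVal θ d := fun s hs h =>
    hc s hs (h ▸ left_mem_segment ℝ _ _)
  set Y₀ : List LogTerm := List.ofFn fun j => (b j, e j, q j) with hY₀
  have hpt : ∀ j, Complex.exp (l j) = numVal θ (pointTerm d (b j, e j, q j)).2.1 ∧
      ‖l j - gaussVal (pointTerm d (b j, e j, q j)).2.2‖ < 1 := by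
    intro j
    refine ⟨?_, hq j⟩
    rw [hl]
    simp only [pointTerm]
    rw [(isVal_numVal θ).sub]
    rfl
  have hsum : ∀ X : List LogTerm, List.Forall₂ (SegmentTerm θ d) c X →
      (∀ t ∈ X, ∃ z, Complex.exp z = numVal θ t.2.1 ∧ ‖z - gaussVal t.2.2‖ < 1) →
      ((X ++ (Y₀.map (pointTerm d) ++ [piTerm k])).map fun t => (t.1 : ℂ) * termLog θ t).sum =
        (c.map fun s => (s.1 : ℂ) * Complex.log (segRatio θ (numVal θ d) s)).sum -
          ∑ j, (b j : ℂ) * l j - k * (2 * Real.pi * Complex.I) := by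
    intro X hX hlog
    rw [List.map_append, List.sum_append, List.map_append, List.sum_append,
      sum_log_terms hz hX hlog, hY₀, List.map_ofFn, List.map_ofFn, List.sum_ofFn,
      List.map_singleton,
      List.sum_singleton, termLog_eq (exp_pi_near θ k).1 (exp_pi_near θ k).2]
    have : ∀ j, ((fun t : LogTerm => (t.1 : ℂ) * termLog θ t) ∘ (pointTerm d) ∘
        fun j => (b j, e j, q j)) j = -((b j : ℂ) * l j) := by
      intro j
      simp only [Function.comp_apply]
      rw [termLog_eq (hpt j).1 (hpt j).2]
      simp [pointTerm]
    rw [Finset.sum_congr rfl fun j _ => this j, Finset.sum_neg_distrib]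
    simp only [piTerm]
    push_cast
    ring
  have hlogs : ∀ X : List LogTerm,
      (∀ t ∈ X, ∃ z, Complex.exp z = numVal θ t.2.1 ∧ ‖z - gaussVal t.2.2‖ < 1) →
      LogValues θ (X ++ (Y₀.map (pointTerm d) ++ [piTerm k])) (termLog θ) := by
    intro X hX t ht
    apply termLog_spec
    rcases List.mem_append.1 ht with h | h
    · exact hX t h
    rcases List.mem_append.1 h with h | h
    · obtain ⟨s, hs, rfl⟩ := List.mem_map.1 h
      obtain ⟨j, rfl⟩ := (List.mem_ofFn' _ _).1 hs
      exact ⟨l j, hpt j⟩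
    · rw [List.mem_singleton.1 h]
      exact ⟨_, exp_pi_near θ k⟩
  -- For every proposed `k` the defect stays in 2πiℤ, as `logSumSmall_iff` requires.
  have hexp' : Complex.exp ((c.map fun s => (s.1 : ℂ) *
      Complex.log (segRatio θ (numVal θ d) s)).sum - ∑ j, (b j : ℂ) * l j -
        k * (2 * Real.pi * Complex.I)) = 1 := by
    rw [Complex.exp_sub, hexp, Complex.exp_int_mul_two_pi_mul_I, div_one]
  have hiff : ∀ X : List LogTerm, List.Forall₂ (SegmentTerm θ d) c X →
      (∀ t ∈ X, ∃ z, Complex.exp z = numVal θ t.2.1 ∧ ‖z - gaussVal t.2.2‖ < 1) →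
      (LogSumSmall θ (X ++ (Y₀.map (pointTerm d) ++ [piTerm k])) ↔
        (c.map fun s => (s.1 : ℂ) * Complex.log (segRatio θ (numVal θ d) s)).sum =
          ∑ j, (b j : ℂ) * l j + k * (2 * Real.pi * Complex.I)) := by
    intro X hX hlog
    rw [logSumSmall_iff (hlogs X hlog) (by rw [hsum X hX hlog]; exact hexp'), hsum X hX hlog,
      sub_sub, sub_eq_zero]
  constructor
  · rintro ⟨Y, X, ⟨hY1, hY2, hY3⟩, hX, hS⟩
    -- The three projections of `Y` are prescribed, so `Y` has no freedom.
    have hYY : Y = Y₀ := by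
      obtain ⟨y, rfl, hy1⟩ := exists_ofFn_of_map_eq hY1
      rw [List.map_ofFn] at hY2 hY3
      have hy2 := congrFun (List.ofFn_injective hY2)
      have hy3 := congrFun (List.ofFn_injective hY3)
      rw [hY₀]
      congr 1
      funext j
      exact Prod.ext (hy1 j) (Prod.ext (hy2 j) (hy3 j))
    rw [hYY] at hS
    exact (hiff X hX fun t ht => hS.exists_log (List.mem_append_left _ ht)).1 hS
  · intro h
    have hterm : ∀ s ∈ c, ∃ t, SegmentTerm θ d s t ∧
        ∃ z, Complex.exp z = numVal θ t.2.1 ∧ ‖z - gaussVal t.2.2‖ < 1 := by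
      intro s hs
      obtain ⟨u, hu⟩ := hrat s hs
      have hslit : segRatio θ (numVal θ d) s ∈ Complex.slitPlane := div_mem_slitPlane (hc s hs)
      obtain ⟨p, hp1, hp2⟩ := exists_principalNear hslit
      refine ⟨(s.1, u, p), ⟨rfl, ?_, by rw [hu]; exact hp1⟩, _, ?_, hp2⟩
      · have hz' : (numVal θ s.2.1 : ℂ) - numVal θ d ≠ 0 := by
          rw [sub_ne_zero]
          exact fun h => hz s hs (Subtype.ext h)
        apply Subtype.ext
        rw [(isVal_numVal θ).mul, (isVal_numVal θ).sub, (isVal_numVal θ).sub]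
        push_cast
        rw [hu, segRatio, div_mul_cancel₀ _ hz']
      · rw [Complex.exp_log (Complex.slitPlane_ne_zero hslit), hu]
    have : ∃ X : List LogTerm, List.Forall₂ (SegmentTerm θ d) c X ∧
        ∀ t ∈ X, ∃ z, Complex.exp z = numVal θ t.2.1 ∧ ‖z - gaussVal t.2.2‖ < 1 := by
      clear h hiff hexp' hlogs hsum hrat hexp hz hc
      induction c with
      | nil => exact ⟨[], by simp⟩
      | cons s c ih =>
        obtain ⟨X, hX, hX'⟩ := ih fun s hs => hterm s (List.mem_cons_of_mem _ hs)
        obtain ⟨t, ht, ht'⟩ := hterm s List.mem_cons_self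
        exact ⟨t :: X, .cons ht hX, List.forall_mem_cons.2 ⟨ht', hX'⟩⟩
    obtain ⟨X, hX, hX'⟩ := this
    refine ⟨Y₀, X, ⟨?_, ?_, ?_⟩, hX, (hiff X hX hX').2 h⟩ <;>
      rw [hY₀, List.map_ofFn] <;> rfl

/-! ### Certified periods -/

theorem isVal_coe_numVal (θ : Qbar) : IsVal fun c => (numVal θ c : ℂ) :=
  (isVal_numVal θ).map (algebraMap Qbar ℂ)

/-- The code of an integer as an element of a number field. -/
def intNum (a : ℤ) : NumCode := [intCode a]

theorem numVal_intNum (θ : Qbar) (a : ℤ) : numVal θ (intNum a) = a := by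
  simp [numVal, intNum, ratVal_intCode]

/-- The value of a polynomial at a point. -/
def evalCode (U : PolyCode) (z : NumCode) : NumCode := horner (fun a => a) z U

theorem numVal_evalCode (θ : Qbar) (U : PolyCode) (z : NumCode) :
    (numVal θ (evalCode U z) : ℂ) = (polyVal θ U).eval₂ (algebraMap Qbar ℂ) (numVal θ z : ℂ) := by
  have h := (isVal_coe_numVal θ).horner (fun a => a) z U
  exact h.trans (eval₂_listVal (numVal θ) (algebraMap Qbar ℂ) _ U).symm

theorem polyVal_singleton (θ : Qbar) (a : NumCode) : polyVal θ [a] = Polynomial.C (numVal θ a) := by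
  simp [polyVal]

/-- The polynomial with the given simple roots. -/
def rootCode (D : List NumCode) : PolyCode := prod (D.map linearCode)

theorem polyVal_rootCode (θ : Qbar) (d : Fin m → NumCode) :
    polyVal θ (rootCode (List.ofFn d)) = rootPoly fun i => numVal θ (d i) := by
  rw [rootCode, (isVal_polyVal θ).prod, List.map_ofFn, List.map_ofFn, List.prod_ofFn, rootPoly]
  simp [polyVal_linearCode]

/-- Data at a pole of a differential: the pole `d`, the branches of the `log (e - d)`, the product
of the linear factors at the other points of `D`, the residue, and a winding number. -/
abbrev PoleCert := NumCode × List GaussCode × PolyCode × NumCode × ℤ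

/-- Data at a segment: the values of a rational function at its end and at its start. -/
abbrev SegmentCert := (ℤ × NumCode × NumCode) × NumCode × NumCode

/-- The list `Y` pairs the coefficients of the boundary of `c` with the values of a function. -/
def BoundaryCert (θ : Qbar) (E : List NumCode) (a : List NumCode) (c : ChainCode)
    (Y : List (ℤ × NumCode)) : Prop :=
  Y.map (fun y => y.1) = E.map (fun e => bdCoeff θ c e) ∧ Y.map (fun y => y.2) = a

/-- `P / Q = (U / T ^ n)' + ∑ r i / (X - d i)`, where `T` is the product of the `X - d i`. -/
def PrimitiveCert (θ : Qbar) (D : List NumCode) (P Q : PolyCode) (n : ℕ) (U : PolyCode)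
    (W : List PoleCert) : Prop :=
  W.map (fun t => t.1) = D ∧
    (∀ t ∈ W, polyVal θ (mul t.2.2.1 (linearCode t.1)) = polyVal θ (rootCode D)) ∧
    polyVal θ (mul P (pow (rootCode D) (n + 1))) =
      polyVal θ (mul Q (add (CodeRing.sub (mul (derivList U) (rootCode D))
        (mul [intNum n] (mul U (derivList (rootCode D)))))
        (mul (pow (rootCode D) n) (sum (W.map fun t => mul [t.2.2.2.1] t.2.2.1)))))

/-- The winding numbers in `W` describe the logarithms along the chain `c`. -/
def LogCert (θ : Qbar) (E : List NumCode) (Λ : List (List GaussCode)) (c : ChainCode) (b : List ℤ)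
    (W : List PoleCert) : Prop :=
  W.map (fun t => t.2.1) = Λ ∧ ∀ t ∈ W, LogRelation θ c t.1 b E t.2.1 t.2.2.2.2

/-- The list `X` gives the values of `U / T ^ n` at the end points of the segments of `c`. -/
def EndpointCert (θ : Qbar) (D : List NumCode) (c : ChainCode) (n : ℕ) (U : PolyCode)
    (X : List SegmentCert) : Prop :=
  X.map (fun x => x.1) = c ∧ ∀ x ∈ X,
    numVal θ (mul x.2.1 (pow (evalCode (rootCode D) x.1.2.2) n)) = numVal θ (evalCode U x.1.2.2) ∧
    numVal θ (mul x.2.2 (pow (evalCode (rootCode D) x.1.2.1) n)) = numVal θ (evalCode U x.1.2.1)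

/-- The expression in standard form computed from the data of a period. -/
def entryCode (W : List PoleCert) (X : List SegmentCert) (Y : List (ℤ × NumCode)) :
    StandardFormCode :=
  -- The components are c = ∑ b_j a_j + ∑ n_s (increment of U / T^n), c' = ∑ r_i k_i and c_ij = r_i
  -- b_j.
  (add (sum (Y.map fun y => mul (intNum y.1) y.2))
      (sum (X.map fun x => mul (intNum x.1.1) (CodeRing.sub x.2.1 x.2.2))),
    sum (W.map fun t => mul t.2.2.2.1 (intNum t.2.2.2.2)),
    W.map fun t => Y.map fun y => mul t.2.2.2.1 (intNum y.1))

/-- Auxiliary data from which a period can be read off. -/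
abbrev PeriodCert := (ℕ × PolyCode) × List PoleCert × List SegmentCert × List (ℤ × NumCode)

/-- The data `t` certify that `z` is the period of the form `f` along the chain `c`. -/
def Certifies (θ : Qbar) (D E : List NumCode) (Λ : List (List GaussCode)) (f : FormCode)
    (c : ChainCode) (z : StandardFormCode) (t : PeriodCert) : Prop :=
  BoundaryCert θ E f.1 c t.2.2.2 ∧ PrimitiveCert θ D f.2.1 f.2.2 t.1.1 t.1.2 t.2.1 ∧
    LogCert θ E Λ c (t.2.2.2.map fun y => y.1) t.2.1 ∧
    EndpointCert θ D c t.1.1 t.1.2 t.2.2.1 ∧ z = entryCode t.2.1 t.2.2.1 t.2.2.2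

/-! ### Semidecidability of the certificates. -/

section SD

variable {α : Type*} [Primcodable α]

@[fun_prop]
theorem primrec_intNum {f : α → ℤ} (hf : Primrec f) : Primrec fun a => intNum (f a) := by
  unfold intNum; fun_prop

@[fun_prop]
theorem primrec_evalCode {f : α → PolyCode} {g : α → NumCode} (hf : Primrec f) (hg : Primrec g) :
    Primrec fun a => evalCode (f a) (g a) := by
  unfold evalCode; fun_prop

@[fun_prop]
theorem primrec_rootCode {f : α → List NumCode} (hf : Primrec f) :
    Primrec fun a => rootCode (f a) := by
  unfold rootCode; fun_prop

@[fun_prop]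
theorem primrec_entryCode {f : α → List PoleCert} {g : α → List SegmentCert}
    {h : α → List (ℤ × NumCode)} (hf : Primrec f) (hg : Primrec g) (hh : Primrec h) :
    Primrec fun a => entryCode (f a) (g a) (h a) := by
  unfold entryCode; fun_prop

variable {β : Type} [Primcodable β] {D E a : β → List NumCode} {Λ : β → List (List GaussCode)}
  {c : β → ChainCode} {P Q U : β → PolyCode} {n : β → ℕ} {W : β → List PoleCert}
  {X : β → List SegmentCert} {Y : β → List (ℤ × NumCode)} {b : β → List ℤ}

theorem SD.boundaryCert (hE : Primrec E) (ha : Primrec a) (hc : Primrec c) (hY : Primrec Y) :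
    SD fun θ x => BoundaryCert θ (E x) (a x) (c x) (Y x) := by
  have h : SDFun fun θ x => (E x).map fun e => bdCoeff θ (c x) e :=
    SDFun.map (F := fun θ (p : β × NumCode) => bdCoeff θ (c p.1) p.2)
      (SDFun.bdCoeff (by fun_prop) (by fun_prop)) hE
  exact SD.and (h.subst (Φ := fun θ (p : β × List ℤ) => (Y p.1).map (fun y => y.1) = p.2)
    (decide_eq (by fun_prop) (by fun_prop))) (decide_eq (by fun_prop) (by fun_prop))

theorem SD.primitiveCert (hD : Primrec D) (hP : Primrec P) (hQ : Primrec Q) (hn : Primrec n)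
    (hU : Primrec U) (hW : Primrec W) :
    SD fun θ x => PrimitiveCert θ (D x) (P x) (Q x) (n x) (U x) (W x) := by
  refine (decide_eq (by fun_prop) (by fun_prop)).and (.and ?_ (polyVal_eq (by fun_prop)
    (by fun_prop)))
  exact forall_mem (Φ := fun θ (p : β × PoleCert) =>
    polyVal θ (mul p.2.2.2.1 (linearCode p.2.1)) = polyVal θ (rootCode (D p.1)))
    (polyVal_eq (by fun_prop) (by fun_prop)) hW

theorem SD.logCert (hE : Primrec E) (hΛ : Primrec Λ) (hc : Primrec c) (hb : Primrec b)
    (hW : Primrec W) : SD fun θ x => LogCert θ (E x) (Λ x) (c x) (b x) (W x) := by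
  refine (decide_eq (by fun_prop) (by fun_prop)).and ?_
  exact forall_mem (Φ := fun θ (p : β × PoleCert) =>
    LogRelation θ (c p.1) p.2.1 (b p.1) (E p.1) p.2.2.1 p.2.2.2.2.2)
    (logRelation (by fun_prop) (by fun_prop) (by fun_prop) (by fun_prop) (by fun_prop)
      (by fun_prop)) hW

theorem SD.endpointCert (hD : Primrec D) (hc : Primrec c) (hn : Primrec n) (hU : Primrec U)
    (hX : Primrec X) : SD fun θ x => EndpointCert θ (D x) (c x) (n x) (U x) (X x) := by
  refine (decide_eq (by fun_prop) (by fun_prop)).and ?_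
  exact forall_mem (Φ := fun θ (p : β × SegmentCert) =>
    numVal θ (mul p.2.2.1 (pow (evalCode (rootCode (D p.1)) p.2.1.2.2) (n p.1))) =
      numVal θ (evalCode (U p.1) p.2.1.2.2) ∧
    numVal θ (mul p.2.2.2 (pow (evalCode (rootCode (D p.1)) p.2.1.2.1) (n p.1))) =
      numVal θ (evalCode (U p.1) p.2.1.2.1))
    (.and (numVal_eq (by fun_prop) (by fun_prop)) (numVal_eq (by fun_prop) (by fun_prop))) hX

theorem SD.exists_certifies {f : β → FormCode} {z : β → StandardFormCode} (hD : Primrec D)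
    (hE : Primrec E) (hΛ : Primrec Λ) (hf : Primrec f) (hc : Primrec c) (hz : Primrec z) :
    SD fun θ x => ∃ t, Certifies θ (D x) (E x) (Λ x) (f x) (c x) (z x) t :=
  ex (Φ := fun θ (p : β × PeriodCert) => Certifies θ (D p.1) (E p.1) (Λ p.1) (f p.1) (c p.1)
    (z p.1) p.2) <| (boundaryCert (by fun_prop) (by fun_prop) (by fun_prop) (by fun_prop)).and <|
      (primitiveCert (by fun_prop) (by fun_prop) (by fun_prop) (by fun_prop) (by fun_prop)
        (by fun_prop)).and <|
      (logCert (by fun_prop) (by fun_prop) (by fun_prop) (by fun_prop) (by fun_prop)).and <|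
      (endpointCert (by fun_prop) (by fun_prop) (by fun_prop) (by fun_prop) (by fun_prop)).and <|
      decide_eq (by fun_prop) (by fun_prop)

end SD

/-! ### Soundness and completeness of the certificates. -/

theorem boundaryCert_iff {θ : Qbar} {e a : Fin n → NumCode} {c : ChainCode}
    {Y : List (ℤ × NumCode)} : BoundaryCert θ (List.ofFn e) (List.ofFn a) c Y ↔
      Y = List.ofFn fun j => (bdCoeff θ c (e j), a j) := by
  constructor
  · rintro ⟨h1, h2⟩
    obtain ⟨y, rfl, hy⟩ := exists_ofFn_of_map_eq h2
    rw [List.map_ofFn, List.map_ofFn] at h1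
    have h1 := congrFun (List.ofFn_injective h1)
    congr 1
    funext j
    exact Prod.ext (h1 j) (hy j)
  · rintro rfl
    simp only [BoundaryCert, List.map_ofFn]
    exact ⟨rfl, rfl⟩

theorem primitiveCert_iff {θ : Qbar} {d : Fin m ↪ Qbar} {dc : Fin m → NumCode}
    (hd : ∀ i, numVal θ (dc i) = d i) {P Q : PolyCode} {k : ℕ} {U : PolyCode}
    {W : Fin m → PoleCert} : PrimitiveCert θ (List.ofFn dc) P Q k U (List.ofFn W) ↔
      (∀ i, (W i).1 = dc i) ∧ (∀ i, polyVal θ (W i).2.2.1 = rootCofactor d i) ∧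
      PrimitiveIdentity d (polyVal θ P) (polyVal θ Q) k (polyVal θ U)
        fun i => numVal θ (W i).2.2.2.1 := by
  have hv := isVal_polyVal θ
  have hT : polyVal θ (rootCode (List.ofFn dc)) = rootPoly d := by
    rw [polyVal_rootCode]; simp [hd]
  have hder : ∀ V : PolyCode, polyVal θ (derivList V) = Polynomial.derivative (polyVal θ V) :=
    listVal_derivList (isVal_numVal θ)
  have hmap : (List.ofFn W).map (fun t => t.1) = List.ofFn dc ↔ ∀ i, (W i).1 = dc i := by
    rw [List.map_ofFn, List.ofFn_injective.eq_iff, funext_iff]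
    rfl
  rw [PrimitiveCert, hmap]
  refine and_congr_right fun h1 => ?_
  have hG : (∀ t ∈ List.ofFn W, polyVal θ (mul t.2.2.1 (linearCode t.1)) =
      polyVal θ (rootCode (List.ofFn dc))) ↔ ∀ i, polyVal θ (W i).2.2.1 = rootCofactor d i := by
    rw [List.forall_mem_ofFn_iff]
    refine forall_congr' fun i => ?_
    rw [hv.mul, hT, polyVal_linearCode, h1, hd, ← rootCofactor_mul d i]
    -- The certificate only gives the product with X - d_i; cancelling this nonzero factor
    -- identifies the cofactor.
    exact mul_left_inj' (Polynomial.X_sub_C_ne_zero _)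
  rw [hG]
  refine and_congr_right fun h2 => ?_
  have hsum : polyVal θ (sum ((List.ofFn W).map fun t => mul [t.2.2.2.1] t.2.2.1)) =
      ∑ i, Polynomial.C (numVal θ (W i).2.2.2.1) * rootCofactor d i := by
    rw [hv.sum, List.map_ofFn, List.map_ofFn, List.sum_ofFn]
    refine Finset.sum_congr rfl fun i _ => ?_
    simp only [Function.comp_apply]
    rw [hv.mul, polyVal_singleton, h2]
  rw [hv.mul, hv.mul, hv.add, hv.sub, hv.mul, hv.mul, hv.mul, hv.mul, hv.pow, hv.pow, hsum, hder,
    hder, hT, polyVal_singleton, numVal_intNum, PrimitiveIdentity]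
  simp

theorem logCert_iff {θ : Qbar} {E : List NumCode} {Λ : Fin m → List GaussCode} {c : ChainCode}
    {b : List ℤ} {W : Fin m → PoleCert} : LogCert θ E (List.ofFn Λ) c b (List.ofFn W) ↔
      ∀ i, (W i).2.1 = Λ i ∧ LogRelation θ c (W i).1 b E (Λ i) (W i).2.2.2.2 := by
  rw [LogCert, List.map_ofFn, List.ofFn_injective.eq_iff, funext_iff, List.forall_mem_ofFn_iff,
    ← forall_and]
  exact forall_congr' fun i => and_congr_right fun h => by rw [← h]; rfl

/-- The certificate avoids division; T does not vanish at a point of the punctured line, so the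
equation determines `v`. -/
theorem numVal_mul_pow_eq_iff {θ : Qbar} {d : Fin m ↪ Qbar} {dc : Fin m → NumCode}
    (hd : ∀ i, numVal θ (dc i) = d i) {z : NumCode} (hz : (numVal θ z : ℂ) ∈ puncturedLine d)
    (v : NumCode) (k : ℕ) (U : PolyCode) :
    numVal θ (mul v (pow (evalCode (rootCode (List.ofFn dc)) z) k)) = numVal θ (evalCode U z) ↔
      (numVal θ v : ℂ) = primVal d (polyVal θ U) k (numVal θ z) := by
  have hT : polyVal θ (rootCode (List.ofFn dc)) = rootPoly d := by
    rw [polyVal_rootCode]; simp [hd]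
  have hv := isVal_coe_numVal θ
  have h1 := hv.mul v (pow (evalCode (rootCode (List.ofFn dc)) z) k)
  have h2 := hv.pow (evalCode (rootCode (List.ofFn dc)) z) k
  simp only [numVal_evalCode, hT] at h1 h2
  rw [Subtype.ext_iff, h1, h2, numVal_evalCode, primVal,
    eq_div_iff (pow_ne_zero _ (rootPoly_eval₂_ne_zero hz))]

theorem endpointCert_sum {θ : Qbar} {d : Fin m ↪ Qbar} {dc : Fin m → NumCode}
    (hd : ∀ i, numVal θ (dc i) = d i) {c : ChainCode} {k : ℕ} {U : PolyCode}
    (hc : ∀ s ∈ c, segment ℝ (numVal θ s.2.1 : ℂ) (numVal θ s.2.2 : ℂ) ⊆ puncturedLine d)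
    {X : List SegmentCert} (h : EndpointCert θ (List.ofFn dc) c k U X) :
    (numVal θ (sum (X.map fun x => mul (intNum x.1.1) (CodeRing.sub x.2.1 x.2.2))) : ℂ) =
      (c.map fun s => (s.1 : ℂ) * (primVal d (polyVal θ U) k (numVal θ s.2.2) -
        primVal d (polyVal θ U) k (numVal θ s.2.1))).sum := by
  obtain ⟨rfl, h⟩ := h
  have hv := isVal_coe_numVal θ
  refine (hv.sum _).trans ?_
  rw [List.map_map, List.map_map]
  congr 1
  refine List.map_congr_left fun x hx => ?_
  have hs := hc _ (List.mem_map_of_mem hx)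
  have h1 := (numVal_mul_pow_eq_iff hd (hs (right_mem_segment ℝ _ _)) _ _ _).1 (h x hx).1
  have h2 := (numVal_mul_pow_eq_iff hd (hs (left_mem_segment ℝ _ _)) _ _ _).1 (h x hx).2
  have h3 := hv.mul (intNum x.1.1) (CodeRing.sub x.2.1 x.2.2)
  have h4 := hv.sub x.2.1 x.2.2
  simp only [numVal_intNum, h1, h2] at h3 h4
  simp only [Function.comp_apply]
  rw [h3, h4]
  simp

theorem exists_numVal_div (θ : Qbar) (u v : NumCode) :
    ∃ c, (numVal θ c : ℂ) = (numVal θ u : ℂ) / numVal θ v := by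
  obtain ⟨c, hc⟩ := exists_numVal_eq (div_mem (numVal_mem θ u) (numVal_mem θ v))
  exact ⟨c, by rw [hc]; rfl⟩

theorem exists_endpointCert {θ : Qbar} {d : Fin m ↪ Qbar} {dc : Fin m → NumCode}
    (hd : ∀ i, numVal θ (dc i) = d i) {c : ChainCode} (k : ℕ) (U : PolyCode)
    (hc : ∀ s ∈ c, segment ℝ (numVal θ s.2.1 : ℂ) (numVal θ s.2.2 : ℂ) ⊆ puncturedLine d) :
    ∃ X, EndpointCert θ (List.ofFn dc) c k U X := by
  have hT : polyVal θ (rootCode (List.ofFn dc)) = rootPoly d := by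
    rw [polyVal_rootCode]; simp [hd]
  -- The condition on `z` stands under the existential quantifier, so that `choose` yields a
  -- function of codes alone.
  have key : ∀ z : NumCode, ∃ v : NumCode, (numVal θ z : ℂ) ∈ puncturedLine d →
      numVal θ (mul v (pow (evalCode (rootCode (List.ofFn dc)) z) k)) =
        numVal θ (evalCode U z) := by
    intro z
    obtain ⟨v, hv⟩ := exists_numVal_div θ (evalCode U z)
      (pow (evalCode (rootCode (List.ofFn dc)) z) k)
    refine ⟨v, fun hz => (numVal_mul_pow_eq_iff hd hz v k U).2 ?_⟩
    have h2 := (isVal_coe_numVal θ).pow (evalCode (rootCode (List.ofFn dc)) z) k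
    simp only [numVal_evalCode, hT] at h2
    rw [hv, h2, numVal_evalCode, primVal]
  choose v hv using key
  refine ⟨c.map fun s => (s, v s.2.2, v s.2.1), by rw [List.map_map]; exact List.map_id c, ?_⟩
  intro x hx
  obtain ⟨s, hs, rfl⟩ := List.mem_map.1 hx
  exact ⟨hv _ (hc s hs (right_mem_segment ℝ _ _)), hv _ (hc s hs (left_mem_segment ℝ _ _))⟩

theorem ChainRepresents.boundary_mem {θ : Qbar} {d : Fin m ↪ Qbar} {e : Fin n ↪ Qbar}
    {c : ChainCode} {γ : relCycles d e} (hγ : ChainRepresents θ c γ) :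
    boundary (chainVal θ c) ∈ Finsupp.supported ℤ ℤ (Set.range fun j => (e j : ℂ)) := by
  have hc : (γ : SegmentChain) = chainVal θ c := hγ.2
  rw [← hc]
  exact γ.2.2

theorem logRelation_iff_of_chainRepresents {θ : Qbar} {d : Fin m ↪ Qbar} {e : Fin n ↪ Qbar}
    {dc : Fin m → NumCode} {ec : Fin n → NumCode} (hd : ∀ i, numVal θ (dc i) = d i)
    (he : ∀ j, numVal θ (ec j) = e j) {L : Fin m → Fin n → ℂ}
    (hL : ∀ i j, Complex.exp (L i j) = (e j : ℂ) - (d i : ℂ)) {q : Fin m → Fin n → GaussCode}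
    (hq : ∀ i j, BranchRepresents (q i j) (L i j)) {c : ChainCode} {γ : relCycles d e}
    (hγ : ChainRepresents θ c γ) (i : Fin m) (k : ℤ) :
    LogRelation θ c (dc i) (List.ofFn fun j => bdCoeff θ c (ec j)) (List.ofFn ec)
      (List.ofFn (q i)) k ↔
      (c.map fun s => (s.1 : ℂ) * Complex.log (segRatio θ (d i) s)).sum =
        ∑ j, (bdCoeff θ c (ec j) : ℂ) * L i j + k * (2 * Real.pi * Complex.I) := by
  have hexp := exp_sum_log hγ.1 hγ.boundary_mem i (hL i)
  simp only [← he, boundary_chainVal] at hexp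
  have h := logRelation_iff (θ := θ) (c := c) (d := dc i)
    (b := fun j => bdCoeff θ c (ec j)) (e := ec)
    (q := q i) (l := L i) k (fun s hs h => hγ.1 s hs h ⟨i, by rw [hd]⟩)
    (fun j => by rw [hL, he, hd]) (hq i) (by rw [hd]; exact hexp) fun s _ => by
      obtain ⟨u, hu⟩ := exists_numVal_div θ (CodeRing.sub s.2.2 (dc i)) (CodeRing.sub s.2.1 (dc i))
      have h1 := (isVal_coe_numVal θ).sub s.2.2 (dc i)
      have h2 := (isVal_coe_numVal θ).sub s.2.1 (dc i)
      exact ⟨u, by rw [hu, h1, h2]; rfl⟩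
  rw [hd] at h
  exact h

/-- The defect has exponential 1, and `k` is the integer by which it is a multiple of 2πi. -/
theorem exists_logRelation {θ : Qbar} {d : Fin m ↪ Qbar} {e : Fin n ↪ Qbar}
    {dc : Fin m → NumCode} {ec : Fin n → NumCode} (hd : ∀ i, numVal θ (dc i) = d i)
    (he : ∀ j, numVal θ (ec j) = e j) {L : Fin m → Fin n → ℂ}
    (hL : ∀ i j, Complex.exp (L i j) = (e j : ℂ) - (d i : ℂ)) {q : Fin m → Fin n → GaussCode}
    (hq : ∀ i j, BranchRepresents (q i j) (L i j)) {c : ChainCode} {γ : relCycles d e}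
    (hγ : ChainRepresents θ c γ) (i : Fin m) : ∃ k : ℤ,
    LogRelation θ c (dc i) (List.ofFn fun j => bdCoeff θ c (ec j)) (List.ofFn ec)
      (List.ofFn (q i)) k := by
  have hexp := exp_sum_log hγ.1 hγ.boundary_mem i (hL i)
  simp only [← he, boundary_chainVal] at hexp
  obtain ⟨k, hk⟩ := Complex.exp_eq_one_iff.1 hexp
  refine ⟨k, (logRelation_iff_of_chainRepresents hd he hL hq hγ i k).2 ?_⟩
  rw [← hk]
  simp only [segRatio]
  ring

theorem sum_map_finset_sum {ι κ M : Type*} [AddCommMonoid M] (l : List κ) (s : Finset ι)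
    (f : ι → κ → M) : (l.map fun x => ∑ i ∈ s, f i x).sum = ∑ i ∈ s, (l.map (f i)).sum := by
  induction l with
  | nil => simp
  | cons x l ih => simp [ih, Finset.sum_add_distrib]

/-- Sum `segmentIntegral_eq` over the segments with their multiplicities and exchange the sums over
segments and poles. -/
theorem period_eq {θ : Qbar} {d : Fin m ↪ Qbar} {e : Fin n ↪ Qbar} {ec : Fin n → NumCode}
    (he : ∀ j, numVal θ (ec j) = e j) {x : DeRhamCocycle d e} {c : ChainCode} {γ : relCycles d e}
    (hγ : ChainRepresents θ c γ) {P Q : Qbar[X]} (hQ : Q ≠ 0)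
    (hPQ : (x.2 : RatFunc Qbar) =
      algebraMap Qbar[X] (RatFunc Qbar) P / algebraMap Qbar[X] (RatFunc Qbar) Q)
    {k : ℕ} {U : Qbar[X]} {r : Fin m → Qbar} (h : PrimitiveIdentity d P Q k U r) :
    period γ x = ∑ j, (bdCoeff θ c (ec j) : ℂ) * (x.1 j : ℂ) +
      (c.map fun s => (s.1 : ℂ) *
        (primVal d U k (numVal θ s.2.2) - primVal d U k (numVal θ s.2.1))).sum +
      ∑ i, (r i : ℂ) * (c.map fun s => (s.1 : ℂ) * Complex.log (segRatio θ (d i) s)).sum := by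
  have hc : (γ : SegmentChain) = chainVal θ c := hγ.2
  rw [period, evalZeroChain, hc, chainIntegral_chainVal, add_assoc]
  simp only [← he, boundary_chainVal]
  congr 1
  simp only [← List.sum_map_mul_left]
  rw [← sum_map_finset_sum, ← List.sum_map_add]
  congr 1
  refine List.map_congr_left fun s hs => ?_
  rw [segmentIntegral_eq x.2.2 hQ hPQ h (hγ.1 s hs), mul_add, Finset.mul_sum]
  congr 1
  refine Finset.sum_congr rfl fun i _ => ?_
  rw [segRatio]
  ring

/-- Soundness: in `period_eq`, the sum of logarithms at each pole is replaced by the combination of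
branches and the multiple of 2πi that the certificate provides. -/
theorem Certifies.standardFormRepresents {θ : Qbar} {d : Fin m ↪ Qbar} {e : Fin n ↪ Qbar}
    {dc : Fin m → NumCode} {ec : Fin n → NumCode} (hd : ∀ i, numVal θ (dc i) = d i)
    (he : ∀ j, numVal θ (ec j) = e j) {L : Fin m → Fin n → ℂ}
    (hL : ∀ i j, Complex.exp (L i j) = (e j : ℂ) - (d i : ℂ)) {q : Fin m → Fin n → GaussCode}
    (hq : ∀ i j, BranchRepresents (q i j) (L i j)) {f : FormCode} {x : DeRhamCocycle d e}
    (hx : FormRepresents θ f x) {c : ChainCode} {γ : relCycles d e} (hγ : ChainRepresents θ c γ)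
    {z : StandardFormCode} {t : PeriodCert} (h : Certifies θ (List.ofFn dc) (List.ofFn ec)
      (List.ofFn fun i => List.ofFn (q i)) f c z t) :
    StandardFormRepresents θ L z (period γ x) := by
  obtain ⟨⟨k, U⟩, W, X, Y⟩ := t
  obtain ⟨hY, hP, hW, hX, rfl⟩ := h
  obtain ⟨a, P, Q⟩ := f
  obtain ⟨ha, hQ, hPQ⟩ := hx
  obtain ⟨a, rfl, ha'⟩ := listRepresents_iff.1 ha
  rw [boundaryCert_iff] at hY
  subst hY
  obtain ⟨W, rfl, -⟩ := exists_ofFn_of_map_eq hP.1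
  obtain ⟨h1, -, h3⟩ := (primitiveCert_iff hd).1 hP
  have h4 := logCert_iff.1 hW
  have h5 := endpointCert_sum hd hγ.1 hX
  have hv := isVal_coe_numVal θ
  simp only [NumRepresents] at ha'
  refine ⟨fun i j => numVal θ (W i).2.2.2.1 * (bdCoeff θ c (ec j) : ℤ), ?_, ?_⟩
  · simp only [entryCode, List.map_ofFn]
    refine listRepresents_ofFn.2 fun i => listRepresents_ofFn.2 fun j => ?_
    simp only [Function.comp_apply, NumRepresents]
    rw [(isVal_numVal θ).mul, numVal_intNum]
  · have e1 := hv.add (sum ((List.ofFn fun j => (bdCoeff θ c (ec j), a j)).map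
      fun y => mul (intNum y.1) y.2)) (sum (X.map fun x => mul (intNum x.1.1)
        (CodeRing.sub x.2.1 x.2.2)))
    have e2 : (numVal θ (sum ((List.ofFn fun j => (bdCoeff θ c (ec j), a j)).map
        fun y => mul (intNum y.1) y.2)) : ℂ) =
        ∑ j, (bdCoeff θ c (ec j) : ℂ) * (x.1 j : ℂ) := by
      refine (hv.sum _).trans ?_
      rw [List.map_ofFn, List.map_ofFn, List.sum_ofFn]
      refine Finset.sum_congr rfl fun j _ => ?_
      refine (hv.mul _ _).trans ?_
      simp [numVal_intNum, ha']
    have e3 : (numVal θ (sum ((List.ofFn W).map fun t => mul t.2.2.2.1 (intNum t.2.2.2.2))) : ℂ) =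
        ∑ i, (numVal θ (W i).2.2.2.1 : ℂ) * ((W i).2.2.2.2 : ℂ) := by
      refine (hv.sum _).trans ?_
      rw [List.map_ofFn, List.map_ofFn, List.sum_ofFn]
      refine Finset.sum_congr rfl fun j _ => ?_
      refine (hv.mul _ _).trans ?_
      simp [numVal_intNum]
    have e4 : ∀ i, (c.map fun s => (s.1 : ℂ) * Complex.log (segRatio θ (d i) s)).sum =
        ∑ j, (bdCoeff θ c (ec j) : ℂ) * L i j + (W i).2.2.2.2 * (2 * Real.pi * Complex.I) := by
      intro i
      have := (h4 i).2
      rw [h1 i, List.map_ofFn] at this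
      exact (logRelation_iff_of_chainRepresents hd he hL hq hγ i _).1 this
    rw [period_eq he hγ hQ hPQ h3]
    simp only [entryCode]
    rw [e1, e2, e3, h5]
    simp only [e4]
    rw [Finset.sum_mul, add_assoc, add_assoc, add_assoc, ← Finset.sum_add_distrib]
    congr 2
    refine Finset.sum_congr rfl fun i _ => ?_
    push_cast
    rw [mul_add, Finset.mul_sum, add_comm]
    congr 1
    · ring
    · exact Finset.sum_congr rfl fun j _ => (mul_assoc _ _ _).symm

/-- Completeness: Hermite reduction, the integers of the logarithmic relations and the values at the
end points all have codes, as ℚ(θ) is closed under the operations used. -/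
theorem exists_certifies {θ : Qbar} {d : Fin m ↪ Qbar} {e : Fin n ↪ Qbar}
    {dc : Fin m → NumCode} {ec : Fin n → NumCode} (hd : ∀ i, numVal θ (dc i) = d i)
    (he : ∀ j, numVal θ (ec j) = e j) {L : Fin m → Fin n → ℂ}
    (hL : ∀ i j, Complex.exp (L i j) = (e j : ℂ) - (d i : ℂ)) {q : Fin m → Fin n → GaussCode}
    (hq : ∀ i j, BranchRepresents (q i j) (L i j)) {f : FormCode} {x : DeRhamCocycle d e}
    (hx : FormRepresents θ f x) {c : ChainCode} {γ : relCycles d e} (hγ : ChainRepresents θ c γ) :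
    ∃ z t, Certifies θ (List.ofFn dc) (List.ofFn ec) (List.ofFn fun i => List.ofFn (q i)) f c z
      t := by
  obtain ⟨a, P, Q⟩ := f
  obtain ⟨ha, hQ, hPQ⟩ := hx
  obtain ⟨a, rfl, ha'⟩ := listRepresents_iff.1 ha
  obtain ⟨k, U, r, G, hP, hG⟩ := exists_primitiveIdentity x.2.2 hd hQ hPQ
  choose N hN using exists_logRelation hd he hL hq hγ
  obtain ⟨X, hX⟩ := exists_endpointCert hd k U hγ.1
  refine ⟨_, ((k, U), List.ofFn fun i => (dc i, List.ofFn (q i), G i, r i, N i), X, _),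
    boundaryCert_iff.2 rfl, (primitiveCert_iff hd).2 ⟨fun _ => rfl, hG, hP⟩,
    logCert_iff.2 fun i => ⟨rfl, ?_⟩, hX, rfl⟩
  change LogRelation θ c (dc i) ((List.ofFn fun j => (bdCoeff θ c (ec j), a j)).map fun y => y.1)
    (List.ofFn ec) (List.ofFn (q i)) (N i)
  rw [List.map_ofFn]
  exact hN i

/-- The matrix `M` consists of certified periods. -/
def MatrixCert (θ : Qbar) (x : InputCode) (M : MatrixCode) : Prop :=
  List.Forall₂ (fun c row => List.Forall₂ (fun f z =>
    ∃ t, Certifies θ x.2.1 x.2.2.1 x.2.2.2.1 f c z t) x.2.2.2.2.1 row) x.2.2.2.2.2 M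

set_option synthInstance.maxHeartbeats 200000 in
set_option synthInstance.maxSize 1024 in
theorem SD.matrixCert : SD fun θ (p : InputCode × MatrixCode) => MatrixCert θ p.1 p.2 := by
  refine forall₂ (β := InputCode × MatrixCode)
    (Φ := fun θ (p : (InputCode × MatrixCode) × ChainCode × List StandardFormCode) =>
      List.Forall₂ (fun f z => ∃ t, Certifies θ p.1.1.2.1 p.1.1.2.2.1 p.1.1.2.2.2.1 f p.2.1 z t)
        p.1.1.2.2.2.2.1 p.2.2) ?_ (by fun_prop) (by fun_prop)
  refine forall₂ (Φ := fun θ (p : ((InputCode × MatrixCode) × ChainCode × List StandardFormCode) ×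
    FormCode × StandardFormCode) => ∃ t, Certifies θ p.1.1.1.2.1 p.1.1.1.2.2.1 p.1.1.1.2.2.2.1
      p.2.1 p.1.2.1 p.2.2 t) ?_ (by fun_prop) (by fun_prop)
  exact exists_certifies (by fun_prop) (by fun_prop) (by fun_prop) (by fun_prop) (by fun_prop)
    (by fun_prop)

theorem forall₂_ofFn_left {α β : Type} {k : ℕ} {R : α → β → Prop} {v : Fin k → α} {l : List β} :
    List.Forall₂ R (List.ofFn v) l ↔ ∃ w : Fin k → β, l = List.ofFn w ∧ ∀ i, R (v i) (w i) := by
  have h := listRepresents_iff (R := fun b a => R a b) (l := l) (v := v)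
  exact ⟨fun h' => h.1 h'.flip, fun h' => (h.2 h').flip⟩

end BakerPeriod

end

theorem mainTheorem9 :
    ∃ A : BakerPeriod.InputCode →. BakerPeriod.MatrixCode, Partrec A ∧
      ∀ (m n k l : ℕ) (d : Fin m ↪ BakerPeriod.Qbar) (e : Fin n ↪ BakerPeriod.Qbar)
        (_hde : ∀ i j, d i ≠ e j)
        (L : Fin m → Fin n → ℂ)
        (_hL : ∀ i j, Complex.exp (L i j) = (e j : ℂ) - (d i : ℂ))
        (ω : Fin k → BakerPeriod.DeRhamCocycle d e) (γ : Fin l → BakerPeriod.relCycles d e)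
        (θ : BakerPeriod.Qbar) (x : BakerPeriod.InputCode),
        BakerPeriod.InputRepresents x θ d e L ω γ →
          ∃ M ∈ A x, BakerPeriod.ListRepresents
            (fun row v => BakerPeriod.ListRepresents
              (BakerPeriod.StandardFormRepresents θ L) row v) M
            (fun s r => BakerPeriod.periodPairing d e
              (Submodule.Quotient.mk (γ s)) (Submodule.Quotient.mk (ω r))) := by
  open BakerPeriod in
  -- One function searches for a certified matrix, for all inputs and all fields at once.
  obtain ⟨A, hA, hspec⟩ := SD.exists_partrec SD.matrixCert
    (field := fun x : InputCode => x.1) (by fun_prop)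
  refine ⟨A, hA, ?_⟩
  rintro m n k l d e - L hL ω γ θ ⟨F, D, E, Λ, fs, cs⟩ ⟨hF, hD, hE, hΛ, hf, hc⟩
  obtain ⟨D, rfl, hD'⟩ := listRepresents_iff.1 hD
  obtain ⟨E, rfl, hE'⟩ := listRepresents_iff.1 hE
  obtain ⟨Λ, rfl, hΛ'⟩ := listRepresents_iff.1 hΛ
  obtain ⟨fs, rfl, hf'⟩ := listRepresents_iff.1 hf
  obtain ⟨cs, rfl, hc'⟩ := listRepresents_iff.1 hc
  choose q hq hqL using fun i => listRepresents_iff.1 (hΛ' i)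
  have hΛ₀ : Λ = fun i => List.ofFn (q i) := funext hq
  clear hΛ hΛ' hq
  subst hΛ₀
  -- Completeness, entry by entry, makes the search terminate.
  have hex : ∃ M, MatrixCert θ (F, List.ofFn D, List.ofFn E, List.ofFn fun i => List.ofFn (q i),
      List.ofFn fs, List.ofFn cs) M := by
    choose z t ht using fun s r => exists_certifies hD' hE' hL hqL (hf' r) (hc' s)
    exact ⟨List.ofFn fun s => List.ofFn fun r => z s r, forall₂_ofFn_left.2 ⟨_, rfl, fun s =>
      forall₂_ofFn_left.2 ⟨_, rfl, fun r => ⟨t s r, ht s r⟩⟩⟩⟩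
  -- The matrix returned may differ from the one just constructed; only its certificates are used
  -- from here on.
  obtain ⟨M, hM, hcert⟩ := hspec _ θ hF hex
  refine ⟨M, hM, ?_⟩
  obtain ⟨rows, rfl, hrows⟩ := forall₂_ofFn_left.1 hcert
  refine listRepresents_ofFn.2 fun s => ?_
  obtain ⟨w, hw, hz⟩ := forall₂_ofFn_left.1 (hrows s)
  rw [hw]
  refine listRepresents_ofFn.2 fun r => ?_
  obtain ⟨t, ht⟩ := hz r
  rw [periodPairing_mk]
  exact ht.standardFormRepresents hD' hE' hL hqL (hf' r) (hc' s)
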